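/- **Notation.** Bicomplex numbers are $w=u+vj$ with $u,v\in\mathbb C$, where $j^2=1$ and $j$ commutes with $i$; put $\mathcal R(w)=u$, $\mathcal I(w)=v$, $\overline w=u-vj$, $w^{\pm}=u\pm v$, $P^{\pm}=\frac12(1\pm j)$ and $\partial_{\bar z}=\frac12(\partial_\xi-j\partial_t)$. Let $P_n(x)=\sum_{k=0}^n l_{k,n}x^k$ be the Legendre polynomials. For a nonvanishing real function $f$ with $f(0)=1$ define $X^{(0)}=\widetilde X^{(0)}=1$ and, for $n\ge1$, $$X^{(n)}(\xi)=n\int_0^\xi X^{(n-1)}(s)\,(f^2(s))^{(-1)^n}ds,\qquad \widetilde X^{(n)}(\xi)=n\int_0^\xi \widetilde X^{(n-1)}(s)\,(f^2(s))^{(-1)^{n-1}}ds ;$$ $\varphi_k=fX^{(k)}$, $\psi_k=\widetilde X^{(k)}/f$ for odd $k$ and $\varphi_k=f\widetilde X^{(k)}$, $\psi_k=X^{(k)}/f$ for even $k$; and $$a_n(\xi)=\tfrac{2n+1}{2}\Bigl(\sum_{k=0}^n\frac{l_{k,n}\varphi_k(\xi)}{\xi^k}-1\Bigr),\qquad b_n(\xi)=\tfrac{2n+1}{2}\Bigl(\sum_{k=0}^n\frac{l_{k,n}\psi_k(\xi)}{\xi^k}-1\Bigr).$$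 **Theorem.** (1) Let $L>0$, $\alpha<\beta$, let $f\in C^1([0,L],\mathbb R)$ be nonvanishing with $f(0)=1$, and let $W_0$ be a continuously differentiable bicomplex-valued function on $[\alpha,\beta]$. Let $D=\{(\xi,t):0\le\xi\le L,\ \alpha\le t-\xi,\ t+\xi\le\beta\}$. Among the functions continuous on $D$ and $C^1$ in its interior, the problem $$\partial_{\bar z}W-\frac{f'}{2f}\,\overline W=0\ \text{ in the interior of } D,\qquad W(0,t)=W_0(t),\ t\in[\alpha,\beta],$$ has exactly one solution $W$. It is $C^1$ on $D$, and for all $(\xi,t)\in D$ with $\xi>0$ $$\begin{aligned}W(\xi,t)&=\tfrac12\bigl(W_0^+(t+\xi)+W_0^-(t-\xi)\bigr)+\tfrac12\sum_{n=0}^\infty\frac{a_n(\xi)}{\xi}\int_{-\xi}^{\xi}P_n\bigl(\tfrac\tau\xi\bigr)\bigl(W_0^+(t+\tau)+W_0^-(t-\tau)\bigr)d\tau\\ &\quad+\tfrac j2\bigl(W_0^+(t+\xi)-W_0^-(t-\xi)\bigr)+\tfrac j2\sum_{n=0}^\infty\frac{b_n(\xi)}{\xi}\int_{-\xi}^{\xi}P_n\bigl(\tfrac\tau\xi\bigr)\bigl(W_0^+(t+\tau)-W_0^-(t-\tau)\bigr)d\tau\\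 &=P^+W_0^+(t+\xi)+P^-W_0^-(t-\xi)+\frac1{2\xi}\sum_{n=0}^\infty\bigl(a_n(\xi)+jb_n(\xi)\bigr)\int_{-\xi}^{\xi}P_n\bigl(\tfrac\tau\xi\bigr)W_0^+(t+\tau)\,d\tau\\ &\quad+\frac1{2\xi}\sum_{n=0}^\infty\bigl(a_n(\xi)-jb_n(\xi)\bigr)\int_{-\xi}^{\xi}P_n\bigl(\tfrac\tau\xi\bigr)W_0^-(t-\tau)\,d\tau,\end{aligned}$$ where all four series converge absolutely. (2) Let $b>0$, $\mu>0$, $\alpha<\beta$, let $\varepsilon\in C^1([0,b])$ be positive, and let $\mathcal E_0,\mathcal H_0:[\alpha,\beta]\to\mathbb C$ be continuously differentiable. Put $c(x)=1/\sqrt{\varepsilon(x)\mu}$, $\xi(x)=\sqrt\mu\int_0^x\sqrt{\varepsilon(s)}\,ds$, $\widetilde c(\xi(x))=c(x)$, $f(\xi)=\sqrt{\widetilde c(0)}/\sqrt{\widetilde c(\xi)}$ for $0\le\xi\le L:=\xi(b)$, and $W_0=\sqrt{c(0)\varepsilon(0)}\,\mathcal E_0+ij\sqrt{c(0)\mu}\,\mathcal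 H_0$. Let $M=\{(x,t):0\le x\le b,\ \alpha\le t-\xi(x),\ t+\xi(x)\le\beta\}$. Among the pairs of complex-valued functions continuous on $M$ and $C^1$ in its interior, the Maxwell problem $$\varepsilon(x)\partial_t\mathcal E=i\partial_x\mathcal H,\quad i\partial_x\mathcal E=-\mu\partial_t\mathcal H\ \text{ in the interior of } M,\qquad \mathcal E(0,t)=\mathcal E_0(t),\ \mathcal H(0,t)=\mathcal H_0(t),\ t\in[\alpha,\beta],$$ has exactly one solution. It is $C^1$ on $M$ and is given by $$\mathcal E(x,t)=\frac{1}{\sqrt{c(x)\varepsilon(x)}}\,\mathcal R\bigl(W(\xi(x),t)\bigr),\qquad \mathcal H(x,t)=-\frac{i}{\sqrt{c(x)\mu}}\,\mathcal I\bigl(W(\xi(x),t)\bigr),\qquad (x,t)\in M,$$ where $W$ is the solution from (1) for these $f$, $W_0$ and $L$, so that the series representations above hold for it. -/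

import Mathlib

/-- Bicomplex numbers `u + v j` with `u v : ℂ` and `j ^ 2 = 1`; `re` and `im` are the components
`u` and `v`, and `ω` is `j`. -/
abbrev Bicomplex : Type := QuadraticAlgebra ℂ 1 0

namespace Bicomplex

/-- The pair of components `(u, v)` of `u + v j`. -/
def toProd : Bicomplex →ₗ[ℂ] ℂ × ℂ where
  toFun w := (w.re, w.im)
  map_add' _ _ := rfl
  map_smul' _ _ := rfl

theorem toProd_injective : Function.Injective toProd := by
  intro a b h
  exact QuadraticAlgebra.ext (congrArg Prod.fst h) (congrArg Prod.snd h)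

/-- The norm `max |u| |v|`; it induces the usual topology of the real vector space
`Bicomplex ≅ ℝ⁴`. -/
noncomputable instance : NormedAddCommGroup Bicomplex :=
  NormedAddCommGroup.induced Bicomplex (ℂ × ℂ) toProd toProd_injective

noncomputable instance : NormedSpace ℂ Bicomplex :=
  NormedSpace.induced ℂ Bicomplex (ℂ × ℂ) toProd

noncomputable instance : NormedSpace ℝ Bicomplex :=
  NormedSpace.induced ℝ Bicomplex (ℂ × ℂ) (toProd.restrictScalars ℝ)

/-- The hyperbolic imaginary unit `j`. -/
def j : Bicomplex := ⟨0, 1⟩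

/-- The embedding of `ℂ`. -/
def ofComplex (z : ℂ) : Bicomplex := ⟨z, 0⟩

theorem j_mul_j : j * j = 1 := by
  ext <;> simp [j] <;> rfl

theorem eq_re_add_im_mul_j (w : Bicomplex) : w = ofComplex w.re + ofComplex w.im * j := by
  ext <;> simp [j, ofComplex]

/-- The conjugation `u + v j ↦ u - v j`. -/
def conj (w : Bicomplex) : Bicomplex := ⟨w.re, -w.im⟩

/-- `w⁺ = u + v`. -/
def plus (w : Bicomplex) : ℂ := w.re + w.im

/-- `w⁻ = u - v`. -/
def minus (w : Bicomplex) : ℂ := w.re - w.im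

/-- `P⁺ = (1 + j) / 2`. -/
noncomputable def projPlus : Bicomplex := ofComplex (1 / 2) * (1 + j)

/-- `P⁻ = (1 - j) / 2`. -/
noncomputable def projMinus : Bicomplex := ofComplex (1 / 2) * (1 - j)

end Bicomplex

namespace Vekua

open Bicomplex

/-- The Legendre polynomial of order `n` (Rodrigues' formula). -/
noncomputable def legendre (n : ℕ) : Polynomial ℝ :=
  Polynomial.C (1 / ((2 : ℝ) ^ n * (n.factorial : ℝ))) *
    (Polynomial.derivative^[n] ((Polynomial.X ^ 2 - 1) ^ n))

/-- The recursive integrals `X⁽ⁿ⁾`. -/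
noncomputable def recX (f : ℝ → ℝ) : ℕ → ℝ → ℝ
  | 0 => fun _ => 1
  | n + 1 => fun ξ =>
      ((n + 1 : ℕ) : ℝ) * ∫ s in (0 : ℝ)..ξ, recX f n s * (f s ^ 2) ^ ((-1 : ℤ) ^ (n + 1))

/-- The recursive integrals `X̃⁽ⁿ⁾`. -/
noncomputable def recXt (f : ℝ → ℝ) : ℕ → ℝ → ℝ
  | 0 => fun _ => 1
  | n + 1 => fun ξ =>
      ((n + 1 : ℕ) : ℝ) * ∫ s in (0 : ℝ)..ξ, recXt f n s * (f s ^ 2) ^ ((-1 : ℤ) ^ n)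

noncomputable def phi (f : ℝ → ℝ) (k : ℕ) (ξ : ℝ) : ℝ :=
  if Odd k then f ξ * recX f k ξ else f ξ * recXt f k ξ

noncomputable def psi (f : ℝ → ℝ) (k : ℕ) (ξ : ℝ) : ℝ :=
  if Odd k then recXt f k ξ / f ξ else recX f k ξ / f ξ

noncomputable def coeffA (f : ℝ → ℝ) (n : ℕ) (ξ : ℝ) : ℝ :=
  (2 * (n : ℝ) + 1) / 2 *
    ((∑ k ∈ Finset.range (n + 1), (legendre n).coeff k * phi f k ξ / ξ ^ k) - 1)

noncomputable def coeffB (f : ℝ → ℝ) (n : ℕ) (ξ : ℝ) : ℝ :=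
  (2 * (n : ℝ) + 1) / 2 *
    ((∑ k ∈ Finset.range (n + 1), (legendre n).coeff k * psi f k ξ / ξ ^ k) - 1)

/-- `∫_{-ξ}^{ξ} P_n(τ/ξ) g(τ) dτ`. -/
noncomputable def legendreIntegral (n : ℕ) (ξ : ℝ) (g : ℝ → ℂ) : ℂ :=
  ∫ τ in (-ξ)..ξ, (((legendre n).eval (τ / ξ) : ℝ) : ℂ) * g τ

/-- The part of the layer `0 ≤ ξ ≤ L` in which the data given on `ξ = 0`, `α ≤ t ≤ β` determine the
solution: both characteristics `t ± ξ = const` through the point meet the line `ξ = 0` in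
`[α, β]`. -/
def domain (L α β : ℝ) : Set (ℝ × ℝ) :=
  {p | 0 ≤ p.1 ∧ p.1 ≤ L ∧ α ≤ p.2 - p.1 ∧ p.2 + p.1 ≤ β}

/-- The interior of `domain L α β`. -/
def openDomain (L α β : ℝ) : Set (ℝ × ℝ) :=
  {p | 0 < p.1 ∧ p.1 < L ∧ α < p.2 - p.1 ∧ p.2 + p.1 < β}

/-- `∂_{z̄} W = (∂_ξ W - j ∂_t W) / 2`. -/
noncomputable def dbar (W : ℝ → ℝ → Bicomplex) (ξ t : ℝ) : Bicomplex :=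
  ofComplex (1 / 2) * (deriv (fun s => W s t) ξ - j * deriv (fun s => W ξ s) t)

/-- `W` is a classical solution of `∂_{z̄} W - f' / (2 f) W̄ = 0` with `W(0, t) = W₀(t)` on
`[α, β]`: continuous up to the boundary, `C¹` and satisfying the equation inside. -/
structure IsSolution (f : ℝ → ℝ) (L α β : ℝ) (W₀ : ℝ → Bicomplex) (W : ℝ → ℝ → Bicomplex) :
    Prop where
  continuousOn : ContinuousOn (Function.uncurry W) (domain L α β)
  contDiffOn : ContDiffOn ℝ 1 (Function.uncurry W) (openDomain L α β)
  equation : ∀ ξ t : ℝ, (ξ, t) ∈ openDomain L α β →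
    dbar W ξ t - ofComplex ((deriv f ξ / (2 * f ξ) : ℝ) : ℂ) * conj (W ξ t) = 0
  initial : ∀ t ∈ Set.Icc α β, W 0 t = W₀ t

section Series

variable (f : ℝ → ℝ) (W₀ : ℝ → Bicomplex) (ξ t : ℝ)

/-- Terms of the series with coefficients `a_n` alone. -/
noncomputable def termA (n : ℕ) : ℂ :=
  ((coeffA f n ξ / ξ : ℝ) : ℂ) *
    legendreIntegral n ξ (fun τ => plus (W₀ (t + τ)) + minus (W₀ (t - τ)))

/-- Terms of the series with coefficients `b_n` alone. -/
noncomputable def termB (n : ℕ) : ℂ :=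
  ((coeffB f n ξ / ξ : ℝ) : ℂ) *
    legendreIntegral n ξ (fun τ => plus (W₀ (t + τ)) - minus (W₀ (t - τ)))

/-- Terms of the series with coefficients `a_n + j b_n`. -/
noncomputable def termPlus (n : ℕ) : Bicomplex :=
  (ofComplex (coeffA f n ξ : ℂ) + j * ofComplex (coeffB f n ξ : ℂ)) *
    ofComplex (legendreIntegral n ξ (fun τ => plus (W₀ (t + τ))))

/-- Terms of the series with coefficients `a_n - j b_n`. -/
noncomputable def termMinus (n : ℕ) : Bicomplex :=
  (ofComplex (coeffA f n ξ : ℂ) - j * ofComplex (coeffB f n ξ : ℂ)) *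
    ofComplex (legendreIntegral n ξ (fun τ => minus (W₀ (t - τ))))

/-- The representation separated into real and imaginary (with respect to `j`) parts. -/
noncomputable def splitForm : Bicomplex :=
  ofComplex (1 / 2 * (plus (W₀ (t + ξ)) + minus (W₀ (t - ξ))) + 1 / 2 * ∑' n, termA f W₀ ξ t n) +
    j * ofComplex
      (1 / 2 * (plus (W₀ (t + ξ)) - minus (W₀ (t - ξ))) + 1 / 2 * ∑' n, termB f W₀ ξ t n)

/-- The representation with the idempotents `P⁺`, `P⁻` and the coefficients `a_n ± j b_n`. -/
noncomputable def idempotentForm : Bicomplex :=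
  projPlus * ofComplex (plus (W₀ (t + ξ))) + projMinus * ofComplex (minus (W₀ (t - ξ))) +
    ofComplex ((1 / (2 * ξ) : ℝ) : ℂ) * ∑' n, termPlus f W₀ ξ t n +
    ofComplex ((1 / (2 * ξ) : ℝ) : ℂ) * ∑' n, termMinus f W₀ ξ t n

/-- All four series converge (absolutely) at `(ξ, t)`. -/
def SeriesConverge : Prop :=
  Summable (termA f W₀ ξ t) ∧ Summable (termB f W₀ ξ t) ∧
    Summable (termPlus f W₀ ξ t) ∧ Summable (termMinus f W₀ ξ t)

end Series

/-- `W` is given by the two series representations at all points of the domain with `ξ > 0`. -/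
def HasSeriesForm (f : ℝ → ℝ) (L α β : ℝ) (W₀ : ℝ → Bicomplex) (W : ℝ → ℝ → Bicomplex) : Prop :=
  ∀ ξ t : ℝ, (ξ, t) ∈ domain L α β → 0 < ξ →
    SeriesConverge f W₀ ξ t ∧ W ξ t = splitForm f W₀ ξ t ∧ W ξ t = idempotentForm f W₀ ξ t

end Vekua

namespace Maxwell

open Bicomplex

/-- The wave speed `c(x) = 1 / √(ε(x) μ)`. -/
noncomputable def speed (ε : ℝ → ℝ) (μ x : ℝ) : ℝ := 1 / √(ε x * μ)

/-- The new variable `ξ(x) = √μ ∫₀ˣ √ε(s) ds`. -/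
noncomputable def xi (ε : ℝ → ℝ) (μ x : ℝ) : ℝ := √μ * ∫ s in (0 : ℝ)..x, √(ε s)

/-- The inverse change of variable `ξ ↦ x`, from `[0, ξ(b)]` to `[0, b]`. -/
noncomputable def xiInv (ε : ℝ → ℝ) (μ b : ℝ) : ℝ → ℝ :=
  Function.invFunOn (xi ε μ) (Set.Icc 0 b)

/-- `f(ξ) = √c̃(0) / √c̃(ξ)`, where `c̃(ξ(x)) = c(x)`. -/
noncomputable def vekuaF (ε : ℝ → ℝ) (μ b ξ : ℝ) : ℝ :=
  √(speed ε μ (xiInv ε μ b 0)) / √(speed ε μ (xiInv ε μ b ξ))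

/-- The initial data `√(c(0) ε(0)) E₀ + i j √(c(0) μ) H₀`. -/
noncomputable def vekuaData (ε : ℝ → ℝ) (μ : ℝ) (E₀ H₀ : ℝ → ℂ) (t : ℝ) : Bicomplex :=
  ofComplex ((√(speed ε μ 0 * ε 0) : ℂ) * E₀ t) +
    ofComplex Complex.I * j * ofComplex ((√(speed ε μ 0 * μ) : ℂ) * H₀ t)

/-- The domain of determinacy in the variables `(x, t)`. -/
def domain (ε : ℝ → ℝ) (μ b α β : ℝ) : Set (ℝ × ℝ) :=
  {p | 0 ≤ p.1 ∧ p.1 ≤ b ∧ α ≤ p.2 - xi ε μ p.1 ∧ p.2 + xi ε μ p.1 ≤ β}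

/-- The interior of `domain ε μ b α β`. -/
def openDomain (ε : ℝ → ℝ) (μ b α β : ℝ) : Set (ℝ × ℝ) :=
  {p | 0 < p.1 ∧ p.1 < b ∧ α < p.2 - xi ε μ p.1 ∧ p.2 + xi ε μ p.1 < β}

/-- `E`, `H` form a classical solution of `ε ∂_t E = i ∂_x H`, `i ∂_x E = -μ ∂_t H` with
`E(0, t) = E₀(t)`, `H(0, t) = H₀(t)` on `[α, β]`. -/
structure IsSolution (ε : ℝ → ℝ) (μ b α β : ℝ) (E₀ H₀ : ℝ → ℂ) (E H : ℝ → ℝ → ℂ) : Prop where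
  continuousOn_E : ContinuousOn (Function.uncurry E) (domain ε μ b α β)
  continuousOn_H : ContinuousOn (Function.uncurry H) (domain ε μ b α β)
  contDiffOn_E : ContDiffOn ℝ 1 (Function.uncurry E) (openDomain ε μ b α β)
  contDiffOn_H : ContDiffOn ℝ 1 (Function.uncurry H) (openDomain ε μ b α β)
  equation_E : ∀ x t : ℝ, (x, t) ∈ openDomain ε μ b α β →
    (ε x : ℂ) * deriv (fun s => E x s) t = Complex.I * deriv (fun s => H s t) x
  equation_H : ∀ x t : ℝ, (x, t) ∈ openDomain ε μ b α β →
    Complex.I * deriv (fun s => E s t) x = -(μ : ℂ) * deriv (fun s => H x s) t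
  initial_E : ∀ t ∈ Set.Icc α β, E 0 t = E₀ t
  initial_H : ∀ t ∈ Set.Icc α β, H 0 t = H₀ t

end Maxwell

/-! With q = f'/f, the idempotent components of the Vekua equation are (∂_ξ - ∂_t)W⁺ = qW⁻ and (∂_ξ
+ ∂_t)W⁻ = qW⁺. Integrated along t ± ξ = const they form a coupled pair of Volterra equations. A
Gronwall argument with weight exp(2Qξ), |q| ≤ Q, yields uniqueness (`IsSolution.eqOn`) and all
estimates.

For data 2pP⁺ with p a polynomial the solution u + jv is explicit: u = Σ p^(k)(t)/k! · φ_k(ξ), and v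
is the same sum with ψ_k. This works because φ_k' = qφ_k + kψ_{k-1} (`hasDerivAt_phi_succ`) and
because ψ_k is φ_k for 1/f. The Volterra equations give |u(ξ,t) - p(t+ξ)| ≤ C∫|p| over the base
[t-ξ, t+ξ] of the characteristic triangle (`abs_polySol_sub_le`). This one bound is used twice.

It makes p ↦ u continuous in the sup norm, so u extends to continuous data by Weierstrass
approximation. Approximation in the C¹ norm carries the formula for the gradient along, which gives
a C¹ solution (`exists_isExtension`, `IsExtension.contDiffOn`).

It also makes p ↦ u(ξ,t) - p(t+ξ) a functional bounded in L¹, as if given by a bounded kernel,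
although no kernel is constructed. Legendre partial sums of continuous data converge in mean, so the
functional may be applied term by term (`hasSum_legendreCoeff`). Its value on P_n(τ/ξ), taken at t =
0, is Σ l_{k,n}φ_k(ξ)/ξ^k - 1, whence a_n; replacing f by 1/f gives b_n. Convergence is
unconditional, which in finite dimension means absolute. Data along P⁻ are reached by the reflection
t ↦ -t.

For Maxwell, put a = √(cε) and σ = ξ'(x). Then ε = σa² and μ = σ/a², and u = aE, v = iH/a in the
variable ξ satisfy the Vekua equation with f = a/a(0). The substitution is used in one direction for
existence and in the other for uniqueness. -/

namespace Vekua

/-! ### Legendre polynomials and mean convergence of Legendre series -/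

open Polynomial

/-- Integration by parts for polynomials on `[-1, 1]`. -/
theorem integral_eval_derivative_mul (p q : ℝ[X]) :
    ∫ x in (-1 : ℝ)..1, (derivative p).eval x * q.eval x =
      p.eval 1 * q.eval 1 - p.eval (-1) * q.eval (-1) -
        ∫ x in (-1 : ℝ)..1, p.eval x * (derivative q).eval x := by
  have h := intervalIntegral.integral_mul_deriv_eq_deriv_mul (a := -1) (b := 1)
    (fun x _ => q.hasDerivAt x) (fun x _ => p.hasDerivAt x)
    ((derivative q).continuous.intervalIntegrable _ _)
    ((derivative p).continuous.intervalIntegrable _ _)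
  simp only [mul_comm] at h ⊢
  exact h

theorem eval_iterate_derivative_sq_sub_one_pow {n k : ℕ} (hk : k < n) {a : ℝ} (ha : a ^ 2 = 1) :
    (derivative^[k] ((X ^ 2 - 1 : ℝ[X]) ^ n)).eval a = 0 := by
  obtain ⟨r, hr⟩ := pow_sub_dvd_iterate_derivative_pow (X ^ 2 - 1 : ℝ[X]) n k
  rw [hr, eval_mul, eval_pow]
  have : n - k ≠ 0 := by omega
  simp [ha, this]

/-- Each integration by parts has vanishing boundary terms: derivatives of order less than n of (x²
- 1)^n keep a factor x² - 1. -/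
theorem integral_iterate_derivative_mul {n k : ℕ} (hk : k ≤ n) (q : ℝ[X]) :
    ∫ x in (-1 : ℝ)..1, (derivative^[k] ((X ^ 2 - 1 : ℝ[X]) ^ n)).eval x * q.eval x =
      (-1) ^ k * ∫ x in (-1 : ℝ)..1,
        ((X ^ 2 - 1 : ℝ[X]) ^ n).eval x * (derivative^[k] q).eval x := by
  induction k generalizing q with
  | zero => simp
  | succ k ih =>
    rw [Function.iterate_succ_apply', integral_eval_derivative_mul,
      eval_iterate_derivative_sq_sub_one_pow (by omega) (by norm_num),
      eval_iterate_derivative_sq_sub_one_pow (by omega) (by norm_num), ih (by omega),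
      Function.iterate_succ_apply]
    ring

theorem natDegree_sq_sub_one_pow (n : ℕ) : ((X ^ 2 - 1 : ℝ[X]) ^ n).natDegree = 2 * n := by
  rw [natDegree_pow, show (X ^ 2 - 1 : ℝ[X]) = X ^ 2 - C 1 by simp, natDegree_X_pow_sub_C, mul_comm]

theorem natDegree_legendre_le (n : ℕ) : (legendre n).natDegree ≤ n := by
  refine (natDegree_C_mul_le _ _).trans ((natDegree_iterate_derivative _ _).trans ?_)
  rw [natDegree_sq_sub_one_pow]
  omega

theorem coeff_legendre_ne_zero (n : ℕ) : (legendre n).coeff n ≠ 0 := by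
  have h1 : ((X ^ 2 - 1 : ℝ[X]) ^ n).coeff (n + n) = 1 := by
    have hm : ((X ^ 2 - 1 : ℝ[X]) ^ n).Monic := by
      rw [show (X ^ 2 - 1 : ℝ[X]) = X ^ 2 - C 1 by simp]
      exact (monic_X_pow_sub_C 1 two_ne_zero).pow n
    have := hm.coeff_natDegree
    rwa [natDegree_sq_sub_one_pow, two_mul] at this
  rw [legendre, coeff_C_mul, coeff_iterate_derivative, h1]
  have : ((n + n).descFactorial n : ℝ) ≠ 0 := by
    rw [Nat.cast_ne_zero, Ne, Nat.descFactorial_eq_zero_iff_lt]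
    omega
  simp only [nsmul_eq_mul, mul_one]
  positivity

theorem integral_legendre_mul_eq_zero {n : ℕ} {q : ℝ[X]} (hq : q.degree < n) :
    ∫ x in (-1 : ℝ)..1, (legendre n).eval x * q.eval x = 0 := by
  simp only [legendre, eval_mul, eval_C, mul_assoc]
  rw [intervalIntegral.integral_const_mul, integral_iterate_derivative_mul le_rfl,
    iterate_derivative_eq_zero_of_degree_lt hq]
  simp

theorem integral_legendre_mul_legendre {m n : ℕ} (h : m ≠ n) :
    ∫ x in (-1 : ℝ)..1, (legendre m).eval x * (legendre n).eval x = 0 := by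
  rcases lt_or_gt_of_ne h with h | h
  · rw [← integral_legendre_mul_eq_zero (n := n) (q := legendre m)]
    · simp only [mul_comm]
    · exact (degree_le_of_natDegree_le (natDegree_legendre_le m)).trans_lt (by exact_mod_cast h)
  · exact integral_legendre_mul_eq_zero
      ((degree_le_of_natDegree_le (natDegree_legendre_le n)).trans_lt (by exact_mod_cast h))

/-- The n-th derivative at a is n! times a Taylor coefficient there. Since a² = 1, the shift by a
turns X² - 1 into X(X + 2a), and the coefficient of Xⁿ in Xⁿ(X + 2a)ⁿ is (2a)ⁿ. -/
theorem eval_legendre_of_sq_eq_one (n : ℕ) {a : ℝ} (ha : a ^ 2 = 1) :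
    (legendre n).eval a = a ^ n := by
  have h1 : derivative^[n] ((X ^ 2 - 1 : ℝ[X]) ^ n) =
      n.factorial • hasseDeriv n ((X ^ 2 - 1 : ℝ[X]) ^ n) :=
    (congrFun (factorial_smul_hasseDeriv (R := ℝ) n) _).symm
  have h2 : taylor a ((X ^ 2 - 1 : ℝ[X]) ^ n) = (X + C (2 * a)) ^ n * X ^ n := by
    have : taylor a (X ^ 2 - 1 : ℝ[X]) = (X + C (2 * a)) * X := by
      simp only [map_sub, taylor_pow, taylor_X, taylor_one, map_mul]
      have : (C a) ^ 2 = (1 : ℝ[X]) := by rw [← C_pow, ha, C_1]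
      have h2 : (C 2 : ℝ[X]) = 2 := rfl
      rw [h2, C_1]
      linear_combination this
    rw [taylor_pow, this, mul_pow]
  rw [legendre, h1, eval_mul, eval_C, eval_smul, ← taylor_coeff, h2, coeff_mul_X_pow', if_pos le_rfl,
    Nat.sub_self, coeff_zero_eq_eval_zero]
  simp only [eval_pow, eval_add, eval_X, eval_C, zero_add, nsmul_eq_mul, mul_pow]
  field_simp

/-- Let I be the integral. The polynomial xP' - nP has degree less than n, so it is orthogonal to P.
Integrating P' · xP by parts, with boundary contribution 2, therefore gives nI = 2 - (n + 1)I. -/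
theorem integral_legendre_sq (n : ℕ) :
    ∫ x in (-1 : ℝ)..1, (legendre n).eval x * (legendre n).eval x = 2 / (2 * n + 1) := by
  set P := legendre n with hP
  have h1 : ∫ x in (-1 : ℝ)..1, P.eval x * (X * derivative P - C (n : ℝ) * P).eval x = 0 := by
    refine integral_legendre_mul_eq_zero ?_
    rw [degree_lt_iff_coeff_zero]
    intro m hm
    have hX : (X * derivative P).coeff m = m * P.coeff m := by
      cases m with
      | zero => simp
      | succ m => rw [coeff_X_mul, coeff_derivative]; push_cast; ring
    rw [coeff_sub, hX, coeff_C_mul]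
    rcases hm.eq_or_lt with rfl | hm
    · ring
    · rw [coeff_eq_zero_of_natDegree_lt ((natDegree_legendre_le n).trans_lt hm)]; ring
  have h2 := integral_eval_derivative_mul P (X * P)
  have e1 : (fun x => (derivative P).eval x * (X * P).eval x) =
      fun x => P.eval x * (X * derivative P - C (n : ℝ) * P).eval x + n * (P.eval x * P.eval x) := by
    funext x; simp; ring
  have e2 : (fun x => P.eval x * (derivative (X * P)).eval x) =
      fun x => P.eval x * (X * derivative P - C (n : ℝ) * P).eval x +
        (n + 1) * (P.eval x * P.eval x) := by
    funext x; simp; ring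
  have i1 : IntervalIntegrable (fun x => P.eval x * (X * derivative P - C (n : ℝ) * P).eval x)
      MeasureTheory.volume (-1) 1 := 
    Continuous.intervalIntegrable (by fun_prop) _ _
  have i2 : IntervalIntegrable (fun x => P.eval x * P.eval x) MeasureTheory.volume (-1) 1 :=
    Continuous.intervalIntegrable (by fun_prop) _ _
  rw [e1, e2, intervalIntegral.integral_add i1 (i2.const_mul _),
    intervalIntegral.integral_add i1 (i2.const_mul _), h1, intervalIntegral.integral_const_mul,
    intervalIntegral.integral_const_mul] at h2
  simp only [eval_mul, eval_X, hP, eval_legendre_of_sq_eq_one n (show (1 : ℝ) ^ 2 = 1 by norm_num),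
    eval_legendre_of_sq_eq_one n (show (-1 : ℝ) ^ 2 = 1 by norm_num)] at h2 ⊢
  have h3 : ((-1 : ℝ) ^ n) * (-1) ^ n = 1 := by rw [← mul_pow]; simp
  rw [eq_div_iff (by positivity)]
  simp only [one_pow] at h2
  linear_combination h2 + h3

/-- The Legendre polynomials of order `< N` span the polynomials of degree `< N`. -/
theorem mem_span_legendre {N : ℕ} (S : Submodule ℝ ℝ[X]) (hS : ∀ n < N, legendre n ∈ S) {p : ℝ[X]}
    (hp : p.degree < N) : p ∈ S := by
  induction N generalizing p with
  | zero =>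
    have : p = 0 := by
      rw [degree_lt_iff_coeff_zero] at hp
      ext m
      simpa using hp m (Nat.zero_le m)
    rw [this]; exact S.zero_mem
  | succ N ih =>
    set d : ℝ := p.coeff N / (legendre N).coeff N with hd
    have h1 : p - d • legendre N ∈ S := by
      refine ih (fun n hn => hS n (by omega)) ?_
      rw [degree_lt_iff_coeff_zero] at hp ⊢
      intro m hm
      rw [coeff_sub, coeff_smul, smul_eq_mul]
      rcases hm.eq_or_lt with rfl | hm
      · rw [hd, div_mul_cancel₀ _ (coeff_legendre_ne_zero N), sub_self]
      · rw [hp m hm, coeff_eq_zero_of_natDegree_lt ((natDegree_legendre_le N).trans_lt hm)]; ring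
    have h2 := S.add_mem h1 (S.smul_mem d (hS N (by omega)))
    simpa using h2

/-- The Legendre coefficient of order `n` of `g` on `[-1, 1]`. -/
noncomputable def legendreCoeff (g : ℝ → ℝ) (n : ℕ) : ℝ :=
  (2 * n + 1) / 2 * ∫ x in (-1 : ℝ)..1, (legendre n).eval x * g x

theorem integral_sub_legendreSum_mul_legendre {g : ℝ → ℝ} (hg : ContinuousOn g (Set.Icc (-1) 1))
    {s : Finset ℕ} {n : ℕ} (hn : n ∈ s) :
    ∫ x in (-1 : ℝ)..1, (g x - (∑ m ∈ s, legendreCoeff g m • legendre m).eval x) *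
      (legendre n).eval x = 0 := by
  have hg' : IntervalIntegrable (fun x => (legendre n).eval x * g x) MeasureTheory.volume (-1) 1 :=
    ContinuousOn.intervalIntegrable_of_Icc (by norm_num)
      ((legendre n).continuous.continuousOn.mul hg)
  have hi : ∀ m, IntervalIntegrable
      (fun x => legendreCoeff g m * ((legendre m).eval x * (legendre n).eval x))
      MeasureTheory.volume (-1) 1 := fun m => Continuous.intervalIntegrable (by fun_prop) _ _
  have e : ∀ x, (g x - (∑ m ∈ s, legendreCoeff g m • legendre m).eval x) * (legendre n).eval x =
      (legendre n).eval x * g x -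
        ∑ m ∈ s, legendreCoeff g m * ((legendre m).eval x * (legendre n).eval x) := by
    intro x
    simp only [eval_finsetSum, eval_smul, smul_eq_mul, sub_mul, Finset.sum_mul, mul_assoc]
    ring
  simp only [e]
  rw [intervalIntegral.integral_sub hg' (Continuous.intervalIntegrable (by fun_prop) _ _),
    intervalIntegral.integral_finsetSum fun m _ => hi m]
  simp only [intervalIntegral.integral_const_mul]
  rw [Finset.sum_eq_single_of_mem n hn fun m _ hm => by
    rw [integral_legendre_mul_legendre hm, mul_zero], integral_legendre_sq, legendreCoeff]
  field_simp
  ring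

/-- A partial sum of the Legendre series of `g` is, in mean, as close to a polynomial as `g` is. -/
theorem integral_abs_legendreSum_sub_le {g : ℝ → ℝ} (hg : ContinuousOn g (Set.Icc (-1) 1))
    {s : Finset ℕ} {N : ℕ} (hs : Finset.range N ⊆ s) {p : ℝ[X]} (hp : p.degree < N) {δ : ℝ}
    (hδ : 0 < δ) (h : ∀ x ∈ Set.Icc (-1 : ℝ) 1, |p.eval x - g x| ≤ δ) :
    ∫ x in (-1 : ℝ)..1, |((∑ n ∈ s, legendreCoeff g n • legendre n) - p).eval x| ≤ 2 * δ := by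
  set G : ℝ[X] := ∑ n ∈ s, legendreCoeff g n • legendre n with hG
  set r := G - p with hr
  have hint : ∀ u : ℝ[X], IntervalIntegrable (fun x => (g x - G.eval x) * u.eval x)
      MeasureTheory.volume (-1) 1 := fun u =>
    ContinuousOn.intervalIntegrable_of_Icc (by norm_num)
      ((hg.sub G.continuous.continuousOn).mul u.continuous.continuousOn)
  -- The polynomials orthogonal to the error g - G. Both G and p lie in it, p because its degree is
  -- less than N and `s` contains all indices below N.
  let S : Submodule ℝ ℝ[X] :=
    { carrier := {u | ∫ x in (-1 : ℝ)..1, (g x - G.eval x) * u.eval x = 0}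
      zero_mem' := by simp
      add_mem' := by
        intro u v hu hv
        simp only [Set.mem_ofPred_eq, eval_add, mul_add] at hu hv ⊢
        rw [intervalIntegral.integral_add (hint u) (hint v), hu, hv, add_zero]
      smul_mem' := by
        intro a u hu
        simp only [Set.mem_ofPred_eq, eval_smul, smul_eq_mul, mul_left_comm _ a] at hu ⊢
        rw [intervalIntegral.integral_const_mul, hu, mul_zero] }
  have hS : ∀ n ∈ s, legendre n ∈ S := fun n hn => integral_sub_legendreSum_mul_legendre hg hn
  have hrS : r ∈ S := S.sub_mem (S.sum_mem fun n hn => S.smul_mem _ (hS n hn))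
    (mem_span_legendre S (fun n hn => hS n (hs (Finset.mem_range.2 hn))) hp)
  have hrS' : ∫ x in (-1 : ℝ)..1, (g x - G.eval x) * r.eval x = 0 := hrS
  have iabs : IntervalIntegrable (fun x => |r.eval x|) MeasureTheory.volume (-1) 1 :=
    r.continuous.abs.intervalIntegrable _ _
  have isq : IntervalIntegrable (fun x => r.eval x * r.eval x) MeasureTheory.volume (-1) 1 :=
    (r.continuous.mul r.continuous).intervalIntegrable _ _
  -- As r is orthogonal to g - G, ∫r² = ∫(r + g - G)r = ∫(g - p)r, and |g - p| ≤ δ.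
  have h1 : ∫ x in (-1 : ℝ)..1, r.eval x * r.eval x ≤ δ * ∫ x in (-1 : ℝ)..1, |r.eval x| := by
    have : ∫ x in (-1 : ℝ)..1, r.eval x * r.eval x =
        ∫ x in (-1 : ℝ)..1, (r.eval x * r.eval x + (g x - G.eval x) * r.eval x) := by
      rw [intervalIntegral.integral_add isq (hint r), hrS', add_zero]
    rw [this, ← intervalIntegral.integral_const_mul]
    refine intervalIntegral.integral_mono_on (by norm_num) (isq.add (hint r))
      (iabs.const_mul δ) fun x hx => ?_
    have e : r.eval x * r.eval x + (g x - G.eval x) * r.eval x =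
        (g x - p.eval x) * r.eval x := by rw [hr, eval_sub]; ring
    rw [e]
    refine (le_abs_self _).trans ?_
    rw [abs_mul]
    gcongr
    rw [abs_sub_comm]
    exact h x hx
  -- Young's inequality δ|r| ≤ r²/2 + δ²/2 on an interval of length 2 replaces Cauchy–Schwarz.
  -- Inserting `h1`, half of δ∫|r| is absorbed on the left.
  have h2 : δ * ∫ x in (-1 : ℝ)..1, |r.eval x| ≤
      ((∫ x in (-1 : ℝ)..1, r.eval x * r.eval x) + 2 * δ ^ 2) / 2 := by
    have : ((∫ x in (-1 : ℝ)..1, r.eval x * r.eval x) + 2 * δ ^ 2) / 2 =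
        ∫ x in (-1 : ℝ)..1, (1 / 2 * (r.eval x * r.eval x) + δ ^ 2 / 2) := by
      rw [intervalIntegral.integral_add (isq.const_mul _) (by simp),
        intervalIntegral.integral_const_mul]
      simp
      ring
    rw [this, ← intervalIntegral.integral_const_mul]
    refine intervalIntegral.integral_mono_on (by norm_num) (iabs.const_mul δ)
      ((isq.const_mul _).add (by simp)) fun x hx => ?_
    nlinarith [sq_nonneg (|r.eval x| - δ), abs_mul_abs_self (r.eval x)]
  nlinarith

/-- A linear functional on polynomials that is bounded in the mean may be evaluated on a continuous
function term by term along the Legendre series. -/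
theorem hasSum_legendreCoeff {Λ : ℝ[X] →ₗ[ℝ] ℝ} {K : ℝ} (hK : 0 ≤ K)
    (hΛ : ∀ p, |Λ p| ≤ K * ∫ x in (-1 : ℝ)..1, |p.eval x|) {g : ℝ → ℝ}
    (hg : ContinuousOn g (Set.Icc (-1) 1)) {l K' : ℝ} (hK' : 0 ≤ K')
    (hl : ∀ (p : ℝ[X]) (δ : ℝ), 0 < δ → (∀ x ∈ Set.Icc (-1 : ℝ) 1, |p.eval x - g x| ≤ δ) →
      |Λ p - l| ≤ K' * δ) :
    HasSum (fun n => legendreCoeff g n * Λ (legendre n)) l := by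
  rw [HasSum, SummationFilter.unconditional_filter, Metric.tendsto_atTop]
  intro ε hε
  -- The total error is at most 2Kδ + K'δ; the extra 1 makes the denominator positive and the final
  -- inequality strict.
  set δ := ε / (2 * K + K' + 1) with hδ
  have hδ0 : 0 < δ := by positivity
  obtain ⟨p, hp⟩ := exists_polynomial_near_of_continuousOn (-1) 1 g hg δ hδ0
  have hp' : ∀ x ∈ Set.Icc (-1 : ℝ) 1, |p.eval x - g x| ≤ δ := fun x hx => (hp x hx).le
  -- The bound holds for every finite `s` that contains the indices up to the degree of p, so the
  -- convergence is unconditional.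
  refine ⟨Finset.range (p.natDegree + 1), fun s hs => ?_⟩
  have h1 := integral_abs_legendreSum_sub_le hg hs
    (by exact_mod_cast degree_le_natDegree.trans_lt (by exact_mod_cast Nat.lt_succ_self _)) hδ0 hp'
  have h2 := hΛ ((∑ n ∈ s, legendreCoeff g n • legendre n) - p)
  rw [map_sub, map_sum] at h2
  simp only [map_smul, smul_eq_mul] at h2
  have h3 := hl p δ hδ0 hp'
  rw [Real.dist_eq]
  calc _ ≤ |∑ n ∈ s, legendreCoeff g n * Λ (legendre n) - Λ p| + |Λ p - l| := abs_sub_le _ _ _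
    _ ≤ K * (2 * δ) + K' * δ := by
        refine add_le_add (h2.trans ?_) h3
        gcongr
    _ = (2 * K + K') * δ := by ring
    _ < (2 * K + K' + 1) * δ := by nlinarith
    _ = ε := by rw [hδ]; field_simp

end Vekua

/-! ### Formal powers and explicit solutions for polynomial data -/

namespace Vekua

open Polynomial

/-- `f` is a nonvanishing `C¹` function on the line with `f(0) = 1` and `f' / f = q`. -/
structure IsLogDeriv (f q : ℝ → ℝ) : Prop where
  apply_zero : f 0 = 1
  ne_zero : ∀ x, f x ≠ 0
  continuous_logDeriv : Continuous q
  hasDerivAt : ∀ x, HasDerivAt f (q x * f x) x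

namespace IsLogDeriv

variable {f q : ℝ → ℝ}

theorem continuous (h : IsLogDeriv f q) : Continuous f :=
  continuous_iff_continuousAt.2 fun x => (h.hasDerivAt x).continuousAt

theorem inv (h : IsLogDeriv f q) : IsLogDeriv f⁻¹ (-q) where
  apply_zero := by simp [h.apply_zero]
  ne_zero x := inv_ne_zero (h.ne_zero x)
  continuous_logDeriv := h.continuous_logDeriv.neg
  hasDerivAt x := by
    refine ((h.hasDerivAt x).inv (h.ne_zero x)).congr_deriv ?_
    have := h.ne_zero x
    simp only [Pi.neg_apply, Pi.inv_apply]
    field_simp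

end IsLogDeriv

/-- The two recursions differ only in the sign of the exponents. Hence f ↦ 1/f exchanges φ with ψ
and a_n with b_n, and every statement about the second family is one about the first. -/
theorem recX_inv (f : ℝ → ℝ) (n : ℕ) : recX f⁻¹ n = recXt f n := by
  induction n with
  | zero => rfl
  | succ n ih =>
    funext ξ
    have e : (-1 : ℤ) ^ (n + 1) = -(-1) ^ n := by ring
    simp only [recX, recXt, ih, Pi.inv_apply, inv_pow, e, inv_zpow', neg_neg]

theorem recXt_inv (f : ℝ → ℝ) (n : ℕ) : recXt f⁻¹ n = recX f n := by
  rw [← recX_inv, inv_inv]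

theorem phi_inv (f : ℝ → ℝ) (k : ℕ) : phi f⁻¹ k = psi f k := by
  funext ξ
  simp only [phi, psi, recX_inv, recXt_inv, Pi.inv_apply, div_eq_inv_mul]

theorem coeffA_inv (f : ℝ → ℝ) (n : ℕ) : coeffA f⁻¹ n = coeffB f n := by
  funext ξ
  simp only [coeffA, coeffB, phi_inv]

section FormalPowers

variable {f q : ℝ → ℝ}

theorem continuous_recX (h : IsLogDeriv f q) (n : ℕ) : Continuous (recX f n) := by
  induction n with
  | zero => exact continuous_const
  | succ n ih =>
    refine continuous_const.mul (intervalIntegral.continuous_primitive (fun a b =>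
      Continuous.intervalIntegrable (ih.mul ?_) a b) 0)
    exact (h.continuous.pow 2).zpow₀ _ fun x => Or.inl (pow_ne_zero 2 (h.ne_zero x))

theorem hasDerivAt_recX_succ (h : IsLogDeriv f q) (n : ℕ) (ξ : ℝ) :
    HasDerivAt (recX f (n + 1))
      ((n + 1) * (recX f n ξ * (f ξ ^ 2) ^ ((-1 : ℤ) ^ (n + 1)))) ξ := by
  have hc : Continuous fun s => recX f n s * (f s ^ 2) ^ ((-1 : ℤ) ^ (n + 1)) :=
    (continuous_recX h n).mul ((h.continuous.pow 2).zpow₀ _ fun x =>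
      Or.inl (pow_ne_zero 2 (h.ne_zero x)))
  have := (hc.integral_hasStrictDerivAt 0 ξ).hasDerivAt.const_mul ((n + 1 : ℕ) : ℝ)
  rw [Nat.cast_add, Nat.cast_one] at this
  simpa only [recX, Nat.cast_add, Nat.cast_one] using this

theorem phi_zero (f : ℝ → ℝ) : phi f 0 = f := by
  funext ξ
  simp [phi, recXt]

theorem phi_succ_apply_zero (f : ℝ → ℝ) (k : ℕ) : phi f (k + 1) 0 = 0 := by
  simp [phi, recX, recXt]

theorem phi_apply_of_odd (f : ℝ → ℝ) {k : ℕ} (hk : Odd k) : phi f k = f * recX f k := by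
  funext ξ
  simp [phi, hk]

theorem phi_apply_of_even (f : ℝ → ℝ) {k : ℕ} (hk : Even k) : phi f k = f * recX f⁻¹ k := by
  funext ξ
  simp [phi, Nat.not_odd_iff_even.2 hk, recX_inv]

/-- In either parity the outermost integral carries the weight f⁻². It turns the prefactor f into
1/f, which leaves (k + 1)ψ_k, written here as `phi f⁻¹ k`. -/
theorem hasDerivAt_phi_succ (h : IsLogDeriv f q) (k : ℕ) (ξ : ℝ) :
    HasDerivAt (phi f (k + 1)) (q ξ * phi f (k + 1) ξ + (k + 1) * phi f⁻¹ k ξ) ξ := by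
  have hne := h.ne_zero ξ
  rcases Nat.even_or_odd k with hk | hk
  · have hk1 : Odd (k + 1) := hk.add_one
    rw [phi_apply_of_odd f hk1, phi_apply_of_even _ hk]
    refine ((h.hasDerivAt ξ).mul (hasDerivAt_recX_succ h k ξ)).congr_deriv ?_
    rw [hk1.neg_one_pow]
    simp only [Pi.mul_apply, Pi.inv_apply, inv_inv, zpow_neg_one]
    field_simp
  · have hk1 : Even (k + 1) := hk.add_one
    rw [phi_apply_of_even f hk1, phi_apply_of_odd _ hk]
    refine ((h.hasDerivAt ξ).mul (hasDerivAt_recX_succ h.inv k ξ)).congr_deriv ?_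
    rw [hk1.neg_one_pow]
    simp only [Pi.mul_apply, Pi.inv_apply, zpow_one]
    field_simp

theorem hasDerivAt_phi_zero (h : IsLogDeriv f q) (ξ : ℝ) :
    HasDerivAt (phi f 0) (q ξ * phi f 0 ξ) ξ := by
  rw [phi_zero]
  exact h.hasDerivAt ξ

/-- The linear map on polynomials which sends `x ^ k` to `φ_k(ξ)`. -/
noncomputable def powerMap (f : ℝ → ℝ) (ξ : ℝ) : ℝ[X] →ₗ[ℝ] ℝ :=
  Polynomial.lsum fun k => LinearMap.mulRight ℝ (phi f k ξ)

theorem powerMap_apply (f : ℝ → ℝ) (ξ : ℝ) {p : ℝ[X]} {N : ℕ} (hN : p.natDegree < N) :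
    powerMap f ξ p = ∑ k ∈ Finset.range N, p.coeff k * phi f k ξ := by
  rw [powerMap, Polynomial.lsum_apply, Polynomial.sum_over_range' _ (by simp) N hN]
  rfl

/-- The value at `ξ` of the image of the polynomial `τ ↦ p(t + τ)` under `x ^ k ↦ φ_k`. -/
noncomputable def polySol (f : ℝ → ℝ) (p : ℝ[X]) (x : ℝ × ℝ) : ℝ :=
  powerMap f x.1 (taylor x.2 p)

theorem polySol_apply (f : ℝ → ℝ) {p : ℝ[X]} {N : ℕ} (hN : p.natDegree < N) (x : ℝ × ℝ) :
    polySol f p x = ∑ k ∈ Finset.range N, (hasseDeriv k p).eval x.2 * phi f k x.1 := by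
  rw [polySol, powerMap_apply f x.1 (N := N) (by rwa [natDegree_taylor])]
  simp only [taylor_coeff]

theorem polySol_sub (f : ℝ → ℝ) (p r : ℝ[X]) (x : ℝ × ℝ) :
    polySol f (p - r) x = polySol f p x - polySol f r x := by
  simp only [polySol, map_sub]

theorem hasseDeriv_derivative (k : ℕ) (p : ℝ[X]) :
    hasseDeriv k (derivative p) = ((k + 1 : ℕ) : ℝ) • hasseDeriv (k + 1) p := by
  have := congrArg (fun L => L p) (hasseDeriv_comp (R := ℝ) k 1)
  simpa [hasseDeriv_one, add_smul, Nat.cast_smul_eq_nsmul, add_mul] using this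

theorem derivative_hasseDeriv (k : ℕ) (p : ℝ[X]) :
    derivative (hasseDeriv k p) = hasseDeriv k (derivative p) := by
  rw [hasseDeriv_derivative]
  have := congrArg (fun L => L p) (hasseDeriv_comp (R := ℝ) 1 k)
  simpa [hasseDeriv_one, add_comm 1 k, add_smul, Nat.cast_smul_eq_nsmul, add_mul] using this

theorem polySol_zero_left (h : IsLogDeriv f q) (p : ℝ[X]) (t : ℝ) :
    polySol f p (0, t) = p.eval t := by
  rw [polySol_apply f (Nat.lt_succ_self _), Finset.sum_range_succ']
  simp [phi_succ_apply_zero, phi_zero, h.apply_zero]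

/-- The linear form on the plane with partial derivatives `a` and `b`. -/
noncomputable def gradient (a b : ℝ) : ℝ × ℝ →L[ℝ] ℝ :=
  a • ContinuousLinearMap.fst ℝ ℝ ℝ + b • ContinuousLinearMap.snd ℝ ℝ ℝ

/-- With u and v the images of p for f and 1/f, this says u_ξ = qu + v_t. Applied to 1/f it says v_ξ
= -qv + u_t, so u + jv solves the Vekua equation. -/
theorem hasFDerivAt_polySol (h : IsLogDeriv f q) (p : ℝ[X]) (x : ℝ × ℝ) :
    HasFDerivAt (polySol f p)
      (gradient (q x.1 * polySol f p x + polySol f⁻¹ (derivative p) x)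
        (polySol f (derivative p) x)) x := by
  set N := p.natDegree + 1 with hN
  have hp : p.natDegree < N := Nat.lt_succ_self _
  have hp' : (derivative p).natDegree < N := (natDegree_derivative_le p).trans_lt (by omega)
  -- At k = 0 the truncated index `k - 1` is harmless, since its factor k vanishes.
  let φ' : ℕ → ℝ := fun k => q x.1 * phi f k x.1 + k * phi f⁻¹ (k - 1) x.1
  have hφ : ∀ k, HasDerivAt (phi f k) (φ' k) x.1 := by
    intro k
    cases k with
    | zero => simpa [φ'] using hasDerivAt_phi_zero h x.1
    | succ k => simpa [φ'] using hasDerivAt_phi_succ h k x.1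
  -- One superfluous zero term is kept: removing k = 0 and shifting the index then leaves exactly N
  -- terms, the range used for `derivative p`.
  have h1 : polySol f p =
      fun y => ∑ k ∈ Finset.range (N + 1), (hasseDeriv k p).eval y.2 * phi f k y.1 :=
    funext fun y => polySol_apply f (by omega) y
  have h2 : HasFDerivAt (fun y : ℝ × ℝ =>
      ∑ k ∈ Finset.range (N + 1), (hasseDeriv k p).eval y.2 * phi f k y.1)
      (∑ k ∈ Finset.range (N + 1), ((hasseDeriv k p).eval x.2 •
        (φ' k • ContinuousLinearMap.fst ℝ ℝ ℝ) + phi f k x.1 •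
        ((derivative (hasseDeriv k p)).eval x.2 • ContinuousLinearMap.snd ℝ ℝ ℝ))) x := by
    refine HasFDerivAt.fun_sum fun k _ => HasFDerivAt.mul ?_ ?_
    · exact ((hasseDeriv k p).hasDerivAt x.2).comp_hasFDerivAt x hasFDerivAt_snd
    · exact (hφ k).comp_hasFDerivAt x hasFDerivAt_fst
  rw [h1]
  refine h2.congr_fderiv ?_
  rw [← h1, polySol_apply f (show p.natDegree < N + 1 by omega), polySol_apply f⁻¹ hp',
    polySol_apply f (show (derivative p).natDegree < N + 1 by omega)]
  have e1 : ∑ k ∈ Finset.range (N + 1), (hasseDeriv k p).eval x.2 * φ' k =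
      q x.1 * ∑ k ∈ Finset.range (N + 1), (hasseDeriv k p).eval x.2 * phi f k x.1 +
        ∑ k ∈ Finset.range N, (hasseDeriv k (derivative p)).eval x.2 * phi f⁻¹ k x.1 := by
    simp only [φ', mul_add, Finset.sum_add_distrib, Finset.mul_sum]
    congr 1
    · exact Finset.sum_congr rfl fun k _ => by ring
    · rw [Finset.sum_range_succ']
      simp only [Nat.cast_zero, zero_mul, mul_zero, add_zero, Nat.add_sub_cancel,
        hasseDeriv_derivative, eval_smul, smul_eq_mul]
      exact Finset.sum_congr rfl fun k _ => by push_cast; ring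
  rw [Finset.sum_add_distrib, gradient, ← e1]
  congr 1
  · rw [Finset.sum_smul]
    exact Finset.sum_congr rfl fun k _ => by rw [smul_smul]
  · rw [Finset.sum_smul]
    exact Finset.sum_congr rfl fun k _ => by rw [smul_smul, derivative_hasseDeriv, mul_comm]

theorem continuous_polySol (h : IsLogDeriv f q) (p : ℝ[X]) : Continuous (polySol f p) :=
  continuous_iff_continuousAt.2 fun x => (hasFDerivAt_polySol h p x).continuousAt

end FormalPowers

end Vekua

/-! ### The mean estimate along characteristics -/

namespace Vekua

open Polynomial

/-- The map B ↦ c + B/2 contracts to its fixed point 2c, so iterating the improvement forgets the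
crude initial constant A. This is the form of Gronwall's argument used for the coupled equations. -/
theorem le_two_mul_of_le_add_half {ι : Type*} {z w : ι → ℝ} {A c : ℝ} (hA : 0 ≤ A) (hc : 0 ≤ c)
    (h : ∀ i, z i ≤ A * w i)
    (hstep : ∀ B, 0 ≤ B → (∀ i, z i ≤ B * w i) → ∀ i, z i ≤ (c + B / 2) * w i) (i : ι) :
    z i ≤ 2 * c * w i := by
  have key : ∀ n : ℕ, 0 ≤ 2 * c + (A - 2 * c) * (1 / 2) ^ n ∧
      ∀ i, z i ≤ (2 * c + (A - 2 * c) * (1 / 2) ^ n) * w i := by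
    intro n
    induction n with
    | zero => simpa using ⟨hA, h⟩
    | succ n ih =>
      have e : 2 * c + (A - 2 * c) * (1 / 2) ^ (n + 1) =
          c + (2 * c + (A - 2 * c) * (1 / 2) ^ n) / 2 := by ring
      rw [e]
      exact ⟨by linarith [ih.1], hstep _ ih.1 ih.2⟩
  have hlim : Filter.Tendsto (fun n : ℕ => (2 * c + (A - 2 * c) * (1 / 2 : ℝ) ^ n) * w i)
      Filter.atTop (nhds ((2 * c + (A - 2 * c) * 0) * w i)) :=
    (((tendsto_pow_atTop_nhds_zero_of_lt_one (by norm_num) (by norm_num)).const_mul _).const_add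
      _).mul_const _
  have := ge_of_tendsto' hlim fun n => (key n).2 i
  simpa using this

/-- The estimate that closes the Gronwall argument for the integral equations along
characteristics. -/
theorem norm_integral_le_half_mul_exp {E : Type*} [NormedAddCommGroup E] [NormedSpace ℝ E]
    {Q A ξ : ℝ} (hA : 0 ≤ A) (hξ : 0 ≤ ξ) {g : ℝ → E}
    (hg : ∀ s ∈ Set.Ioc 0 ξ, ‖g s‖ ≤ Q * (A * Real.exp (2 * Q * s))) :
    ‖∫ s in (0 : ℝ)..ξ, g s‖ ≤ A / 2 * Real.exp (2 * Q * ξ) := by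
  have hc : Continuous fun s => Q * (A * Real.exp (2 * Q * s)) := by fun_prop
  have h1 := intervalIntegral.norm_integral_le_of_norm_le (μ := MeasureTheory.volume) hξ
    (Filter.Eventually.of_forall hg) (hc.intervalIntegrable 0 ξ)
  -- The exponent 2Q, twice the bound of the coefficient, is what makes integration gain the factor
  -- 1/2.
  have hd : ∀ s ∈ Set.uIcc 0 ξ, HasDerivAt (fun s => A / 2 * Real.exp (2 * Q * s))
      (Q * (A * Real.exp (2 * Q * s))) s := by
    intro s _
    have := (((hasDerivAt_id s).const_mul (2 * Q)).exp).const_mul (A / 2)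
    refine this.congr_deriv ?_
    simp only [id]
    ring
  rw [intervalIntegral.integral_eq_sub_of_hasDerivAt hd (hc.intervalIntegrable 0 ξ)] at h1
  refine h1.trans ?_
  simp
  linarith

variable {f q : ℝ → ℝ}

/-- The component along `P⁺` of the solution with data `2 p P⁺`. -/
noncomputable def plusSol (f : ℝ → ℝ) (p : ℝ[X]) (x : ℝ × ℝ) : ℝ :=
  polySol f p x + polySol f⁻¹ p x

/-- The component along `P⁻` of the solution with data `2 p P⁺`. -/
noncomputable def minusSol (f : ℝ → ℝ) (p : ℝ[X]) (x : ℝ × ℝ) : ℝ :=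
  polySol f p x - polySol f⁻¹ p x

theorem continuous_plusSol (h : IsLogDeriv f q) (p : ℝ[X]) : Continuous (plusSol f p) :=
  (continuous_polySol h p).add (continuous_polySol h.inv p)

theorem continuous_minusSol (h : IsLogDeriv f q) (p : ℝ[X]) : Continuous (minusSol f p) :=
  (continuous_polySol h p).sub (continuous_polySol h.inv p)

theorem hasDerivAt_polySol_line (h : IsLogDeriv f q) (p : ℝ[X]) (c e s : ℝ) :
    HasDerivAt (fun s => polySol f p (s, c + e * s))
      (q s * polySol f p (s, c + e * s) + polySol f⁻¹ (derivative p) (s, c + e * s) +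
        e * polySol f (derivative p) (s, c + e * s)) s := by
  have h1 : HasDerivAt (fun s : ℝ => (s, c + e * s)) ((1 : ℝ), e) s := by
    have := ((hasDerivAt_id s).const_mul e).const_add c
    exact (hasDerivAt_id s).prodMk (by simpa using this)
  refine ((hasFDerivAt_polySol h p (s, c + e * s)).comp_hasDerivAt s h1).congr_deriv ?_
  simp [gradient]
  ring

/-- On the characteristic t + ξ = const the terms with the derivative of p cancel, and only the
coupling q·`minusSol` remains. -/
theorem plusSol_eq (h : IsLogDeriv f q) (p : ℝ[X]) (ξ t : ℝ) :
    plusSol f p (ξ, t) = 2 * p.eval (t + ξ) +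
      ∫ s in (0 : ℝ)..ξ, q s * minusSol f p (s, t + ξ + -1 * s) := by
  have hd : ∀ s ∈ Set.uIcc 0 ξ, HasDerivAt (fun s => plusSol f p (s, t + ξ + -1 * s))
      (q s * minusSol f p (s, t + ξ + -1 * s)) s := by
    intro s _
    refine ((hasDerivAt_polySol_line h p (t + ξ) (-1) s).add
      (hasDerivAt_polySol_line h.inv p (t + ξ) (-1) s)).congr_deriv ?_
    rw [inv_inv, minusSol, Pi.neg_apply]
    ring
  have hc : Continuous fun s => q s * minusSol f p (s, t + ξ + -1 * s) :=
    h.continuous_logDeriv.mul ((continuous_minusSol h p).comp (by fun_prop))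
  rw [intervalIntegral.integral_eq_sub_of_hasDerivAt hd (hc.intervalIntegrable _ _)]
  have e1 : plusSol f p (0, t + ξ + -1 * 0) = 2 * p.eval (t + ξ) := by
    rw [plusSol, polySol_zero_left h, polySol_zero_left h.inv, mul_zero, add_zero]
    ring
  rw [e1, show t + ξ + -1 * ξ = t by ring]
  ring

/-- The same on t - ξ = const. There is no free term because the data have no component along P⁻. -/
theorem minusSol_eq (h : IsLogDeriv f q) (p : ℝ[X]) (ξ t : ℝ) :
    minusSol f p (ξ, t) = ∫ s in (0 : ℝ)..ξ, q s * plusSol f p (s, t - ξ + 1 * s) := by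
  have hd : ∀ s ∈ Set.uIcc 0 ξ, HasDerivAt (fun s => minusSol f p (s, t - ξ + 1 * s))
      (q s * plusSol f p (s, t - ξ + 1 * s)) s := by
    intro s _
    refine ((hasDerivAt_polySol_line h p (t - ξ) 1 s).sub
      (hasDerivAt_polySol_line h.inv p (t - ξ) 1 s)).congr_deriv ?_
    rw [inv_inv, plusSol, Pi.neg_apply]
    ring
  have hc : Continuous fun s => q s * plusSol f p (s, t - ξ + 1 * s) :=
    h.continuous_logDeriv.mul ((continuous_plusSol h p).comp (by fun_prop))
  rw [intervalIntegral.integral_eq_sub_of_hasDerivAt hd (hc.intervalIntegrable _ _)]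
  have e1 : minusSol f p (0, t - ξ + 1 * 0) = 0 := by
    rw [minusSol, polySol_zero_left h, polySol_zero_left h.inv]
    ring
  rw [e1, show t - ξ + 1 * ξ = t by ring, sub_zero]

/-- The deviation of the solution from the free wave is bounded by the mean of the data over the
base of the characteristic triangle. -/
theorem abs_plusSol_sub_le_and_abs_minusSol_le (h : IsLogDeriv f q) {L Q : ℝ} (hQ0 : 0 < Q)
    (hQ : ∀ s ∈ Set.Icc 0 L, |q s| ≤ Q) (p : ℝ[X]) {ξ : ℝ} (hξ : ξ ∈ Set.Icc 0 L) (t : ℝ) :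
    max |plusSol f p (ξ, t) - 2 * p.eval (t + ξ)| |minusSol f p (ξ, t)| ≤
      2 * Q * Real.exp (2 * Q * L) * ∫ x in (t - ξ)..(t + ξ), |p.eval x| := by
  set J : ℝ × ℝ → ℝ := fun x => ∫ y in (x.2 - x.1)..(x.2 + x.1), |p.eval y| with hJ
  have hpi : ∀ a b, IntervalIntegrable (fun y => |p.eval y|) MeasureTheory.volume a b :=
    fun a b => p.continuous.abs.intervalIntegrable a b
  have hJ0 : ∀ x : ℝ × ℝ, 0 ≤ x.1 → 0 ≤ J x := fun x hx =>
    intervalIntegral.integral_nonneg (by linarith) fun _ _ => abs_nonneg _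
  have hJmono : ∀ x y : ℝ × ℝ, 0 ≤ x.1 → y.2 - y.1 ≤ x.2 - x.1 → x.2 + x.1 ≤ y.2 + y.1 →
      J x ≤ J y := fun x y hx h1 h2 =>
    intervalIntegral.integral_mono_interval h1 (by linarith) h2
      (Filter.Eventually.of_forall fun _ => abs_nonneg _) (hpi _ _)
  set Z : ℝ × ℝ → ℝ := fun x => plusSol f p x - 2 * p.eval (x.2 + x.1) with hZ
  have hZc : Continuous Z := by
    have := continuous_plusSol h p
    fun_prop
  -- A compact set that contains (ξ, t) and is stable under following both characteristics back to
  -- the line ξ = 0. Compactness supplies the a priori bound that the iteration needs.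
  set Ω : Set (ℝ × ℝ) := {x | 0 ≤ x.1 ∧ x.1 ≤ L ∧ |x.2| + x.1 ≤ |t| + ξ} with hΩ
  have hmemΩ : ∀ x : ℝ × ℝ, x ∈ Ω ↔ 0 ≤ x.1 ∧ x.1 ≤ L ∧ |x.2| + x.1 ≤ |t| + ξ := fun x => Iff.rfl
  have hΩc : IsCompact Ω := by
    have hsub : Ω ⊆ Set.Icc 0 L ×ˢ Set.Icc (-(|t| + ξ)) (|t| + ξ) := by
      rintro ⟨a, b⟩ ⟨h1, h2, h3⟩
      exact ⟨⟨h1, h2⟩, abs_le.1 (by dsimp at *; linarith)⟩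
    refine (isCompact_Icc.prod isCompact_Icc).of_isClosed_subset ?_ hsub
    exact (isClosed_le continuous_const continuous_fst).inter
      ((isClosed_le continuous_fst continuous_const).inter
        (isClosed_le (f := fun x : ℝ × ℝ => |x.2| + x.1) (by fun_prop) continuous_const))
  -- The integral `J` may vanish. Adding δ keeps the weight bounded below, so that a constant bound
  -- B yields the initial constant B/δ; finally δ tends to 0.
  have main : ∀ δ : ℝ, 0 < δ → ∀ i : Ω, max |Z i| |minusSol f p i| ≤
      2 * Q * (Real.exp (2 * Q * (i : ℝ × ℝ).1) * (J i + δ)) := by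
    intro δ hδ
    obtain ⟨B, hB⟩ := (hΩc.image_of_continuousOn (f := fun x => max |Z x| |minusSol f p x|)
      (by have := continuous_minusSol h p; fun_prop)).bddAbove
    have hB' : ∀ x ∈ Ω, max |Z x| |minusSol f p x| ≤ B := fun x hx => hB ⟨x, hx, rfl⟩
    have hB0 : 0 ≤ B := (abs_nonneg _).trans ((le_max_left _ _).trans
      (hB' (ξ, t) ⟨hξ.1, hξ.2, le_rfl⟩))
    refine le_two_mul_of_le_add_half (A := B / δ) (by positivity) hQ0.le ?_ ?_
    · rintro ⟨x, hx⟩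
      refine (hB' x hx).trans ?_
      have h1 : 1 ≤ Real.exp (2 * Q * x.1) := Real.one_le_exp (by have := hx.1; positivity)
      have h2 : δ ≤ Real.exp (2 * Q * x.1) * (J x + δ) := by
        have := hJ0 x hx.1
        nlinarith
      calc B = B / δ * δ := by field_simp
        _ ≤ _ := by gcongr
    · rintro A hA hA' ⟨⟨a, b⟩, hx⟩
      have hA'' : ∀ x ∈ Ω, max |Z x| |minusSol f p x| ≤
          A * (Real.exp (2 * Q * x.1) * (J x + δ)) := fun x hx => hA' ⟨x, hx⟩
      obtain ⟨ha0, haL, hab⟩ := hx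
      dsimp only at ha0 haL hab ⊢
      have hJa := hJ0 (a, b) ha0
      have hm1 : ∀ s ∈ Set.Ioc 0 a, (s, b + a + -1 * s) ∈ Ω := by
        intro s hs
        refine ⟨hs.1.le, hs.2.trans haL, ?_⟩
        have := abs_add_le b (a - s)
        rw [abs_of_nonneg (sub_nonneg.2 hs.2)] at this
        dsimp only
        rw [show b + a + -1 * s = b + (a - s) by ring]
        linarith
      have hm2 : ∀ s ∈ Set.Ioc 0 a, (s, b - a + 1 * s) ∈ Ω := by
        intro s hs
        refine ⟨hs.1.le, hs.2.trans haL, ?_⟩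
        have := abs_sub b (a - s)
        rw [abs_of_nonneg (sub_nonneg.2 hs.2)] at this
        dsimp only
        rw [show b - a + 1 * s = b - (a - s) by ring]
        linarith
      have hJ1 : ∀ s ∈ Set.Ioc 0 a, J (s, b + a + -1 * s) ≤ J (a, b) := fun s hs =>
        hJmono _ _ hs.1.le (by dsimp only; linarith [hs.2]) (by dsimp only; linarith [hs.2])
      have hJ2 : ∀ s ∈ Set.Ioc 0 a, J (s, b - a + 1 * s) ≤ J (a, b) := fun s hs =>
        hJmono _ _ hs.1.le (by dsimp only; linarith [hs.2]) (by dsimp only; linarith [hs.2])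
      have hqs : ∀ s ∈ Set.Ioc 0 a, |q s| ≤ Q := fun s hs => hQ s ⟨hs.1.le, hs.2.trans haL⟩
      have hAJ : 0 ≤ A * (J (a, b) + δ) := by positivity
      have hbd : ∀ (y : ℝ × ℝ) (z : ℝ), y ∈ Ω → y.1 ∈ Set.Ioc 0 a → J y ≤ J (a, b) →
          |z| ≤ max |Z y| |minusSol f p y| →
          ‖q y.1 * z‖ ≤ Q * (A * (J (a, b) + δ) * Real.exp (2 * Q * y.1)) := by
        intro y z hy hy1 hyJ hz
        rw [Real.norm_eq_abs, abs_mul]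
        refine mul_le_mul (hqs _ hy1) (hz.trans ((hA'' y hy).trans ?_)) (abs_nonneg _) hQ0.le
        calc A * (Real.exp (2 * Q * y.1) * (J y + δ))
            ≤ A * (Real.exp (2 * Q * y.1) * (J (a, b) + δ)) := by gcongr
          _ = _ := by ring
      have hexp : 1 ≤ Real.exp (2 * Q * a) := Real.one_le_exp (by positivity)
      refine max_le ?_ ?_
      · have e : Z (a, b) = ∫ s in (0 : ℝ)..a, q s * minusSol f p (s, b + a + -1 * s) := by
          rw [hZ]
          dsimp only
          rw [plusSol_eq h]
          ring
        rw [e]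
        refine (norm_integral_le_half_mul_exp hAJ ha0 (fun s hs =>
          hbd (s, b + a + -1 * s) _ (hm1 s hs) hs (hJ1 s hs) (le_max_right _ _))).trans ?_
        have : 0 ≤ Q * (Real.exp (2 * Q * a) * (J (a, b) + δ)) := by positivity
        linarith
      -- Here `plusSol` is split into the free wave and its deviation. Along this characteristic the
      -- free wave is evaluated at b - a + 2s, which sweeps the whole base of the triangle and gives
      -- Q·`J`, the source of the constant c = Q; the deviation gives the half.
      · have hc1 : Continuous fun s => q s * (2 * p.eval (b - a + 2 * s)) := by
          have := h.continuous_logDeriv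
          fun_prop
        have hc2 : Continuous fun s => q s * Z (s, b - a + 1 * s) := by
          have := h.continuous_logDeriv
          fun_prop
        have e : minusSol f p (a, b) = (∫ s in (0 : ℝ)..a, q s * (2 * p.eval (b - a + 2 * s))) +
            ∫ s in (0 : ℝ)..a, q s * Z (s, b - a + 1 * s) := by
          rw [minusSol_eq h, ← intervalIntegral.integral_add (hc1.intervalIntegrable _ _)
            (hc2.intervalIntegrable _ _)]
          congr 1
          funext s
          rw [hZ]
          dsimp only
          rw [show b - a + 1 * s + s = b - a + 2 * s by ring]
          ring
        have e1 : |∫ s in (0 : ℝ)..a, q s * (2 * p.eval (b - a + 2 * s))| ≤ Q * J (a, b) := by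
          have hc3 : Continuous fun s => Q * (2 * |p.eval (b - a + 2 * s)|) := by fun_prop
          have h1 := intervalIntegral.norm_integral_le_of_norm_le (μ := MeasureTheory.volume) ha0
            (f := fun s => q s * (2 * p.eval (b - a + 2 * s)))
            (g := fun s => Q * (2 * |p.eval (b - a + 2 * s)|))
            (Filter.Eventually.of_forall fun s hs => by
              rw [Real.norm_eq_abs, abs_mul, abs_mul, abs_two]
              exact mul_le_mul_of_nonneg_right (hqs s hs) (by positivity))
            (hc3.intervalIntegrable _ _)
          refine h1.trans (le_of_eq ?_)
          rw [intervalIntegral.integral_const_mul, intervalIntegral.integral_const_mul,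
            
            intervalIntegral.mul_integral_comp_add_mul (f := fun y => |p.eval y|)]
          rw [hJ]
          dsimp only
          ring_nf
        have e2 := norm_integral_le_half_mul_exp hAJ ha0 (fun s hs =>
          hbd (s, b - a + 1 * s) (Z (s, b - a + 1 * s)) (hm2 s hs) hs (hJ2 s hs) (le_max_left _ _))
        rw [e]
        refine (abs_add_le _ _).trans ((add_le_add e1 e2).trans ?_)
        have : Q * J (a, b) ≤ Q * (Real.exp (2 * Q * a) * (J (a, b) + δ)) := by
          gcongr
          nlinarith
        linarith
  have hx : (ξ, t) ∈ Ω := ⟨hξ.1, hξ.2, le_rfl⟩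
  have hlim : Filter.Tendsto (fun δ : ℝ => 2 * Q * (Real.exp (2 * Q * ξ) * (J (ξ, t) + δ)))
      (nhdsWithin 0 (Set.Ioi 0)) (nhds (2 * Q * (Real.exp (2 * Q * ξ) * (J (ξ, t) + 0)))) :=
    (Continuous.tendsto (by fun_prop) 0).mono_left nhdsWithin_le_nhds
  have h1 := ge_of_tendsto hlim (Filter.eventually_of_mem self_mem_nhdsWithin
    fun δ hδ => main δ hδ ⟨(ξ, t), hx⟩)
  refine h1.trans ?_
  have hJa := hJ0 (ξ, t) hξ.1
  rw [add_zero, ← mul_assoc]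
  refine mul_le_mul_of_nonneg_right ?_ hJa
  have := hξ.2
  gcongr

/-- The real part is half the sum of the two idempotent components. An L¹ norm on the right, rather
than a sup norm, is what permits termwise evaluation of Legendre series. -/
theorem abs_polySol_sub_le (h : IsLogDeriv f q) {L Q : ℝ} (hQ0 : 0 < Q)
    (hQ : ∀ s ∈ Set.Icc 0 L, |q s| ≤ Q) (p : ℝ[X]) {ξ : ℝ} (hξ : ξ ∈ Set.Icc 0 L) (t : ℝ) :
    |polySol f p (ξ, t) - p.eval (t + ξ)| ≤
      2 * Q * Real.exp (2 * Q * L) * ∫ x in (t - ξ)..(t + ξ), |p.eval x| := by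
  have h1 := abs_plusSol_sub_le_and_abs_minusSol_le h hQ0 hQ p hξ t
  have h2 := (le_max_left _ _).trans h1
  have h3 := (le_max_right _ _).trans h1
  have e : polySol f p (ξ, t) - p.eval (t + ξ) =
      ((plusSol f p (ξ, t) - 2 * p.eval (t + ξ)) + minusSol f p (ξ, t)) / 2 := by
    rw [plusSol, minusSol]
    ring
  rw [e, abs_div, abs_two]
  have := abs_add_le (plusSol f p (ξ, t) - 2 * p.eval (t + ξ)) (minusSol f p (ξ, t))
  linarith

end Vekua

/-! ### Extension to continuous and C¹ data, and its Legendre series -/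

namespace Vekua

open Polynomial Filter Topology

section Domain

variable {L α β : ℝ}

theorem isOpen_openDomain (L α β : ℝ) : IsOpen (openDomain L α β) :=
  (isOpen_lt continuous_const continuous_fst).inter
    ((isOpen_lt continuous_fst continuous_const).inter
      ((isOpen_lt (g := fun p : ℝ × ℝ => p.2 - p.1) continuous_const (by fun_prop)).inter
        (isOpen_lt (f := fun p : ℝ × ℝ => p.2 + p.1) (by fun_prop) continuous_const)))

theorem isClosed_domain (L α β : ℝ) : IsClosed (domain L α β) :=
  (isClosed_le continuous_const continuous_fst).inter
    ((isClosed_le continuous_fst continuous_const).inter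
      ((isClosed_le (g := fun p : ℝ × ℝ => p.2 - p.1) continuous_const (by fun_prop)).inter
        (isClosed_le (f := fun p : ℝ × ℝ => p.2 + p.1) (by fun_prop) continuous_const)))

theorem openDomain_subset_domain : openDomain L α β ⊆ domain L α β :=
  fun _ h => ⟨h.1.le, h.2.1.le, h.2.2.1.le, h.2.2.2.le⟩

theorem convex_openDomain (L α β : ℝ) : Convex ℝ (openDomain L α β) := by
  rintro x ⟨h1, h2, h3, h4⟩ y ⟨k1, k2, k3, k4⟩ a b ha hb hab
  have key : ∀ u v : ℝ, 0 < u → 0 < v → 0 < a * u + b * v := by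
    intro u v hu hv
    rcases ha.eq_or_lt with rfl | ha
    · have : b = 1 := by linarith
      subst this
      linarith
    · have := mul_pos ha hu
      have := mul_nonneg hb hv.le
      linarith
  obtain rfl : b = 1 - a := by linarith
  refine ⟨?_, ?_, ?_, ?_⟩ <;>
    simp only [Prod.fst_add, Prod.snd_add, Prod.smul_fst, Prod.smul_snd, smul_eq_mul]
  · exact key _ _ h1 k1
  · linarith [key _ _ (sub_pos.2 h2) (sub_pos.2 k2)]
  · linarith [key _ _ (sub_pos.2 h3) (sub_pos.2 k3)]
  · linarith [key _ _ (sub_pos.2 h4) (sub_pos.2 k4)]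

theorem openDomain_nonempty (hL : 0 < L) (hαβ : α < β) : (openDomain L α β).Nonempty := by
  obtain ⟨r, hr0, hr⟩ := exists_between (lt_min hL (show 0 < (β - α) / 2 by linarith))
  have h1 := (lt_min_iff.1 hr).1
  have h2 := (lt_min_iff.1 hr).2
  exact ⟨(r, (α + β) / 2), hr0, h1, by dsimp only; linarith, by dsimp only; linarith⟩

theorem closure_openDomain (hL : 0 < L) (hαβ : α < β) :
    closure (openDomain L α β) = domain L α β := by
  refine ((isClosed_domain L α β).closure_subset_iff.2 openDomain_subset_domain).antisymm ?_
  intro x hx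
  obtain ⟨y, hy⟩ := openDomain_nonempty hL hαβ
  have hlim : Tendsto (fun r : ℝ => x + r • (y - x)) (𝓝[>] 0) (𝓝 (x + (0 : ℝ) • (y - x))) :=
    (Continuous.tendsto (by fun_prop) 0).mono_left nhdsWithin_le_nhds
  rw [zero_smul, add_zero] at hlim
  refine mem_closure_of_tendsto hlim ?_
  filter_upwards [Ioo_mem_nhdsGT (zero_lt_one' ℝ)] with r hr
  obtain ⟨h1, h2, h3, h4⟩ := hx
  obtain ⟨k1, k2, k3, k4⟩ := hy
  have key : ∀ u v : ℝ, 0 ≤ u → 0 < v → 0 < u + r * (v - u) := by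
    intro u v hu hv
    have := mul_pos hr.1 hv
    have := mul_nonneg (sub_pos.2 hr.2).le hu
    linarith
  refine ⟨?_, ?_, ?_, ?_⟩ <;> simp only [Prod.fst_add, Prod.snd_add, Prod.smul_fst, Prod.smul_snd,
    smul_eq_mul, Prod.fst_sub, Prod.snd_sub]
  · exact key _ _ h1 k1
  · linarith [key _ _ (sub_nonneg.2 h2) (sub_pos.2 k2)]
  · linarith [key _ _ (sub_nonneg.2 h3) (sub_pos.2 k3)]
  · linarith [key _ _ (sub_nonneg.2 h4) (sub_pos.2 k4)]

/-- A function with a derivative in the interior which extends continuously to the closed domain is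
`C¹` up to the boundary. -/
theorem contDiffOn_domain (hL : 0 < L) (hαβ : α < β) {U : ℝ × ℝ → ℝ}
    {U' : ℝ × ℝ → ℝ × ℝ →L[ℝ] ℝ} (hU : ContinuousOn U (domain L α β))
    (hU' : ContinuousOn U' (domain L α β))
    (hd : ∀ x ∈ openDomain L α β, HasFDerivAt U (U' x) x) :
    ContDiffOn ℝ 1 U (domain L α β) := by
  have hcl := closure_openDomain hL hαβ
  have hd' : ∀ x ∈ domain L α β, HasFDerivWithinAt U (U' x) (domain L α β) x := by
    intro x hx
    rw [← hcl]
    refine hasFDerivWithinAt_closure_of_tendsto_fderiv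
      (fun y hy => (hd y hy).differentiableAt.differentiableWithinAt)
      (convex_openDomain L α β) (isOpen_openDomain L α β)
      (fun y hy => (hU y (hcl ▸ hy)).mono openDomain_subset_domain) ?_
    have h1 : Tendsto U' (𝓝[openDomain L α β] x) (𝓝 (U' x)) :=
      (hU' x hx).mono openDomain_subset_domain
    refine h1.congr' ?_
    filter_upwards [self_mem_nhdsWithin] with y hy
    exact (hd y hy).fderiv.symm
  have huniq : UniqueDiffOn ℝ (domain L α β) := by
    rw [← hcl]
    refine uniqueDiffOn_convex (convex_openDomain L α β).closure ?_
    obtain ⟨y, hy⟩ := openDomain_nonempty (L := L) hL hαβ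
    exact ⟨y, interior_mono subset_closure ((isOpen_openDomain L α β).interior_eq.symm ▸ hy)⟩
  rw [show (1 : WithTop ℕ∞) = 0 + 1 from rfl, contDiffOn_succ_iff_fderivWithin huniq]
  exact ⟨fun x hx => (hd' x hx).differentiableWithinAt, by simp,
    contDiffOn_zero.2 <| hU'.congr fun x hx => (hd' x hx).fderivWithin (huniq x hx)⟩

end Domain

theorem exists_derivative_eq (r : ℝ[X]) : ∃ p : ℝ[X], derivative p = r := by
  induction r using Polynomial.induction_on' with
  | add p q hp hq =>
    obtain ⟨a, rfl⟩ := hp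
    obtain ⟨b, rfl⟩ := hq
    exact ⟨a + b, derivative_add⟩
  | monomial n a =>
    refine ⟨monomial (n + 1) (a / (n + 1)), ?_⟩
    rw [derivative_monomial, Nat.add_sub_cancel, Nat.cast_add, Nat.cast_one]
    congr 1
    field_simp

/-- Weierstrass approximation in the `C¹` norm. -/
theorem exists_polynomial_near_of_contDiffOn {α β : ℝ} (hαβ : α < β) {g : ℝ → ℝ}
    (hg : ContDiffOn ℝ 1 g (Set.Icc α β)) {δ : ℝ} (hδ : 0 < δ) :
    ∃ p : ℝ[X], (∀ x ∈ Set.Icc α β, |p.eval x - g x| ≤ δ) ∧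
      ∀ x ∈ Set.Icc α β, |(derivative p).eval x - derivWithin g (Set.Icc α β) x| ≤ δ := by
  have hc : ContinuousOn (derivWithin g (Set.Icc α β)) (Set.Icc α β) :=
    hg.continuousOn_derivWithin (uniqueDiffOn_Icc hαβ) le_rfl
  -- An error η in the derivative accumulates to at most η(β - α) in the function once the values at
  -- α are matched; the 1 ensures η ≤ δ.
  set η := δ / (1 + (β - α)) with hη
  have hβα : 0 < β - α := sub_pos.2 hαβ
  have hη0 : 0 < η := by positivity
  have hηδ : η * (1 + (β - α)) = δ := by rw [hη]; field_simp
  obtain ⟨r, hr⟩ := exists_polynomial_near_of_continuousOn α β _ hc η hη0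
  obtain ⟨p₀, hp₀⟩ := exists_derivative_eq r
  refine ⟨p₀ + C (g α - p₀.eval α), fun x hx => ?_, fun x hx => ?_⟩
  · have hd : ∀ y ∈ Set.Icc α β, HasDerivWithinAt (fun y => p₀.eval y - g y)
        (r.eval y - derivWithin g (Set.Icc α β) y) (Set.Icc α β) y := by
      intro y hy
      rw [← hp₀]
      exact (p₀.hasDerivAt y).hasDerivWithinAt.sub
        ((hg.differentiableOn one_ne_zero) y hy).hasDerivWithinAt
    have := (convex_Icc α β).norm_image_sub_le_of_norm_hasDerivWithin_le hd
      (fun y hy => (hr y hy).le) (Set.left_mem_Icc.2 hαβ.le) hx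
    rw [Real.norm_eq_abs, Real.norm_eq_abs, abs_of_nonneg (sub_nonneg.2 hx.1)] at this
    rw [eval_add, eval_C, show p₀.eval x + (g α - p₀.eval α) - g x =
      p₀.eval x - g x - (p₀.eval α - g α) by ring]
    refine this.trans ?_
    rw [← hηδ]
    have := hx.2
    gcongr
    linarith
  · rw [derivative_add, derivative_C, add_zero, hp₀]
    refine (hr x hx).le.trans ?_
    rw [← hηδ]
    nlinarith

variable {f q : ℝ → ℝ} {L α β : ℝ}

/-- `U` is the continuous extension to `g` of the map `p ↦ polySol f p`, with norm at most `K`. -/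
def IsExtension (f : ℝ → ℝ) (L α β K : ℝ) (g : ℝ → ℝ) (U : ℝ × ℝ → ℝ) : Prop :=
  ∀ (p : ℝ[X]) (δ : ℝ), ∀ x ∈ domain L α β,
    (∀ y ∈ Set.Icc (x.2 - x.1) (x.2 + x.1), |p.eval y - g y| ≤ δ) → |polySol f p x - U x| ≤ K * δ

theorem abs_polySol_le (h : IsLogDeriv f q) {Q : ℝ} (hQ0 : 0 < Q)
    (hQ : ∀ s ∈ Set.Icc 0 L, |q s| ≤ Q) (p : ℝ[X]) {x : ℝ × ℝ} (hx : x.1 ∈ Set.Icc 0 L) {δ : ℝ}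
    (hp : ∀ y ∈ Set.Icc (x.2 - x.1) (x.2 + x.1), |p.eval y| ≤ δ) :
    |polySol f p x| ≤ (1 + 2 * Q * Real.exp (2 * Q * L) * (2 * L)) * δ := by
  have h1 := abs_polySol_sub_le h hQ0 hQ p hx x.2
  have hx0 := hx.1
  have hmem : x.2 + x.1 ∈ Set.Icc (x.2 - x.1) (x.2 + x.1) := ⟨by linarith, le_rfl⟩
  have hδ : 0 ≤ δ := (abs_nonneg _).trans (hp _ hmem)
  have h2 : ∫ y in (x.2 - x.1)..(x.2 + x.1), |p.eval y| ≤ 2 * L * δ := by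
    have := intervalIntegral.integral_mono_on (μ := MeasureTheory.volume) (by linarith)
      (p.continuous.abs.intervalIntegrable (x.2 - x.1) (x.2 + x.1))
      (continuous_const.intervalIntegrable (x.2 - x.1) (x.2 + x.1)) hp
    rw [intervalIntegral.integral_const, smul_eq_mul] at this
    have := hx.2
    nlinarith
  have h3 : |polySol f p x| ≤ |polySol f p (x.1, x.2) - p.eval (x.2 + x.1)| +
      |p.eval (x.2 + x.1)| := by
    simpa using abs_add_le (polySol f p (x.1, x.2) - p.eval (x.2 + x.1)) (p.eval (x.2 + x.1))
  have h4 : 2 * Q * Real.exp (2 * Q * L) * ∫ y in (x.2 - x.1)..(x.2 + x.1), |p.eval y| ≤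
      2 * Q * Real.exp (2 * Q * L) * (2 * L * δ) := by gcongr
  have := hp _ hmem
  linarith

theorem Icc_subset_of_mem_domain {x : ℝ × ℝ} (hx : x ∈ domain L α β) :
    Set.Icc (x.2 - x.1) (x.2 + x.1) ⊆ Set.Icc α β :=
  Set.Icc_subset_Icc hx.2.2.1 hx.2.2.2

/-- Extension by density, from the sup norm bound `abs_polySol_le`. The value at a point depends
only on the data over the base of its characteristic triangle, so closeness is demanded only there.
-/
theorem exists_isExtension (h : IsLogDeriv f q) {Q : ℝ} (hL : 0 < L) (hQ0 : 0 < Q)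
    (hQ : ∀ s ∈ Set.Icc 0 L, |q s| ≤ Q) {g : ℝ → ℝ} (hg : ContinuousOn g (Set.Icc α β)) :
    ∃ U, IsExtension f L α β (1 + 2 * Q * Real.exp (2 * Q * L) * (2 * L)) g U := by
  set K := 1 + 2 * Q * Real.exp (2 * Q * L) * (2 * L) with hK
  have hK0 : 0 < K := by positivity
  choose p hp using fun k : ℕ => exists_polynomial_near_of_continuousOn α β g hg
    (1 / ((k : ℝ) + 1)) (by positivity)
  have key : ∀ (r : ℝ[X]) (δ : ℝ), ∀ x ∈ domain L α β,
      (∀ y ∈ Set.Icc (x.2 - x.1) (x.2 + x.1), |r.eval y - g y| ≤ δ) → ∀ k,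
      |polySol f r x - polySol f (p k) x| ≤ K * (δ + 1 / ((k : ℝ) + 1)) := by
    intro r δ x hx hr k
    rw [← polySol_sub]
    refine abs_polySol_le h hQ0 hQ _ ⟨hx.1, hx.2.1⟩ fun y hy => ?_
    rw [eval_sub]
    have h1 := hr y hy
    have h2 := hp k y (Icc_subset_of_mem_domain hx hy)
    rw [abs_sub_comm] at h2
    exact (abs_sub_le _ (g y) _).trans (add_le_add h1 h2.le)
  have hlim0 : Tendsto (fun k : ℕ => 1 / ((k : ℝ) + 1)) atTop (𝓝 0) :=
    tendsto_one_div_add_atTop_nhds_zero_nat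
  have hlim : ∀ x ∈ domain L α β, ∃ u, Tendsto (fun k => polySol f (p k) x) atTop (𝓝 u) := by
    intro x hx
    refine cauchySeq_tendsto_of_complete (cauchySeq_of_le_tendsto_0
      (fun k : ℕ => K * (1 / ((k : ℝ) + 1) + 1 / ((k : ℝ) + 1))) ?_ ?_)
    · intro n m N hn hm
      rw [Real.dist_eq]
      refine (key (p n) _ x hx
        (fun y hy => (hp n y (Icc_subset_of_mem_domain hx hy)).le) m).trans ?_
      gcongr
    · simpa using (hlim0.add hlim0).const_mul K
  choose! U hU using hlim
  refine ⟨U, fun r δ x hx hr => ?_⟩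
  have h1 : Tendsto (fun k => |polySol f r x - polySol f (p k) x|) atTop
      (𝓝 |polySol f r x - U x|) := (tendsto_const_nhds.sub (hU x hx)).abs
  have h2 : Tendsto (fun k : ℕ => K * (δ + 1 / ((k : ℝ) + 1))) atTop (𝓝 (K * (δ + 0))) :=
    (hlim0.const_add δ).const_mul K
  rw [add_zero] at h2
  exact le_of_tendsto_of_tendsto' h1 h2 (key r δ x hx hr)

theorem tendstoUniformlyOn_of_dist_le {X E : Type*} [PseudoMetricSpace E] {F : ℕ → X → E}
    {G : X → E} {s : Set X} {K : ℝ} (h : ∀ n, ∀ x ∈ s, dist (G x) (F n x) ≤ K * (1 / ((n : ℝ) + 1))) :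
    TendstoUniformlyOn F G atTop s := by
  rw [Metric.tendstoUniformlyOn_iff]
  intro ε hε
  have hlim : Tendsto (fun n : ℕ => K * (1 / ((n : ℝ) + 1))) atTop (𝓝 (K * 0)) :=
    tendsto_one_div_add_atTop_nhds_zero_nat.const_mul K
  rw [mul_zero] at hlim
  filter_upwards [hlim.eventually_lt_const hε] with n hn x hx
  exact (h n x hx).trans_lt hn

namespace IsExtension

variable {K : ℝ} {g : ℝ → ℝ} {U : ℝ × ℝ → ℝ}

theorem tendstoUniformlyOn (hU : IsExtension f L α β K g U) {p : ℕ → ℝ[X]}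
    (hp : ∀ n : ℕ, ∀ x ∈ Set.Icc α β, |(p n).eval x - g x| ≤ 1 / ((n : ℝ) + 1)) :
    TendstoUniformlyOn (fun n => polySol f (p n)) U atTop (domain L α β) := by
  refine tendstoUniformlyOn_of_dist_le (K := K) fun n x hx => ?_
  rw [dist_comm, Real.dist_eq]
  exact hU _ _ x hx fun y hy => hp n y (Icc_subset_of_mem_domain hx hy)

theorem continuousOn (hU : IsExtension f L α β K g U) (h : IsLogDeriv f q)
    (hg : ContinuousOn g (Set.Icc α β)) : ContinuousOn U (domain L α β) := by
  choose p hp using fun k : ℕ => exists_polynomial_near_of_continuousOn α β g hg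
    (1 / ((k : ℝ) + 1)) (by positivity)
  exact (hU.tendstoUniformlyOn fun n x hx => (hp n x hx).le).continuousOn
    (Frequently.of_forall fun n => (continuous_polySol h (p n)).continuousOn)

theorem apply_zero (hU : IsExtension f L α β K g U) (h : IsLogDeriv f q) (hL : 0 < L) {t : ℝ}
    (ht : t ∈ Set.Icc α β) : U (0, t) = g t := by
  have hx : ((0 : ℝ), t) ∈ domain L α β :=
    ⟨le_rfl, hL.le, by simpa using ht.1, by simpa using ht.2⟩
  -- At ξ = 0 the base shrinks to the single point t, where the constant polynomial g(t) is exact.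
  have := hU (C (g t)) 0 (0, t) hx (by
    intro y hy
    obtain rfl : y = t := by simpa using hy
    simp)
  rw [polySol_zero_left h, eval_C, mul_zero, abs_nonpos_iff, sub_eq_zero] at this
  exact this.symm

theorem norm_gradient_sub_le (a b a' b' : ℝ) :
    ‖gradient a b - gradient a' b'‖ ≤ |a - a'| + |b - b'| := by
  have e : gradient a b - gradient a' b' = gradient (a - a') (b - b') := by
    ext <;> simp [gradient]
  rw [e, gradient]
  refine (norm_add_le _ _).trans (add_le_add ?_ ?_)
  · rw [norm_smul, Real.norm_eq_abs]
    exact mul_le_of_le_one_right (abs_nonneg _) (ContinuousLinearMap.norm_fst_le ℝ ℝ ℝ)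
  · rw [norm_smul, Real.norm_eq_abs]
    exact mul_le_of_le_one_right (abs_nonneg _) (ContinuousLinearMap.norm_snd_le ℝ ℝ ℝ)

/-- For polynomials p_n tending to g in C¹, the gradients involve only the images of p_n and p_n'
for f and 1/f. These converge uniformly to U, U' and V', so differentiation passes to the limit. -/
theorem hasFDerivAt (hαβ : α < β) {Q : ℝ}
    (hQ : ∀ s ∈ Set.Icc 0 L, |q s| ≤ Q) (h : IsLogDeriv f q) (hg : ContDiffOn ℝ 1 g (Set.Icc α β))
    {U' V' : ℝ × ℝ → ℝ} (hU : IsExtension f L α β K g U)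
    (hU' : IsExtension f L α β K (derivWithin g (Set.Icc α β)) U')
    (hV' : IsExtension f⁻¹ L α β K (derivWithin g (Set.Icc α β)) V') {x : ℝ × ℝ}
    (hx : x ∈ openDomain L α β) :
    HasFDerivAt U (gradient (q x.1 * U x + V' x) (U' x)) x := by
  choose p hp hp' using fun k : ℕ => exists_polynomial_near_of_contDiffOn hαβ hg
    (show 0 < 1 / ((k : ℝ) + 1) by positivity)
  have h1 : ∀ x ∈ openDomain L α β,
      Tendsto (fun n => polySol f (p n) x) atTop (𝓝 (U x)) := fun x hx =>
    (hU.tendstoUniformlyOn hp).tendsto_at (openDomain_subset_domain hx)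
  have h2 : TendstoUniformlyOn (fun n x => gradient
      (q x.1 * polySol f (p n) x + polySol f⁻¹ (derivative (p n)) x)
      (polySol f (derivative (p n)) x))
      (fun x => gradient (q x.1 * U x + V' x) (U' x)) atTop (openDomain L α β) := by
    refine tendstoUniformlyOn_of_dist_le (K := Q * K + K + K) fun n x hx => ?_
    have hx' := openDomain_subset_domain hx
    have hsub := Icc_subset_of_mem_domain hx'
    have k1 := hU _ _ x hx' fun y hy => hp n y (hsub hy)
    have k2 := hU' _ _ x hx' fun y hy => hp' n y (hsub hy)
    have k3 := hV' _ _ x hx' fun y hy => hp' n y (hsub hy)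
    rw [dist_comm, dist_eq_norm]
    refine (norm_gradient_sub_le _ _ _ _).trans ?_
    have hq := hQ x.1 ⟨hx'.1, hx'.2.1⟩
    have k4 : |q x.1 * polySol f (p n) x + polySol f⁻¹ (derivative (p n)) x -
        (q x.1 * U x + V' x)| ≤ |q x.1| * |polySol f (p n) x - U x| +
          |polySol f⁻¹ (derivative (p n)) x - V' x| := by
      rw [← abs_mul]
      refine le_trans (le_of_eq ?_) (abs_add_le _ _)
      congr 1
      ring
    have k5 : |q x.1| * |polySol f (p n) x - U x| ≤ Q * (K * (1 / ((n : ℝ) + 1))) :=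
      mul_le_mul hq k1 (abs_nonneg _) ((abs_nonneg _).trans hq)
    linarith
  exact hasFDerivAt_of_tendstoUniformlyOn (isOpen_openDomain L α β) h2
    (fun n x _ => hasFDerivAt_polySol h (p n) x) h1 hx

theorem contDiffOn (hL : 0 < L) (hαβ : α < β) {Q : ℝ}
    (hQ : ∀ s ∈ Set.Icc 0 L, |q s| ≤ Q) (h : IsLogDeriv f q) (hg : ContDiffOn ℝ 1 g (Set.Icc α β))
    {U' V' : ℝ × ℝ → ℝ} (hU : IsExtension f L α β K g U)
    (hU' : IsExtension f L α β K (derivWithin g (Set.Icc α β)) U')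
    (hV' : IsExtension f⁻¹ L α β K (derivWithin g (Set.Icc α β)) V') :
    ContDiffOn ℝ 1 U (domain L α β) := by
  have hc : ContinuousOn (derivWithin g (Set.Icc α β)) (Set.Icc α β) :=
    hg.continuousOn_derivWithin (uniqueDiffOn_Icc hαβ) le_rfl
  have hUc := hU.continuousOn h hg.continuousOn
  have hUc' := hU'.continuousOn h hc
  have hVc' := hV'.continuousOn h.inv hc
  refine contDiffOn_domain hL hαβ hUc ?_ fun x hx => hU.hasFDerivAt hαβ hQ h hg hU' hV' hx
  have hq : ContinuousOn (fun x : ℝ × ℝ => q x.1) (domain L α β) :=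
    (h.continuous_logDeriv.comp continuous_fst).continuousOn
  exact (((hq.mul hUc).add hVc').smul continuousOn_const).add (hUc'.smul continuousOn_const)

/-- The Legendre series of the extension. -/
theorem hasSum (hU : IsExtension f L α β K g U) (hK : 0 ≤ K) (h : IsLogDeriv f q) {Q : ℝ}
    (hQ0 : 0 < Q) (hQ : ∀ s ∈ Set.Icc 0 L, |q s| ≤ Q) (hg : ContinuousOn g (Set.Icc α β))
    {ξ t : ℝ} (hx : (ξ, t) ∈ domain L α β) (hξ : 0 < ξ) :
    HasSum (fun n => coeffA f n ξ / ξ *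
      ∫ τ in (-ξ)..ξ, (legendre n).eval (τ / ξ) * g (t + τ)) (U (ξ, t) - g (t + ξ)) := by
  have hne : ξ ≠ 0 := hξ.ne'
  -- The deviation from the free wave at (ξ, 0), with the base rescaled to [-1, 1]. Since P_n(1) =
  -- 1, its value on P_n is a_n without the factor (2n + 1)/2.
  set Λ : ℝ[X] →ₗ[ℝ] ℝ :=
    powerMap f ξ ∘ₗ (aeval (C ξ⁻¹ * X : ℝ[X])).toLinearMap - leval 1 with hΛdef
  have hΛ : ∀ p, Λ p = powerMap f ξ (p.comp (C ξ⁻¹ * X)) - p.eval 1 := fun p => rfl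
  have hcoeff : ∀ p : ℝ[X], ∀ k, (p.comp (C ξ⁻¹ * X)).coeff k = p.coeff k / ξ ^ k := by
    intro p k
    rw [comp_C_mul_X_coeff, inv_pow, div_eq_mul_inv]
  have hΛl : ∀ n, coeffA f n ξ = (2 * n + 1) / 2 * Λ (legendre n) := by
    intro n
    rw [hΛ, coeffA, eval_legendre_of_sq_eq_one n (by norm_num), one_pow,
      powerMap_apply f ξ (N := n + 1)]
    · simp only [hcoeff]
      congr 2
      exact Finset.sum_congr rfl fun k _ => by ring
    · refine Nat.lt_succ_of_le (natDegree_comp_le.trans ?_)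
      have h1 : (C ξ⁻¹ * X : ℝ[X]).natDegree ≤ 1 := (natDegree_C_mul_le _ _).trans natDegree_X_le
      simpa using Nat.mul_le_mul (natDegree_legendre_le n) h1
  have hscale : ∀ F : ℝ → ℝ, ∫ x in (-1 : ℝ)..1, F (ξ * x) = ξ⁻¹ * ∫ τ in (-ξ)..ξ, F τ := by
    intro F
    rw [intervalIntegral.integral_comp_mul_left F hne]
    simp
  have hterm : ∀ n, legendreCoeff (fun x => g (t + ξ * x)) n * Λ (legendre n) =
      coeffA f n ξ / ξ * ∫ τ in (-ξ)..ξ, (legendre n).eval (τ / ξ) * g (t + τ) := by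
    intro n
    have := hscale fun τ => (legendre n).eval (τ / ξ) * g (t + τ)
    simp only [mul_div_cancel_left₀ _ hne] at this
    rw [legendreCoeff, this, hΛl]
    ring
  simp only [← hterm]
  have hmaps : ∀ x ∈ Set.Icc (-1 : ℝ) 1, t + ξ * x ∈ Set.Icc (t - ξ) (t + ξ) := by
    intro x hx
    constructor <;> nlinarith [hx.1, hx.2]
  -- The factor ξ in `K` comes from rescaling the base. The 1 in `K'` accounts for the free wave
  -- p(1), which is subtracted in `Λ`.
  refine hasSum_legendreCoeff (K := 2 * Q * Real.exp (2 * Q * L) * ξ) (by positivity) ?_ ?_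
    (K' := K + 1) (by positivity) ?_
  · intro p
    have h1 := abs_polySol_sub_le h hQ0 hQ (p.comp (C ξ⁻¹ * X)) ⟨hx.1, hx.2.1⟩ 0
    have h2 := hscale fun τ => |(p.comp (C ξ⁻¹ * X)).eval τ|
    simp only [eval_comp, eval_mul, eval_C, eval_X, inv_mul_cancel_left₀ hne] at h2
    rw [polySol, taylor_zero, zero_sub, zero_add] at h1
    simp only [eval_comp, eval_mul, eval_C, eval_X, inv_mul_cancel₀ hne] at h1
    rw [hΛ, h2, mul_assoc (2 * Q * Real.exp (2 * Q * L)), mul_inv_cancel_left₀ hne]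
    exact h1
  · exact hg.comp (by fun_prop) fun x hx' => Icc_subset_of_mem_domain hx (hmaps x hx')
  · intro p δ hδ hp
    -- The polynomial is moved to the base centred at t; the Taylor shift in `polySol` undoes the
    -- translation, so the same `Λ` serves every t.
    have h1 := hU (p.comp (C ξ⁻¹ * (X - C t))) δ (ξ, t) hx (by
      intro y hy
      have := hp (ξ⁻¹ * (y - t)) (by
        rw [inv_mul_eq_div]
        exact ⟨by rw [le_div_iff₀ hξ]; linarith [hy.1], by rw [div_le_iff₀ hξ]; linarith [hy.2]⟩)
      rw [mul_inv_cancel_left₀ hne, add_sub_cancel] at this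
      simpa using this)
    have h2 : taylor t (p.comp (C ξ⁻¹ * (X - C t))) = p.comp (C ξ⁻¹ * X) := by
      rw [taylor_apply, comp_assoc]
      simp
    rw [polySol, h2] at h1
    have h3 := hp 1 (by norm_num)
    rw [mul_one] at h3
    rw [hΛ, show powerMap f ξ (p.comp (C ξ⁻¹ * X)) - p.eval 1 - (U (ξ, t) - g (t + ξ)) =
      (powerMap f ξ (p.comp (C ξ⁻¹ * X)) - U (ξ, t)) - (p.eval 1 - g (t + ξ)) by ring]
    refine (abs_sub _ _).trans ?_
    dsimp only at h1
    linarith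

end IsExtension

end Vekua

/-! ### Bicomplex numbers as a real normed space -/

namespace Bicomplex

/-- Bicomplex numbers as pairs of components, with their topologies. -/
noncomputable def equivProdL : Bicomplex ≃L[ℝ] ℂ × ℂ where
  toFun w := (w.re, w.im)
  invFun z := ⟨z.1, z.2⟩
  map_add' _ _ := rfl
  map_smul' _ _ := rfl
  left_inv _ := rfl
  right_inv _ := rfl
  continuous_toFun := (AddMonoidHomClass.isometry_of_norm (toProd.restrictScalars ℝ)
    fun _ => rfl).continuous
  continuous_invFun := AddMonoidHomClass.continuous_of_bound
    ({ toFun := fun z => ⟨z.1, z.2⟩, map_zero' := rfl, map_add' := fun _ _ => rfl } :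
      ℂ × ℂ →+ Bicomplex) 1 fun z => by rw [one_mul]; exact le_rfl

/-- The component `u` of `u + v j`. -/
noncomputable def reL : Bicomplex →L[ℝ] ℂ :=
  (ContinuousLinearMap.fst ℝ ℂ ℂ).comp (equivProdL : Bicomplex →L[ℝ] ℂ × ℂ)

/-- The component `v` of `u + v j`. -/
noncomputable def imL : Bicomplex →L[ℝ] ℂ :=
  (ContinuousLinearMap.snd ℝ ℂ ℂ).comp (equivProdL : Bicomplex →L[ℝ] ℂ × ℂ)

/-- `w ↦ w⁺`. -/
noncomputable def plusL : Bicomplex →L[ℝ] ℂ := reL + imL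

/-- `w ↦ w⁻`. -/
noncomputable def minusL : Bicomplex →L[ℝ] ℂ := reL - imL

theorem reL_apply (w : Bicomplex) : reL w = w.re := rfl

theorem imL_apply (w : Bicomplex) : imL w = w.im := rfl

theorem plusL_apply (w : Bicomplex) : plusL w = plus w := rfl

theorem minusL_apply (w : Bicomplex) : minusL w = minus w := rfl

theorem eq_of_plus_of_minus {v w : Bicomplex} (h1 : plus v = plus w) (h2 : minus v = minus w) :
    v = w := by
  simp only [plus, minus] at h1 h2
  ext
  · linear_combination (h1 + h2) / 2
  · linear_combination (h1 - h2) / 2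

theorem hasDerivAt_mk {u v : ℝ → ℂ} {u' v' : ℂ} {x : ℝ} (hu : HasDerivAt u u' x)
    (hv : HasDerivAt v v' x) : HasDerivAt (fun s => (⟨u s, v s⟩ : Bicomplex)) ⟨u', v'⟩ x :=
  (equivProdL.symm : ℂ × ℂ →L[ℝ] Bicomplex).hasFDerivAt.comp_hasDerivAt x (hu.prodMk hv)

theorem contDiffOn_mk {E : Type*} [NormedAddCommGroup E] [NormedSpace ℝ E] {u v : E → ℂ} {s : Set E}
    (hu : ContDiffOn ℝ 1 u s) (hv : ContDiffOn ℝ 1 v s) :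
    ContDiffOn ℝ 1 (fun x => (⟨u x, v x⟩ : Bicomplex)) s :=
  (equivProdL.symm : ℂ × ℂ →L[ℝ] Bicomplex).contDiff.comp_contDiffOn (hu.prodMk hv)

theorem hasSum_mk {u v : ℕ → ℂ} {a b : ℂ} (hu : HasSum u a) (hv : HasSum v b) :
    HasSum (fun n => (⟨u n, v n⟩ : Bicomplex)) ⟨a, b⟩ :=
  (equivProdL.symm : ℂ × ℂ →L[ℝ] Bicomplex).hasSum (hu.prodMk hv)

end Bicomplex

/-! ### Complex-valued data -/

namespace Vekua

open Bicomplex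

variable {f q : ℝ → ℝ} {L α β : ℝ}

section Integral

theorem continuousOn_eval_div_mul (n : ℕ) (ξ : ℝ) {g : ℝ → ℂ}
    (hg : ContinuousOn g (Set.Icc (-ξ) ξ)) :
    ContinuousOn (fun τ => (((legendre n).eval (τ / ξ) : ℝ) : ℂ) * g τ) (Set.Icc (-ξ) ξ) := by
  refine ContinuousOn.mul (Continuous.continuousOn ?_) hg
  exact Complex.continuous_ofReal.comp ((legendre n).continuous.comp (by fun_prop))

theorem legendreIntegral_add (n : ℕ) {ξ : ℝ} (hξ : 0 < ξ) {g h : ℝ → ℂ}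
    (hg : ContinuousOn g (Set.Icc (-ξ) ξ)) (hh : ContinuousOn h (Set.Icc (-ξ) ξ)) :
    legendreIntegral n ξ (fun τ => g τ + h τ) = legendreIntegral n ξ g + legendreIntegral n ξ h := by
  simp only [legendreIntegral, mul_add]
  exact intervalIntegral.integral_add
    ((continuousOn_eval_div_mul n ξ hg).intervalIntegrable_of_Icc (by linarith))
    ((continuousOn_eval_div_mul n ξ hh).intervalIntegrable_of_Icc (by linarith))

theorem legendreIntegral_sub (n : ℕ) {ξ : ℝ} (hξ : 0 < ξ) {g h : ℝ → ℂ}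
    (hg : ContinuousOn g (Set.Icc (-ξ) ξ)) (hh : ContinuousOn h (Set.Icc (-ξ) ξ)) :
    legendreIntegral n ξ (fun τ => g τ - h τ) = legendreIntegral n ξ g - legendreIntegral n ξ h := by
  simp only [legendreIntegral, mul_sub]
  exact intervalIntegral.integral_sub
    ((continuousOn_eval_div_mul n ξ hg).intervalIntegrable_of_Icc (by linarith))
    ((continuousOn_eval_div_mul n ξ hh).intervalIntegrable_of_Icc (by linarith))

theorem legendreIntegral_eq_re_add_im (n : ℕ) {ξ : ℝ} (hξ : 0 < ξ) {g : ℝ → ℂ}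
    (hg : ContinuousOn g (Set.Icc (-ξ) ξ)) :
    legendreIntegral n ξ g =
      ((∫ τ in (-ξ)..ξ, (legendre n).eval (τ / ξ) * (g τ).re : ℝ) : ℂ) +
        ((∫ τ in (-ξ)..ξ, (legendre n).eval (τ / ξ) * (g τ).im : ℝ) : ℂ) * Complex.I := by
  have e : g = fun τ => ((g τ).re : ℂ) + ((g τ).im : ℂ) * Complex.I :=
    funext fun τ => (Complex.re_add_im _).symm
  have h1 : ContinuousOn (fun τ => ((g τ).re : ℂ)) (Set.Icc (-ξ) ξ) :=
    (Complex.continuous_ofReal.comp Complex.continuous_re).comp_continuousOn hg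
  have h2 : ContinuousOn (fun τ => ((g τ).im : ℂ) * Complex.I) (Set.Icc (-ξ) ξ) :=
    ((Complex.continuous_ofReal.comp Complex.continuous_im).comp_continuousOn hg).mul
      continuousOn_const
  rw [e, legendreIntegral_add n hξ h1 h2]
  simp only [legendreIntegral, ← mul_assoc, intervalIntegral.integral_mul_const, ← Complex.ofReal_mul,
    intervalIntegral.integral_ofReal]
  simp

end Integral

/-- `U` is the image of the functions `τ ↦ g(t + τ)` under the extension of `x ^ k ↦ φ_k`; `U'` and
`V'` are the derivatives with respect to `t` of `U` and of the corresponding function for `1 / f`. -/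
structure IsWave (f q : ℝ → ℝ) (L α β : ℝ) (g : ℝ → ℂ) (U U' V' : ℝ × ℝ → ℂ) : Prop where
  contDiffOn : ContDiffOn ℝ 1 U (domain L α β)
  hasDerivAt_left : ∀ ξ t, (ξ, t) ∈ openDomain L α β →
    HasDerivAt (fun s => U (s, t)) (q ξ * U (ξ, t) + V' (ξ, t)) ξ
  hasDerivAt_right : ∀ ξ t, (ξ, t) ∈ openDomain L α β →
    HasDerivAt (fun s => U (ξ, s)) (U' (ξ, t)) t
  apply_zero : ∀ t ∈ Set.Icc α β, U (0, t) = g t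
  hasSum : ∀ ξ t, (ξ, t) ∈ domain L α β → 0 < ξ →
    HasSum (fun n => ((coeffA f n ξ / ξ : ℝ) : ℂ) * legendreIntegral n ξ fun τ => g (t + τ))
      (U (ξ, t) - g (t + ξ))

theorem add_mem_Icc_of_mem_domain {ξ t τ : ℝ} (hx : (ξ, t) ∈ domain L α β)
    (hτ : τ ∈ Set.Icc (-ξ) ξ) : t + τ ∈ Set.Icc α β := by
  obtain ⟨_, _, h3, h4⟩ := hx
  dsimp only at h3 h4
  exact ⟨by linarith [hτ.1], by linarith [hτ.2]⟩

theorem IsExtension.isWave (hL : 0 < L) (hαβ : α < β) (h : IsLogDeriv f q) {Q K : ℝ} (hQ0 : 0 < Q)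
    (hQ : ∀ s ∈ Set.Icc 0 L, |q s| ≤ Q) (hK : 0 ≤ K) {g : ℝ → ℂ}
    (hg : ContDiffOn ℝ 1 g (Set.Icc α β)) {A A' B' C C' D' : ℝ × ℝ → ℝ}
    (hA : IsExtension f L α β K (fun t => (g t).re) A)
    (hA' : IsExtension f L α β K (derivWithin (fun t => (g t).re) (Set.Icc α β)) A')
    (hB' : IsExtension f⁻¹ L α β K (derivWithin (fun t => (g t).re) (Set.Icc α β)) B')
    (hC : IsExtension f L α β K (fun t => (g t).im) C)
    (hC' : IsExtension f L α β K (derivWithin (fun t => (g t).im) (Set.Icc α β)) C')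
    (hD' : IsExtension f⁻¹ L α β K (derivWithin (fun t => (g t).im) (Set.Icc α β)) D') :
    IsWave f q L α β g (fun x => A x + C x * Complex.I) (fun x => A' x + C' x * Complex.I)
      (fun x => B' x + D' x * Complex.I) := by
  have hre : ContDiffOn ℝ 1 (fun t => (g t).re) (Set.Icc α β) :=
    Complex.reCLM.contDiff.comp_contDiffOn hg
  have him : ContDiffOn ℝ 1 (fun t => (g t).im) (Set.Icc α β) :=
    Complex.imCLM.contDiff.comp_contDiffOn hg
  have hleft : ∀ ξ t : ℝ, HasDerivAt (fun s : ℝ => (s, t)) ((1 : ℝ), (0 : ℝ)) ξ := fun ξ t =>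
    (hasDerivAt_id ξ).prodMk (hasDerivAt_const ξ t)
  have hright : ∀ ξ t : ℝ, HasDerivAt (fun s : ℝ => (ξ, s)) ((0 : ℝ), (1 : ℝ)) t := fun ξ t =>
    (hasDerivAt_const t ξ).prodMk (hasDerivAt_id t)
  refine ⟨?_, ?_, ?_, ?_, ?_⟩
  · have h1 := hA.contDiffOn hL hαβ hQ h hre hA' hB'
    have h2 := hC.contDiffOn hL hαβ hQ h him hC' hD'
    exact (Complex.ofRealCLM.contDiff.comp_contDiffOn h1).add
      ((Complex.ofRealCLM.contDiff.comp_contDiffOn h2).mul contDiffOn_const)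
  · intro ξ t hx
    have h1 := ((hA.hasFDerivAt hαβ hQ h hre hA' hB' hx).comp_hasDerivAt ξ (hleft ξ t)).ofReal_comp
    have h2 := ((hC.hasFDerivAt hαβ hQ h him hC' hD' hx).comp_hasDerivAt ξ (hleft ξ t)).ofReal_comp
    refine (h1.add (h2.mul_const Complex.I)).congr_deriv ?_
    simp [gradient]
    ring
  · intro ξ t hx
    have h1 := ((hA.hasFDerivAt hαβ hQ h hre hA' hB' hx).comp_hasDerivAt t (hright ξ t)).ofReal_comp
    have h2 := ((hC.hasFDerivAt hαβ hQ h him hC' hD' hx).comp_hasDerivAt t (hright ξ t)).ofReal_comp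
    refine (h1.add (h2.mul_const Complex.I)).congr_deriv ?_
    simp [gradient]
  · intro t ht
    rw [hA.apply_zero h hL ht, hC.apply_zero h hL ht, Complex.re_add_im]
  · intro ξ t hx hξ
    have h1 := (Complex.hasSum_ofReal.2 (hA.hasSum hK h hQ0 hQ hre.continuousOn hx hξ)).add
      ((Complex.hasSum_ofReal.2 (hC.hasSum hK h hQ0 hQ him.continuousOn hx hξ)).mul_right Complex.I)
    have hgc : ContinuousOn (fun τ => g (t + τ)) (Set.Icc (-ξ) ξ) :=
      hg.continuousOn.comp (by fun_prop) fun τ hτ => add_mem_Icc_of_mem_domain hx hτ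
    convert h1 using 1
    · funext n
      rw [legendreIntegral_eq_re_add_im n hξ hgc, Complex.ofReal_mul, Complex.ofReal_mul]
      ring
    · conv_lhs => rw [← Complex.re_add_im (g (t + ξ))]
      push_cast
      ring

/-- The waves for f and 1/f must be produced together: the ξ-derivative of each contains the
t-derivative of the other, hence the interchanged `U'` and `V'`. -/
theorem exists_isWave (hL : 0 < L) (hαβ : α < β) (h : IsLogDeriv f q) {g : ℝ → ℂ}
    (hg : ContDiffOn ℝ 1 g (Set.Icc α β)) :
    ∃ U V U' V', IsWave f q L α β g U U' V' ∧ IsWave f⁻¹ (-q) L α β g V V' U' := by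
  obtain ⟨Q₀, hQ₀⟩ := (isCompact_Icc (a := (0 : ℝ)) (b := L)).exists_bound_of_continuousOn
    h.continuous_logDeriv.continuousOn
  set Q := max Q₀ 1 with hQdef
  have hQ0 : 0 < Q := lt_max_of_lt_right one_pos
  have hQ : ∀ s ∈ Set.Icc 0 L, |q s| ≤ Q := fun s hs => (hQ₀ s hs).trans (le_max_left _ _)
  have hQ' : ∀ s ∈ Set.Icc 0 L, |(-q) s| ≤ Q := fun s hs => by
    rw [Pi.neg_apply, abs_neg]; exact hQ s hs
  have hre : ContDiffOn ℝ 1 (fun t => (g t).re) (Set.Icc α β) :=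
    Complex.reCLM.contDiff.comp_contDiffOn hg
  have him : ContDiffOn ℝ 1 (fun t => (g t).im) (Set.Icc α β) :=
    Complex.imCLM.contDiff.comp_contDiffOn hg
  have hre' := hre.continuousOn_derivWithin (uniqueDiffOn_Icc hαβ) le_rfl
  have him' := him.continuousOn_derivWithin (uniqueDiffOn_Icc hαβ) le_rfl
  obtain ⟨A, hA⟩ := exists_isExtension h hL hQ0 hQ hre.continuousOn
  obtain ⟨A', hA'⟩ := exists_isExtension h hL hQ0 hQ hre'
  obtain ⟨B, hB⟩ := exists_isExtension h.inv hL hQ0 hQ' hre.continuousOn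
  obtain ⟨B', hB'⟩ := exists_isExtension h.inv hL hQ0 hQ' hre'
  obtain ⟨C, hC⟩ := exists_isExtension h hL hQ0 hQ him.continuousOn
  obtain ⟨C', hC'⟩ := exists_isExtension h hL hQ0 hQ him'
  obtain ⟨D, hD⟩ := exists_isExtension h.inv hL hQ0 hQ' him.continuousOn
  obtain ⟨D', hD'⟩ := exists_isExtension h.inv hL hQ0 hQ' him'
  exact ⟨_, _, _, _, IsExtension.isWave hL hαβ h hQ0 hQ (by positivity) hg hA hA' hB' hC hC' hD',
    IsExtension.isWave hL hαβ h.inv hQ0 hQ' (by positivity) hg hB hB' (by rwa [inv_inv]) hD hD'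
      (by rwa [inv_inv])⟩

end Vekua

/-! ### Uniqueness for the Vekua problem -/

namespace Vekua

open Bicomplex

variable {f q : ℝ → ℝ} {L α β : ℝ} {W₀ : ℝ → Bicomplex} {W : ℝ → ℝ → Bicomplex}

theorem isCompact_domain (L α β : ℝ) : IsCompact (domain L α β) := by
  refine ((isCompact_Icc (a := 0) (b := L)).prod (isCompact_Icc (a := α) (b := β))).of_isClosed_subset
    (isClosed_domain L α β) ?_
  rintro ⟨a, b⟩ ⟨h1, h2, h3, h4⟩
  dsimp only at h1 h2 h3 h4
  exact ⟨⟨h1, h2⟩, by linarith, by linarith⟩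

/-- The two components of the equation with respect to the idempotents. -/
theorem equation_iff (a b w : Bicomplex) (r : ℝ) :
    ofComplex (1 / 2) * (a - j * b) - ofComplex ((r / 2 : ℝ) : ℂ) * conj w = 0 ↔
      plus a - plus b = r * minus w ∧ minus a + minus b = r * plus w := by
  have e : ofComplex (1 / 2) * (a - j * b) - ofComplex ((r / 2 : ℝ) : ℂ) * conj w =
      ⟨1 / 2 * (a.re - b.im) - r / 2 * w.re, 1 / 2 * (a.im - b.re) + r / 2 * w.im⟩ := by
    ext <;> simp [ofComplex, j, conj]
  rw [e, QuadraticAlgebra.ext_iff]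
  simp only [QuadraticAlgebra.re_zero, QuadraticAlgebra.im_zero, plus, minus]
  constructor
  · rintro ⟨h1, h2⟩
    exact ⟨by linear_combination 2 * h1 + 2 * h2, by linear_combination 2 * h1 - 2 * h2⟩
  · rintro ⟨h1, h2⟩
    exact ⟨by linear_combination (h1 + h2) / 4, by linear_combination (h1 - h2) / 4⟩

namespace IsSolution

theorem hasDerivAt_line (hW : IsSolution f L α β W₀ W) {c e s : ℝ}
    (hs : (s, c + e * s) ∈ openDomain L α β) :
    HasDerivAt (fun s => W s (c + e * s)) (deriv (fun r => W r (c + e * s)) s +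
      e • deriv (fun r => W s r) (c + e * s)) s := by
  have hd : HasFDerivAt (Function.uncurry W)
      (fderiv ℝ (Function.uncurry W) (s, c + e * s)) (s, c + e * s) :=
    ((hW.contDiffOn.differentiableOn one_ne_zero).differentiableAt
      ((isOpen_openDomain L α β).mem_nhds hs)).hasFDerivAt
  set D := fderiv ℝ (Function.uncurry W) (s, c + e * s)
  have h1 : HasDerivAt (fun r => W r (c + e * s)) (D (1, 0)) s :=
    HasFDerivAt.comp_hasDerivAt (l := Function.uncurry W) (f := fun r => (r, c + e * s)) s hd
      ((hasDerivAt_id s).prodMk (hasDerivAt_const s (c + e * s)))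
  have h2 : HasDerivAt (fun r => W s r) (D (0, 1)) (c + e * s) :=
    HasFDerivAt.comp_hasDerivAt (l := Function.uncurry W) (f := fun r => (s, r)) (c + e * s) hd
      ((hasDerivAt_const (c + e * s) s).prodMk (hasDerivAt_id (c + e * s)))
  have h3 : HasDerivAt (fun s : ℝ => (s, c + e * s)) ((1 : ℝ), e) s := by
    have := ((hasDerivAt_id s).const_mul e).const_add c
    exact (hasDerivAt_id s).prodMk (by simpa using this)
  rw [h1.deriv, h2.deriv, ← map_smul, ← map_add]
  refine (hd.comp_hasDerivAt s h3).congr_deriv ?_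
  simp

/-- The Volterra equation for an arbitrary classical solution. The characteristic is interior for 0
< s < ξ, where the differential equation applies; continuity alone is used at its foot on s = 0. -/
theorem plus_eq (hW : IsSolution f L α β W₀ W) (hq : Continuous q)
    (hfq : ∀ ξ ∈ Set.Ioo 0 L, deriv f ξ / (2 * f ξ) = q ξ / 2) {ξ t : ℝ}
    (hx : (ξ, t) ∈ openDomain L α β) :
    (IntervalIntegrable (fun s => (q s : ℂ) * minus (W s (t + ξ + -1 * s)))
      MeasureTheory.volume 0 ξ) ∧
    plus (W ξ t) = plus (W₀ (t + ξ)) +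
      ∫ s in (0 : ℝ)..ξ, (q s : ℂ) * minus (W s (t + ξ + -1 * s)) := by
  obtain ⟨h1, h2, h3, h4⟩ := hx
  dsimp only at h1 h2 h3 h4
  have hmaps : Set.MapsTo (fun s => (s, t + ξ + -1 * s)) (Set.Icc 0 ξ) (domain L α β) := fun s hs =>
    ⟨hs.1, hs.2.trans h2.le, by dsimp only; linarith [hs.2], by dsimp only; linarith⟩
  have hc : ContinuousOn (fun s => W s (t + ξ + -1 * s)) (Set.Icc 0 ξ) :=
    hW.continuousOn.comp (f := fun s => (s, t + ξ + -1 * s)) (by fun_prop) hmaps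
  have hint : IntervalIntegrable (fun s => (q s : ℂ) * minus (W s (t + ξ + -1 * s)))
      MeasureTheory.volume 0 ξ :=
    ContinuousOn.intervalIntegrable_of_Icc h1.le
      ((Complex.continuous_ofReal.comp hq).continuousOn.mul (minusL.continuous.comp_continuousOn hc))
  refine ⟨hint, ?_⟩
  have hd : ∀ s ∈ Set.Ioo 0 ξ, HasDerivAt (fun s => plus (W s (t + ξ + -1 * s)))
      ((q s : ℂ) * minus (W s (t + ξ + -1 * s))) s := by
    intro s hs
    have hs' : (s, t + ξ + -1 * s) ∈ openDomain L α β :=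
      ⟨hs.1, hs.2.trans h2, by dsimp only; linarith [hs.2], by dsimp only; linarith⟩
    have e := hW.equation _ _ hs'
    rw [hfq s ⟨hs.1, hs.2.trans h2⟩, dbar, equation_iff] at e
    refine (plusL.hasFDerivAt.comp_hasDerivAt s (hW.hasDerivAt_line hs')).congr_deriv ?_
    rw [← e.1, map_add, map_smul, plusL_apply, plusL_apply]
    simp [sub_eq_add_neg]
  have := intervalIntegral.integral_eq_sub_of_hasDerivAt_of_le h1.le
    (plusL.continuous.comp_continuousOn hc) hd hint
  rw [this]
  simp only [Function.comp, plusL_apply, mul_zero, add_zero]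
  rw [hW.initial (t + ξ) ⟨by linarith, h4.le⟩, show t + ξ + -1 * ξ = t by ring]
  ring

theorem minus_eq (hW : IsSolution f L α β W₀ W) (hq : Continuous q)
    (hfq : ∀ ξ ∈ Set.Ioo 0 L, deriv f ξ / (2 * f ξ) = q ξ / 2) {ξ t : ℝ}
    (hx : (ξ, t) ∈ openDomain L α β) :
    (IntervalIntegrable (fun s => (q s : ℂ) * plus (W s (t - ξ + 1 * s)))
      MeasureTheory.volume 0 ξ) ∧
    minus (W ξ t) = minus (W₀ (t - ξ)) +
      ∫ s in (0 : ℝ)..ξ, (q s : ℂ) * plus (W s (t - ξ + 1 * s)) := by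
  obtain ⟨h1, h2, h3, h4⟩ := hx
  dsimp only at h1 h2 h3 h4
  have hmaps : Set.MapsTo (fun s => (s, t - ξ + 1 * s)) (Set.Icc 0 ξ) (domain L α β) := fun s hs =>
    ⟨hs.1, hs.2.trans h2.le, by dsimp only; linarith, by dsimp only; linarith [hs.2]⟩
  have hc : ContinuousOn (fun s => W s (t - ξ + 1 * s)) (Set.Icc 0 ξ) :=
    hW.continuousOn.comp (f := fun s => (s, t - ξ + 1 * s)) (by fun_prop) hmaps
  have hint : IntervalIntegrable (fun s => (q s : ℂ) * plus (W s (t - ξ + 1 * s)))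
      MeasureTheory.volume 0 ξ :=
    ContinuousOn.intervalIntegrable_of_Icc h1.le
      ((Complex.continuous_ofReal.comp hq).continuousOn.mul (plusL.continuous.comp_continuousOn hc))
  refine ⟨hint, ?_⟩
  have hd : ∀ s ∈ Set.Ioo 0 ξ, HasDerivAt (fun s => minus (W s (t - ξ + 1 * s)))
      ((q s : ℂ) * plus (W s (t - ξ + 1 * s))) s := by
    intro s hs
    have hs' : (s, t - ξ + 1 * s) ∈ openDomain L α β :=
      ⟨hs.1, hs.2.trans h2, by dsimp only; linarith, by dsimp only; linarith [hs.2]⟩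
    have e := hW.equation _ _ hs'
    rw [hfq s ⟨hs.1, hs.2.trans h2⟩, dbar, equation_iff] at e
    refine (minusL.hasFDerivAt.comp_hasDerivAt s (hW.hasDerivAt_line hs')).congr_deriv ?_
    rw [← e.2, map_add, map_smul, minusL_apply, minusL_apply]
    simp
  have := intervalIntegral.integral_eq_sub_of_hasDerivAt_of_le h1.le
    (minusL.continuous.comp_continuousOn hc) hd hint
  rw [this]
  simp only [Function.comp, minusL_apply, mul_zero, add_zero]
  rw [hW.initial (t - ξ) ⟨h3.le, by linarith⟩, show t - ξ + 1 * ξ = t by ring]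
  ring

theorem eqOn (hL : 0 < L) (hαβ : α < β) (hq : Continuous q)
    (hfq : ∀ ξ ∈ Set.Ioo 0 L, deriv f ξ / (2 * f ξ) = q ξ / 2) {V : ℝ → ℝ → Bicomplex}
    (hV : IsSolution f L α β W₀ V) (hW : IsSolution f L α β W₀ W) :
    Set.EqOn (Function.uncurry V) (Function.uncurry W) (domain L α β) := by
  have hcl := closure_openDomain hL hαβ
  -- Continuity carries equality from the interior to the closed domain, so only interior points are
  -- treated below.
  refine Set.EqOn.of_subset_closure ?_ hV.continuousOn hW.continuousOn openDomain_subset_domain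
    hcl.ge
  obtain ⟨Q₀, hQ₀⟩ := (isCompact_Icc (a := (0 : ℝ)) (b := L)).exists_bound_of_continuousOn
    hq.continuousOn
  set Q := max Q₀ 1 with hQdef
  have hQ0 : 0 < Q := lt_max_of_lt_right one_pos
  have hQ : ∀ s ∈ Set.Icc 0 L, |q s| ≤ Q := fun s hs => (hQ₀ s hs).trans (le_max_left _ _)
  let zp : ℝ × ℝ → ℂ := fun x => plus (V x.1 x.2) - plus (W x.1 x.2)
  let zm : ℝ × ℝ → ℂ := fun x => minus (V x.1 x.2) - minus (W x.1 x.2)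
  have hzp : ContinuousOn zp (domain L α β) :=
    (plusL.continuous.comp_continuousOn hV.continuousOn).sub
      (plusL.continuous.comp_continuousOn hW.continuousOn)
  have hzm : ContinuousOn zm (domain L α β) :=
    (minusL.continuous.comp_continuousOn hV.continuousOn).sub
      (minusL.continuous.comp_continuousOn hW.continuousOn)
  obtain ⟨B, hB⟩ := ((isCompact_domain L α β).image_of_continuousOn
    (f := fun x => max ‖zp x‖ ‖zm x‖) (hzp.norm.sup hzm.norm)).bddAbove
  -- Differences of solutions satisfy the Volterra equations without free term, so the contraction
  -- runs with c = 0 and leaves the bound 0.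
  have key : ∀ i : openDomain L α β, max ‖zp i‖ ‖zm i‖ ≤
      2 * 0 * Real.exp (2 * Q * (i : ℝ × ℝ).1) := by
    refine le_two_mul_of_le_add_half (A := max B 0) (le_max_right _ _) le_rfl ?_ ?_
    · rintro ⟨x, hx⟩
      have h1 : max ‖zp x‖ ‖zm x‖ ≤ max B 0 :=
        (hB ⟨x, openDomain_subset_domain hx, rfl⟩).trans (le_max_left _ _)
      have h2 : 1 ≤ Real.exp (2 * Q * x.1) := Real.one_le_exp (by have := hx.1; positivity)
      exact h1.trans (le_mul_of_one_le_right (le_max_right _ _) h2)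
    · rintro A hA hA' ⟨⟨ξ, t⟩, hx⟩
      obtain ⟨h1, h2, h3, h4⟩ := id hx
      dsimp only at h1 h2 h3 h4
      have hbd : ∀ (y : ℝ × ℝ) (z : ℂ), y ∈ openDomain L α β → ‖z‖ ≤ max ‖zp y‖ ‖zm y‖ →
          ‖(q y.1 : ℂ) * z‖ ≤ Q * (A * Real.exp (2 * Q * y.1)) := by
        intro y z hy hz
        rw [norm_mul, Complex.norm_real]
        exact mul_le_mul (hQ _ ⟨hy.1.le, hy.2.1.le⟩) (hz.trans (hA' ⟨y, hy⟩)) (norm_nonneg _) hQ0.le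
      dsimp only
      rw [zero_add]
      refine max_le ?_ ?_
      · obtain ⟨i1, e1⟩ := hV.plus_eq hq hfq hx
        obtain ⟨i2, e2⟩ := hW.plus_eq hq hfq hx
        have e : zp (ξ, t) = ∫ s in (0 : ℝ)..ξ, (q s : ℂ) * zm (s, t + ξ + -1 * s) := by
          simp only [zp, zm, mul_sub]
          rw [intervalIntegral.integral_sub i1 i2, e1, e2]
          ring
        rw [e]
        refine norm_integral_le_half_mul_exp hA h1.le fun s hs =>
          hbd (s, t + ξ + -1 * s) _ ⟨hs.1, hs.2.trans_lt h2, ?_, ?_⟩ (le_max_right _ _)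
        · dsimp only; linarith [hs.2]
        · dsimp only; linarith [hs.1]
      · obtain ⟨i1, e1⟩ := hV.minus_eq hq hfq hx
        obtain ⟨i2, e2⟩ := hW.minus_eq hq hfq hx
        have e : zm (ξ, t) = ∫ s in (0 : ℝ)..ξ, (q s : ℂ) * zp (s, t - ξ + 1 * s) := by
          simp only [zp, zm, mul_sub]
          rw [intervalIntegral.integral_sub i1 i2, e1, e2]
          ring
        rw [e]
        refine norm_integral_le_half_mul_exp hA h1.le fun s hs =>
          hbd (s, t - ξ + 1 * s) _ ⟨hs.1, hs.2.trans_lt h2, ?_, ?_⟩ (le_max_left _ _)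
        · dsimp only; linarith [hs.1]
        · dsimp only; linarith [hs.2]
  intro x hx
  have hk := key ⟨x, hx⟩
  rw [mul_zero, zero_mul] at hk
  have k1 := norm_le_zero_iff.1 ((le_max_left _ _).trans hk)
  have k2 := norm_le_zero_iff.1 ((le_max_right _ _).trans hk)
  exact eq_of_plus_of_minus (sub_eq_zero.1 k1) (sub_eq_zero.1 k2)

end IsSolution

/-! ### Extending the coefficient from [0, L] to the line -/

section Extension

/-- Extending f'/f by its end values and exponentiating a primitive gives F. The quotient f/F has
derivative zero on [0, L] and equals 1 at 0. -/
theorem exists_isLogDeriv (hL : 0 < L) (hf : ContDiffOn ℝ 1 f (Set.Icc 0 L))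
    (hne : ∀ ξ ∈ Set.Icc 0 L, f ξ ≠ 0) (hf0 : f 0 = 1) :
    ∃ F q : ℝ → ℝ, IsLogDeriv F q ∧ Set.EqOn f F (Set.Icc 0 L) := by
  have hc : ContinuousOn (fun x => derivWithin f (Set.Icc 0 L) x / f x) (Set.Icc 0 L) :=
    (hf.continuousOn_derivWithin (uniqueDiffOn_Icc hL) le_rfl).div hf.continuousOn hne
  set q : ℝ → ℝ := Set.IccExtend hL.le
    ((Set.Icc 0 L).domRestrict fun x => derivWithin f (Set.Icc 0 L) x / f x) with hqdef
  have hq : Continuous q := hc.domRestrict.Icc_extend'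
  have hqe : ∀ x ∈ Set.Icc 0 L, q x = derivWithin f (Set.Icc 0 L) x / f x := fun x hx =>
    Set.IccExtend_of_mem hL.le _ hx
  have hprim : ∀ x, HasDerivAt (fun x => ∫ s in (0 : ℝ)..x, q s) (q x) x := fun x =>
    (hq.integral_hasStrictDerivAt 0 x).hasDerivAt
  set F : ℝ → ℝ := fun x => Real.exp (∫ s in (0 : ℝ)..x, q s) with hF
  have hFd : ∀ x, HasDerivAt F (q x * F x) x := fun x =>
    (hprim x).exp.congr_deriv (mul_comm _ _)
  have hF0 : F 0 = 1 := by simp [hF]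
  have hFne : ∀ x, F x ≠ 0 := fun x => (Real.exp_pos _).ne'
  refine ⟨F, q, ⟨hF0, hFne, hq, hFd⟩, fun x hx => ?_⟩
  have hd : ∀ y ∈ Set.Icc 0 L, HasDerivWithinAt (fun y => f y / F y) 0 (Set.Icc 0 L) y := by
    intro y hy
    refine (((hf.differentiableOn one_ne_zero) y hy).hasDerivWithinAt.div
      (hFd y).hasDerivWithinAt (hFne y)).congr_deriv ?_
    have h1 := hne y hy
    have h2 := hFne y
    rw [hqe y hy]
    field_simp
    ring
  have := constant_of_derivWithin_zero (fun y hy => (hd y hy).differentiableWithinAt)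
    (fun y hy => (hd y (Set.Ico_subset_Icc_self hy)).derivWithin
      (uniqueDiffOn_Icc hL y (Set.Ico_subset_Icc_self hy))) x hx
  rw [hF0, hf0, div_one, div_eq_one_iff_eq (hFne x)] at this
  exact this

variable {F : ℝ → ℝ}

/-- The recursive integrals start at 0 and never leave [0, L], so passing from f to its extension
does not alter the coefficients there. -/
theorem recX_congr (h : Set.EqOn f F (Set.Icc 0 L)) (n : ℕ) :
    Set.EqOn (recX f n) (recX F n) (Set.Icc 0 L) := by
  induction n with
  | zero => exact fun _ _ => rfl
  | succ n ih =>
    intro ξ hξ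
    simp only [recX]
    congr 1
    refine intervalIntegral.integral_congr fun s hs => ?_
    rw [Set.uIcc_of_le hξ.1] at hs
    have hs' : s ∈ Set.Icc 0 L := ⟨hs.1, hs.2.trans hξ.2⟩
    rw [ih hs', h hs']

theorem coeffA_congr (h : Set.EqOn f F (Set.Icc 0 L)) (n : ℕ) :
    Set.EqOn (coeffA f n) (coeffA F n) (Set.Icc 0 L) := by
  have hinv : Set.EqOn f⁻¹ F⁻¹ (Set.Icc 0 L) := fun x hx => by
    rw [Pi.inv_apply, Pi.inv_apply, h hx]
  intro ξ hξ
  simp only [coeffA, phi, ← recX_inv, h hξ, recX_congr h _ hξ, recX_congr hinv _ hξ]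

theorem coeffB_congr (h : Set.EqOn f F (Set.Icc 0 L)) (n : ℕ) :
    Set.EqOn (coeffB f n) (coeffB F n) (Set.Icc 0 L) := by
  have hinv : Set.EqOn f⁻¹ F⁻¹ (Set.Icc 0 L) := fun x hx => by
    rw [Pi.inv_apply, Pi.inv_apply, h hx]
  rw [← coeffA_inv, ← coeffA_inv]
  exact coeffA_congr hinv n

end Extension

end Vekua

/-! ### Assembling the solution of the Vekua problem -/

namespace Vekua

open Bicomplex

variable {f q : ℝ → ℝ} {L α β : ℝ} {W₀ : ℝ → Bicomplex}

theorem neg_mem_domain {ξ t : ℝ} (h : (ξ, t) ∈ domain L α β) : (ξ, -t) ∈ domain L (-β) (-α) := by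
  obtain ⟨h1, h2, h3, h4⟩ := h
  dsimp only at h1 h2 h3 h4
  exact ⟨h1, h2, by dsimp only; linarith, by dsimp only; linarith⟩

theorem neg_mem_openDomain {ξ t : ℝ} (h : (ξ, t) ∈ openDomain L α β) :
    (ξ, -t) ∈ openDomain L (-β) (-α) := by
  obtain ⟨h1, h2, h3, h4⟩ := h
  dsimp only at h1 h2 h3 h4
  exact ⟨h1, h2, by dsimp only; linarith, by dsimp only; linarith⟩

theorem IsLogDeriv.deriv_div_of_eqOn {F : ℝ → ℝ} (h : IsLogDeriv F q)
    (he : Set.EqOn f F (Set.Icc 0 L)) {ξ : ℝ} (hξ : ξ ∈ Set.Ioo 0 L) :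
    deriv f ξ / (2 * f ξ) = q ξ / 2 := by
  have h1 : f =ᶠ[nhds ξ] F := by
    filter_upwards [isOpen_Ioo.mem_nhds hξ] with x hx using he (Set.Ioo_subset_Icc_self hx)
  rw [h1.deriv_eq, h1.eq_of_nhds, (h.hasDerivAt ξ).deriv]
  have := h.ne_zero ξ
  field_simp

/-- The solution assembled from the images of the two components of the initial data. -/
noncomputable def assemble (U V X Y : ℝ × ℝ → ℂ) (ξ t : ℝ) : Bicomplex :=
  ⟨1 / 2 * (U (ξ, t) + X (ξ, -t)), 1 / 2 * (V (ξ, t) - Y (ξ, -t))⟩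

section Assemble

variable {U V U' V' X Y X' Y' : ℝ × ℝ → ℂ} {F : ℝ → ℝ}

theorem contDiffOn_assemble
    (hU : IsWave F q L α β (fun t => plus (W₀ t)) U U' V')
    (hV : IsWave F⁻¹ (-q) L α β (fun t => plus (W₀ t)) V V' U')
    (hX : IsWave F q L (-β) (-α) (fun t => minus (W₀ (-t))) X X' Y')
    (hY : IsWave F⁻¹ (-q) L (-β) (-α) (fun t => minus (W₀ (-t))) Y Y' X') :
    ContDiffOn ℝ 1 (Function.uncurry (assemble U V X Y)) (domain L α β) := by
  have hneg : ContDiffOn ℝ 1 (fun x : ℝ × ℝ => (x.1, -x.2)) (domain L α β) :=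
    (contDiff_fst.prodMk contDiff_snd.neg).contDiffOn
  have h1 : ContDiffOn ℝ 1 (fun x : ℝ × ℝ => X (x.1, -x.2)) (domain L α β) :=
    hX.contDiffOn.comp hneg fun x hx => neg_mem_domain hx
  have h2 : ContDiffOn ℝ 1 (fun x : ℝ × ℝ => Y (x.1, -x.2)) (domain L α β) :=
    hY.contDiffOn.comp hneg fun x hx => neg_mem_domain hx
  exact contDiffOn_mk (contDiffOn_const.mul (hU.contDiffOn.add h1))
    (contDiffOn_const.mul (hV.contDiffOn.sub h2))

/-- The equation is invariant under t ↦ -t combined with conjugation: both the t-derivative and the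
j-component change sign. This turns solutions for P⁺ data into solutions for P⁻ data and explains
the minus sign before `Y`. -/
theorem isSolution_assemble (h : IsLogDeriv F q) (he : Set.EqOn f F (Set.Icc 0 L))
    (hU : IsWave F q L α β (fun t => plus (W₀ t)) U U' V')
    (hV : IsWave F⁻¹ (-q) L α β (fun t => plus (W₀ t)) V V' U')
    (hX : IsWave F q L (-β) (-α) (fun t => minus (W₀ (-t))) X X' Y')
    (hY : IsWave F⁻¹ (-q) L (-β) (-α) (fun t => minus (W₀ (-t))) Y Y' X') :
    IsSolution f L α β W₀ (assemble U V X Y) := by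
  have hcd := contDiffOn_assemble hU hV hX hY
  refine ⟨hcd.continuousOn, hcd.mono openDomain_subset_domain, ?_, ?_⟩
  · intro ξ t hx
    have hx' := neg_mem_openDomain hx
    have d1 : HasDerivAt (fun s => assemble U V X Y s t) _ ξ := hasDerivAt_mk
      (((hU.hasDerivAt_left ξ t hx).add (hX.hasDerivAt_left ξ (-t) hx')).const_mul (1 / 2))
      (((hV.hasDerivAt_left ξ t hx).sub (hY.hasDerivAt_left ξ (-t) hx')).const_mul (1 / 2))
    have d2 : HasDerivAt (fun s => assemble U V X Y ξ s) _ t := hasDerivAt_mk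
      (((hU.hasDerivAt_right ξ t hx).add
        ((hX.hasDerivAt_right ξ (-t) hx').scomp t (hasDerivAt_neg t))).const_mul (1 / 2))
      (((hV.hasDerivAt_right ξ t hx).sub
        ((hY.hasDerivAt_right ξ (-t) hx').scomp t (hasDerivAt_neg t))).const_mul (1 / 2))
    rw [h.deriv_div_of_eqOn he ⟨hx.1, hx.2.1⟩, dbar, d1.deriv, d2.deriv, equation_iff]
    simp only [plus, minus, assemble, Pi.neg_apply, Complex.ofReal_neg, neg_smul, one_smul]
    constructor <;> ring
  · intro t ht
    have ht' : -t ∈ Set.Icc (-β) (-α) := ⟨neg_le_neg ht.2, neg_le_neg ht.1⟩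
    rw [assemble, hU.apply_zero t ht, hV.apply_zero t ht, hX.apply_zero (-t) ht',
      hY.apply_zero (-t) ht', neg_neg]
    ext <;> simp only [plus, minus] <;> ring

theorem hasSeriesForm_assemble (he : Set.EqOn f F (Set.Icc 0 L))
    (hW₀ : ContinuousOn W₀ (Set.Icc α β))
    (hU : IsWave F q L α β (fun t => plus (W₀ t)) U U' V')
    (hV : IsWave F⁻¹ (-q) L α β (fun t => plus (W₀ t)) V V' U')
    (hX : IsWave F q L (-β) (-α) (fun t => minus (W₀ (-t))) X X' Y')
    (hY : IsWave F⁻¹ (-q) L (-β) (-α) (fun t => minus (W₀ (-t))) Y Y' X') :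
    HasSeriesForm f L α β W₀ (assemble U V X Y) := by
  intro ξ t hx hξ
  have hx' := neg_mem_domain hx
  have hξL : ξ ∈ Set.Icc 0 L := ⟨hx.1, hx.2.1⟩
  have hne : (ξ : ℂ) ≠ 0 := Complex.ofReal_ne_zero.2 hξ.ne'
  have e1 : ∀ τ, -(-t + τ) = t - τ := fun τ => by ring
  have sUF := hU.hasSum ξ t hx hξ
  have sVF := hV.hasSum ξ t hx hξ
  have sXG := hX.hasSum ξ (-t) hx' hξ
  have sYG := hY.hasSum ξ (-t) hx' hξ
  simp only [e1, coeffA_inv, ← coeffA_congr he _ hξL, ← coeffB_congr he _ hξL] at sUF sVF sXG sYG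
  -- In the idempotent form the factor 1/ξ stands outside the sums, so the basic series are
  -- multiplied by ξ.
  have hmulξ : ∀ {c : ℕ → ℝ} {I : ℕ → ℂ} {s : ℂ},
      HasSum (fun n => ((c n / ξ : ℝ) : ℂ) * I n) s → HasSum (fun n => (c n : ℂ) * I n) (ξ * s) := by
    intro c I s hs
    refine (hs.mul_left (ξ : ℂ)).congr_fun ?_
    intro n
    push_cast
    field_simp
  have hF : ContinuousOn (fun τ => plus (W₀ (t + τ))) (Set.Icc (-ξ) ξ) :=
    plusL.continuous.comp_continuousOn
      (hW₀.comp (by fun_prop) fun τ hτ => add_mem_Icc_of_mem_domain hx hτ)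
  have hG : ContinuousOn (fun τ => minus (W₀ (t - τ))) (Set.Icc (-ξ) ξ) :=
    minusL.continuous.comp_continuousOn
      (hW₀.comp (f := fun τ => t - τ) (by fun_prop) fun τ hτ => by
        simpa [sub_eq_add_neg] using add_mem_Icc_of_mem_domain hx (τ := -τ)
          ⟨neg_le_neg hτ.2, by linarith [hτ.1]⟩)
  have sA : HasSum (termA f W₀ ξ t) _ := (sUF.add sXG).congr_fun fun n => by
    rw [termA, legendreIntegral_add n hξ hF hG, mul_add]
  have sB : HasSum (termB f W₀ ξ t) _ := (sVF.sub sYG).congr_fun fun n => by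
    rw [termB, legendreIntegral_sub n hξ hF hG, mul_sub]
  have sP : HasSum (termPlus f W₀ ξ t) _ :=
    (hasSum_mk (hmulξ sUF) (hmulξ sVF)).congr_fun fun n => by
      ext <;> simp [termPlus, ofComplex, j]
  have sM : HasSum (termMinus f W₀ ξ t) _ :=
    (hasSum_mk (hmulξ sXG) (hmulξ sYG).neg).congr_fun fun n => by
      ext <;> simp [termMinus, ofComplex, j]
  refine ⟨⟨sA.summable, sB.summable, sP.summable, sM.summable⟩, ?_, ?_⟩
  · rw [splitForm, sA.tsum_eq, sB.tsum_eq, assemble]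
    ext <;> simp [ofComplex, j] <;> ring
  · rw [idempotentForm, sP.tsum_eq, sM.tsum_eq, assemble]
    have h1 : (1 : Bicomplex).re = 1 := rfl
    have h2 : (1 : Bicomplex).im = 0 := rfl
    ext <;> simp [ofComplex, j, projPlus, projMinus, h1, h2] <;> field_simp <;> ring

end Assemble

/-- The Cauchy problem for the hyperbolic Vekua equation. -/
theorem exists_unique_solution (f : ℝ → ℝ) (L α β : ℝ) (W₀ : ℝ → Bicomplex) (hL : 0 < L)
    (hαβ : α < β) (hf : ContDiffOn ℝ 1 f (Set.Icc 0 L)) (hne : ∀ ξ ∈ Set.Icc 0 L, f ξ ≠ 0)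
    (hf0 : f 0 = 1) (hW₀ : ContDiffOn ℝ 1 W₀ (Set.Icc α β)) :
    ∃ W : ℝ → ℝ → Bicomplex, IsSolution f L α β W₀ W ∧
      ContDiffOn ℝ 1 (Function.uncurry W) (domain L α β) ∧
      (∀ V : ℝ → ℝ → Bicomplex, IsSolution f L α β W₀ V →
        ∀ ξ t : ℝ, (ξ, t) ∈ domain L α β → V ξ t = W ξ t) ∧
      HasSeriesForm f L α β W₀ W := by
  obtain ⟨F, q, h, he⟩ := exists_isLogDeriv hL hf hne hf0
  have hp : ContDiffOn ℝ 1 (fun t => plus (W₀ t)) (Set.Icc α β) :=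
    plusL.contDiff.comp_contDiffOn hW₀
  have hm : ContDiffOn ℝ 1 (fun t => minus (W₀ (-t))) (Set.Icc (-β) (-α)) :=
    minusL.contDiff.comp_contDiffOn (hW₀.comp contDiff_neg.contDiffOn fun t ht =>
      ⟨by linarith [ht.2], by linarith [ht.1]⟩)
  obtain ⟨U, V, U', V', hU, hV⟩ := exists_isWave hL hαβ h hp
  obtain ⟨X, Y, X', Y', hX, hY⟩ := exists_isWave hL (neg_lt_neg hαβ) h hm
  have hsol := isSolution_assemble h he hU hV hX hY
  exact ⟨assemble U V X Y, hsol, contDiffOn_assemble hU hV hX hY, fun W hW ξ t hx =>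
    IsSolution.eqOn hL hαβ h.continuous_logDeriv (fun ξ hξ => h.deriv_div_of_eqOn he hξ) hW hsol hx,
    hasSeriesForm_assemble he hW₀.continuousOn hU hV hX hY⟩

end Vekua

/-! ### The amplitude and the change of variable -/

namespace Maxwell

open Bicomplex Filter Topology

variable {ε : ℝ → ℝ} {μ b α β : ℝ} {E₀ H₀ : ℝ → ℂ}

/-- The factor `√(c ε)` between the electric field and the Vekua unknown. -/
noncomputable def amplitude (ε : ℝ → ℝ) (μ x : ℝ) : ℝ := √(speed ε μ x * ε x)

section Amplitude

variable {x : ℝ}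

theorem speed_pos (hμ : 0 < μ) (hε : 0 < ε x) : 0 < speed ε μ x := by
  rw [speed]
  positivity

theorem amplitude_pos (hμ : 0 < μ) (hε : 0 < ε x) : 0 < amplitude ε μ x :=
  Real.sqrt_pos.2 (mul_pos (speed_pos hμ hε) hε)

theorem speed_mul_sqrt (hμ : 0 < μ) (hε : 0 < ε x) : speed ε μ x * (√μ * √(ε x)) = 1 := by
  have h1 := Real.sqrt_pos.2 hμ
  have h2 := Real.sqrt_pos.2 hε
  rw [speed, Real.sqrt_mul hε.le]
  field_simp

/-- Since c√(με) = 1, both material parameters are determined by σ = √(με) and the amplitude a: ε =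
σa² and, below, μ = σ/a² and √(cμ) = 1/a. -/
theorem eq_sqrt_mul_amplitude_sq (hμ : 0 < μ) (hε : 0 < ε x) :
    ε x = √μ * √(ε x) * amplitude ε μ x ^ 2 := by
  rw [amplitude, Real.sq_sqrt (mul_pos (speed_pos hμ hε) hε).le]
  linear_combination -ε x * speed_mul_sqrt hμ hε

theorem sqrt_speed_mul (hμ : 0 < μ) (hε : 0 < ε x) :
    √(speed ε μ x * μ) = (amplitude ε μ x)⁻¹ := by
  have hc := speed_pos hμ hε
  refine eq_inv_of_mul_eq_one_left ?_
  rw [amplitude, ← Real.sqrt_mul (mul_pos hc hμ).le, Real.sqrt_eq_one]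
  have h1 := speed_mul_sqrt hμ hε
  calc speed ε μ x * μ * (speed ε μ x * ε x) = speed ε μ x ^ 2 * (μ * ε x) := by ring
    _ = (speed ε μ x * (√μ * √(ε x))) ^ 2 := by
        rw [mul_pow, mul_pow, Real.sq_sqrt hμ.le, Real.sq_sqrt hε.le]
    _ = 1 := by rw [h1, one_pow]

theorem eq_sqrt_div_amplitude_sq (hμ : 0 < μ) (hε : 0 < ε x) :
    μ = √μ * √(ε x) / amplitude ε μ x ^ 2 := by
  have ha := amplitude_pos hμ hε
  rw [eq_div_iff (by positivity), amplitude, Real.sq_sqrt (mul_pos (speed_pos hμ hε) hε).le]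
  have h1 := speed_mul_sqrt hμ hε
  have h2 : √μ * √μ = μ := Real.mul_self_sqrt hμ.le
  have h3 : √(ε x) * √(ε x) = ε x := Real.mul_self_sqrt hε.le
  calc μ * (speed ε μ x * ε x) = (√μ * √μ) * (speed ε μ x * (√(ε x) * √(ε x))) := by rw [h2, h3]
    _ = speed ε μ x * (√μ * √(ε x)) * (√μ * √(ε x)) := by ring
    _ = _ := by rw [h1, one_mul]

theorem sqrt_speed_div (hμ : 0 < μ) {y : ℝ} (hε : 0 < ε x) (hε' : 0 < ε y) :
    √(speed ε μ y) / √(speed ε μ x) = amplitude ε μ x / amplitude ε μ y := by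
  have key : ∀ z, 0 < ε z → √(speed ε μ z) * (√μ * amplitude ε μ z) = 1 := by
    intro z hz
    have := sqrt_speed_mul hμ hz
    rw [Real.sqrt_mul (speed_pos hμ hz).le] at this
    rw [← mul_assoc, this, inv_mul_cancel₀ (amplitude_pos hμ hz).ne']
  have h1 := key x hε
  have h2 := key y hε'
  have hx := Real.sqrt_pos.2 (speed_pos hμ hε)
  have hy := amplitude_pos hμ hε'
  have hm := Real.sqrt_pos.2 hμ
  rw [div_eq_div_iff hx.ne' hy.ne']
  refine mul_left_cancel₀ hm.ne' ?_
  linear_combination h2 - h1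

theorem contDiffOn_amplitude (hμ : 0 < μ) (hε : ContDiffOn ℝ 1 ε (Set.Icc 0 b))
    (hpos : ∀ x ∈ Set.Icc 0 b, 0 < ε x) : ContDiffOn ℝ 1 (amplitude ε μ) (Set.Icc 0 b) := by
  refine ContDiffOn.sqrt ((contDiffOn_const.div ((hε.mul contDiffOn_const).sqrt ?_) ?_).mul hε) ?_
  · exact fun x hx => (mul_pos (hpos x hx) hμ).ne'
  · exact fun x hx => (Real.sqrt_pos.2 (mul_pos (hpos x hx) hμ)).ne'
  · exact fun x hx => (mul_pos (speed_pos hμ (hpos x hx)) (hpos x hx)).ne'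

end Amplitude

/-- `Ξ` is a `C¹` diffeomorphism of the line with inverse `X` and derivative `σ` which extends the
change of variable `ξ(x)`. -/
structure IsChart (ε : ℝ → ℝ) (μ b : ℝ) (σ Ξ X : ℝ → ℝ) : Prop where
  continuous_deriv : Continuous σ
  deriv_pos : ∀ x, 0 < σ x
  deriv_eq : ∀ x ∈ Set.Icc 0 b, σ x = √μ * √(ε x)
  hasDerivAt : ∀ x, HasDerivAt Ξ (σ x) x
  eq_xi : ∀ x ∈ Set.Icc 0 b, Ξ x = xi ε μ x
  left_inv : ∀ x, X (Ξ x) = x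
  right_inv : ∀ y, Ξ (X y) = y
  hasDerivAt_inv : ∀ y, HasDerivAt X (σ (X y))⁻¹ y

/-- Extending the density √μ√ε by its end values gives a diffeomorphism of the whole line, so no
one-sided inverse is needed at 0 and b. -/
theorem exists_isChart (hb : 0 < b) (hμ : 0 < μ) (hε : ContinuousOn ε (Set.Icc 0 b))
    (hpos : ∀ x ∈ Set.Icc 0 b, 0 < ε x) : ∃ σ Ξ X, IsChart ε μ b σ Ξ X := by
  have hc : ContinuousOn (fun x => √μ * √(ε x)) (Set.Icc 0 b) := continuousOn_const.mul hε.sqrt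
  set σ : ℝ → ℝ := Set.IccExtend hb.le ((Set.Icc 0 b).domRestrict fun x => √μ * √(ε x)) with hσdef
  have hσ : Continuous σ := hc.domRestrict.Icc_extend'
  have hσe : ∀ x ∈ Set.Icc 0 b, σ x = √μ * √(ε x) := fun x hx => Set.IccExtend_of_mem hb.le _ hx
  obtain ⟨x₀, hx₀, hmin⟩ := isCompact_Icc.exists_isMinOn (Set.nonempty_Icc.2 hb.le) hc
  set m := √μ * √(ε x₀) with hm
  have hm0 : 0 < m := mul_pos (Real.sqrt_pos.2 hμ) (Real.sqrt_pos.2 (hpos x₀ hx₀))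
  have hmσ : ∀ x, m ≤ σ x := fun x => hmin (Set.projIcc 0 b hb.le x).2
  have hσ0 : ∀ x, 0 < σ x := fun x => hm0.trans_le (hmσ x)
  set Ξ : ℝ → ℝ := fun x => ∫ s in (0 : ℝ)..x, σ s with hΞ
  have hd : ∀ x, HasDerivAt Ξ (σ x) x := fun x => (hσ.integral_hasStrictDerivAt 0 x).hasDerivAt
  have hmono : StrictMono Ξ := strictMono_of_hasDerivAt_pos hd hσ0
  -- The density is at least m > 0, so Ξ dominates a line of slope m at +∞, and is dominated by it
  -- at -∞; this gives surjectivity.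
  have hmono' : Monotone fun x => Ξ x - m * x := by
    refine monotone_of_hasDerivAt_nonneg (f' := fun x => σ x - m) (fun x => ?_)
      fun x => sub_nonneg.2 (hmσ x)
    exact (hd x).sub (by simpa using (hasDerivAt_id x).const_mul m)
  have hΞ0 : Ξ 0 = 0 := by simp [hΞ]
  have hΞc : Continuous Ξ := continuous_iff_continuousAt.2 fun x => (hd x).continuousAt
  have hsurj : Function.Surjective Ξ := by
    refine hΞc.surjective ?_ ?_
    · refine tendsto_atTop_mono' _ ?_ (tendsto_id.const_mul_atTop hm0)
      filter_upwards [eventually_ge_atTop 0] with x hx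
      have := hmono' hx
      simp only [hΞ0, mul_zero, sub_zero] at this
      simpa using this
    · refine tendsto_atBot_mono' _ ?_ (tendsto_id.const_mul_atBot hm0)
      filter_upwards [eventually_le_atBot 0] with x hx
      have := hmono' hx
      simp only [hΞ0, mul_zero, sub_zero] at this
      simpa using this
  let e : ℝ ≃o ℝ := hmono.orderIsoOfSurjective Ξ hsurj
  have hr : ∀ y, Ξ (e.symm y) = y := fun y => e.apply_symm_apply y
  refine ⟨σ, Ξ, e.symm, hσ, hσ0, hσe, hd, ?_, fun x => e.symm_apply_apply x, hr, fun y => ?_⟩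
  · intro x hx
    rw [xi, ← intervalIntegral.integral_const_mul]
    refine intervalIntegral.integral_congr fun s hs => ?_
    rw [Set.uIcc_of_le hx.1] at hs
    exact hσe s ⟨hs.1, hs.2.trans hx.2⟩
  · exact (hd _).of_local_left_inverse e.symm.continuous.continuousAt (hσ0 _).ne'
      (Eventually.of_forall hr)

namespace IsChart

variable {σ Ξ X : ℝ → ℝ}

theorem strictMono (h : IsChart ε μ b σ Ξ X) : StrictMono Ξ :=
  strictMono_of_hasDerivAt_pos h.hasDerivAt h.deriv_pos

theorem apply_zero (h : IsChart ε μ b σ Ξ X) (hb : 0 < b) : Ξ 0 = 0 := by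
  rw [h.eq_xi 0 ⟨le_rfl, hb.le⟩, xi, intervalIntegral.integral_same, mul_zero]

theorem apply_right (h : IsChart ε μ b σ Ξ X) (hb : 0 < b) : Ξ b = xi ε μ b :=
  h.eq_xi b ⟨hb.le, le_rfl⟩

theorem inv_zero (h : IsChart ε μ b σ Ξ X) (hb : 0 < b) : X 0 = 0 := by
  rw [← h.apply_zero hb, h.left_inv, h.apply_zero hb]

theorem inv_mem_Icc (h : IsChart ε μ b σ Ξ X) (hb : 0 < b) {y : ℝ}
    (hy : y ∈ Set.Icc 0 (xi ε μ b)) : X y ∈ Set.Icc 0 b := by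
  rw [Set.mem_Icc, ← h.strictMono.le_iff_le (a := 0), ← h.strictMono.le_iff_le (b := b), h.right_inv,
    h.apply_zero hb, h.apply_right hb]
  exact hy

theorem inv_mem_Ioo (h : IsChart ε μ b σ Ξ X) (hb : 0 < b) {y : ℝ}
    (hy : y ∈ Set.Ioo 0 (xi ε μ b)) : X y ∈ Set.Ioo 0 b := by
  rw [Set.mem_Ioo, ← h.strictMono.lt_iff_lt (a := 0), ← h.strictMono.lt_iff_lt (b := b), h.right_inv,
    h.apply_zero hb, h.apply_right hb]
  exact hy

theorem mem_Icc (h : IsChart ε μ b σ Ξ X) (hb : 0 < b) {x : ℝ}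
    (hx : x ∈ Set.Icc 0 b) : Ξ x ∈ Set.Icc 0 (xi ε μ b) := by
  rw [← h.apply_zero hb, ← h.apply_right hb]
  exact ⟨h.strictMono.monotone hx.1, h.strictMono.monotone hx.2⟩

theorem mem_Ioo (h : IsChart ε μ b σ Ξ X) (hb : 0 < b) {x : ℝ}
    (hx : x ∈ Set.Ioo 0 b) : Ξ x ∈ Set.Ioo 0 (xi ε μ b) := by
  rw [← h.apply_zero hb, ← h.apply_right hb]
  exact ⟨h.strictMono hx.1, h.strictMono hx.2⟩

theorem xi_pos (h : IsChart ε μ b σ Ξ X) (hb : 0 < b) : 0 < xi ε μ b := by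
  rw [← h.apply_zero hb, ← h.apply_right hb]
  exact h.strictMono hb

theorem contDiff (h : IsChart ε μ b σ Ξ X) : ContDiff ℝ 1 Ξ := by
  rw [contDiff_one_iff_deriv]
  refine ⟨fun x => (h.hasDerivAt x).differentiableAt, ?_⟩
  rw [show deriv Ξ = σ from funext fun x => (h.hasDerivAt x).deriv]
  exact h.continuous_deriv

theorem contDiff_inv (h : IsChart ε μ b σ Ξ X) : ContDiff ℝ 1 X := by
  have hd : Differentiable ℝ X := fun y => (h.hasDerivAt_inv y).differentiableAt
  rw [contDiff_one_iff_deriv]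
  refine ⟨hd, ?_⟩
  rw [show deriv X = fun y => (σ (X y))⁻¹ from funext fun y => (h.hasDerivAt_inv y).deriv]
  exact (h.continuous_deriv.comp hd.continuous).inv₀ fun y => (h.deriv_pos _).ne'

theorem xiInv_eq (h : IsChart ε μ b σ Ξ X) (hb : 0 < b) {y : ℝ}
    (hy : y ∈ Set.Icc 0 (xi ε μ b)) : xiInv ε μ b y = X y := by
  have hX := h.inv_mem_Icc hb hy
  have hex : ∃ x ∈ Set.Icc 0 b, xi ε μ x = y := ⟨X y, hX, by rw [← h.eq_xi _ hX, h.right_inv]⟩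
  have h1 := Function.invFunOn_mem hex
  have h2 := Function.invFunOn_eq hex
  rw [← h.eq_xi _ h1] at h2
  rw [xiInv, ← h2, h.left_inv, h2]

theorem vekuaF_eq (h : IsChart ε μ b σ Ξ X) (hb : 0 < b) (hμ : 0 < μ)
    (hpos : ∀ x ∈ Set.Icc 0 b, 0 < ε x) :
    Set.EqOn (vekuaF ε μ b) (fun y => amplitude ε μ (X y) / amplitude ε μ 0)
      (Set.Icc 0 (xi ε μ b)) := by
  intro y hy
  have hX := h.inv_mem_Icc hb hy
  rw [vekuaF, h.xiInv_eq hb hy, h.xiInv_eq hb ⟨le_rfl, (h.xi_pos hb).le⟩, h.inv_zero hb]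
  exact sqrt_speed_div hμ (hpos _ hX) (hpos _ ⟨le_rfl, hb.le⟩)

theorem mem_vekuaDomain (h : IsChart ε μ b σ Ξ X) (hb : 0 < b) {x t : ℝ}
    (hx : (x, t) ∈ domain ε μ b α β) : (Ξ x, t) ∈ Vekua.domain (xi ε μ b) α β := by
  obtain ⟨h1, h2, h3, h4⟩ := hx
  have hΞ := h.mem_Icc hb ⟨h1, h2⟩
  rw [← h.eq_xi _ ⟨h1, h2⟩] at h3 h4
  exact ⟨hΞ.1, hΞ.2, h3, h4⟩

theorem mem_vekuaOpenDomain (h : IsChart ε μ b σ Ξ X) (hb : 0 < b) {x t : ℝ}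
    (hx : (x, t) ∈ openDomain ε μ b α β) : (Ξ x, t) ∈ Vekua.openDomain (xi ε μ b) α β := by
  obtain ⟨h1, h2, h3, h4⟩ := hx
  have hΞ := h.mem_Ioo hb ⟨h1, h2⟩
  rw [← h.eq_xi _ ⟨h1.le, h2.le⟩] at h3 h4
  exact ⟨hΞ.1, hΞ.2, h3, h4⟩

theorem inv_mem_domain (h : IsChart ε μ b σ Ξ X) (hb : 0 < b) {y t : ℝ}
    (hy : (y, t) ∈ Vekua.domain (xi ε μ b) α β) : (X y, t) ∈ domain ε μ b α β := by
  obtain ⟨h1, h2, h3, h4⟩ := hy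
  have hX := h.inv_mem_Icc hb ⟨h1, h2⟩
  refine ⟨hX.1, hX.2, ?_, ?_⟩ <;> rw [← h.eq_xi _ hX, h.right_inv] <;> assumption

theorem inv_mem_openDomain (h : IsChart ε μ b σ Ξ X) (hb : 0 < b) {y t : ℝ}
    (hy : (y, t) ∈ Vekua.openDomain (xi ε μ b) α β) : (X y, t) ∈ openDomain ε μ b α β := by
  obtain ⟨h1, h2, h3, h4⟩ := hy
  have hX := h.inv_mem_Ioo hb ⟨h1, h2⟩
  refine ⟨hX.1, hX.2, ?_, ?_⟩ <;> rw [← h.eq_xi _ (Set.Ioo_subset_Icc_self hX), h.right_inv] <;>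
    assumption

theorem isOpen_openDomain (h : IsChart ε μ b σ Ξ X) (hb : 0 < b) :
    IsOpen (openDomain ε μ b α β) := by
  -- The domain is defined by `xi`, which is controlled only on [0, b]; there it coincides with Ξ,
  -- which is continuous everywhere.
  have e : openDomain ε μ b α β =
      (fun x : ℝ × ℝ => (Ξ x.1, x.2)) ⁻¹' Vekua.openDomain (xi ε μ b) α β := by
    ext ⟨x, t⟩
    refine ⟨fun hx => h.mem_vekuaOpenDomain hb hx, fun hx => ?_⟩
    have := h.inv_mem_openDomain hb hx
    rwa [h.left_inv] at this
  rw [e]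
  have := h.contDiff.continuous
  exact (Vekua.isOpen_openDomain _ _ _).preimage (by fun_prop)

end IsChart

end Maxwell

/-! ### Equivalence of the Maxwell and Vekua problems -/

theorem ContDiffOn.hasDerivAt_partial {E : Type*} [NormedAddCommGroup E] [NormedSpace ℝ E]
    {G : ℝ → ℝ → E} {s : Set (ℝ × ℝ)} (hs : IsOpen s) (hG : ContDiffOn ℝ 1 (Function.uncurry G) s)
    {x t : ℝ} (hx : (x, t) ∈ s) :
    HasDerivAt (fun r => G r t) (deriv (fun r => G r t) x) x ∧
      HasDerivAt (fun r => G x r) (deriv (fun r => G x r) t) t := by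
  have hd : DifferentiableAt ℝ (Function.uncurry G) (x, t) :=
    (hG.differentiableOn one_ne_zero).differentiableAt (hs.mem_nhds hx)
  constructor
  · exact (DifferentiableAt.comp (g := Function.uncurry G) (f := fun r => (r, t)) x hd
      (by fun_prop)).hasDerivAt
  · exact (DifferentiableAt.comp (g := Function.uncurry G) (f := fun r => (x, r)) t hd
      (by fun_prop)).hasDerivAt

namespace Maxwell

open Bicomplex Filter Topology

variable {ε : ℝ → ℝ} {μ b α β : ℝ} {E₀ H₀ : ℝ → ℂ} {σ Ξ X : ℝ → ℝ}

/-- The electric field obtained from a solution of the Vekua equation. -/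
noncomputable def electric (ε : ℝ → ℝ) (μ : ℝ) (W : ℝ → ℝ → Bicomplex) (x t : ℝ) : ℂ :=
  ((1 / √(speed ε μ x * ε x) : ℝ) : ℂ) * (W (xi ε μ x) t).re

/-- The magnetic field obtained from a solution of the Vekua equation. -/
noncomputable def magnetic (ε : ℝ → ℝ) (μ : ℝ) (W : ℝ → ℝ → Bicomplex) (x t : ℝ) : ℂ :=
  -(Complex.I / ((√(speed ε μ x * μ) : ℝ) : ℂ)) * (W (xi ε μ x) t).im

/-- The bicomplex function obtained from an electromagnetic field by the change of variable with
inverse `X`. -/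
noncomputable def fieldToVekua (ε : ℝ → ℝ) (μ : ℝ) (X : ℝ → ℝ) (E H : ℝ → ℝ → ℂ) (ξ t : ℝ) :
    Bicomplex :=
  ⟨(amplitude ε μ (X ξ) : ℂ) * E (X ξ) t, Complex.I * ((amplitude ε μ (X ξ) : ℂ)⁻¹ * H (X ξ) t)⟩

theorem vekuaData_eq (hμ : 0 < μ) (hε : 0 < ε 0) (t : ℝ) :
    vekuaData ε μ E₀ H₀ t =
      ⟨(amplitude ε μ 0 : ℂ) * E₀ t, Complex.I * ((amplitude ε μ 0 : ℂ)⁻¹ * H₀ t)⟩ := by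
  rw [vekuaData, sqrt_speed_mul hμ hε, ← amplitude]
  ext <;> simp [ofComplex, j]

theorem contDiffOn_vekuaData (hμ : 0 < μ) (hε : 0 < ε 0) (hE₀ : ContDiffOn ℝ 1 E₀ (Set.Icc α β))
    (hH₀ : ContDiffOn ℝ 1 H₀ (Set.Icc α β)) :
    ContDiffOn ℝ 1 (vekuaData ε μ E₀ H₀) (Set.Icc α β) := by
  rw [show vekuaData ε μ E₀ H₀ = _ from funext fun t => vekuaData_eq hμ hε t]
  exact contDiffOn_mk (contDiffOn_const.mul hE₀) (contDiffOn_const.mul (contDiffOn_const.mul hH₀))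

theorem electric_eq {W : ℝ → ℝ → Bicomplex} (h : IsChart ε μ b σ Ξ X) {x : ℝ}
    (hx : x ∈ Set.Icc 0 b) (t : ℝ) :
    electric ε μ W x t = (amplitude ε μ x : ℂ)⁻¹ * (W (Ξ x) t).re := by
  rw [electric, ← amplitude, h.eq_xi x hx, one_div, Complex.ofReal_inv]

theorem magnetic_eq {W : ℝ → ℝ → Bicomplex} (h : IsChart ε μ b σ Ξ X) (hμ : 0 < μ) {x : ℝ}
    (hε : 0 < ε x) (hx : x ∈ Set.Icc 0 b) (t : ℝ) :
    magnetic ε μ W x t = -Complex.I * ((amplitude ε μ x : ℂ) * (W (Ξ x) t).im) := by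
  rw [magnetic, sqrt_speed_mul hμ hε, h.eq_xi x hx, Complex.ofReal_inv, div_inv_eq_mul]
  ring

theorem hasDerivAt_amplitude (hμ : 0 < μ) (hε : ContDiffOn ℝ 1 ε (Set.Icc 0 b))
    (hpos : ∀ x ∈ Set.Icc 0 b, 0 < ε x) {x : ℝ} (hx : x ∈ Set.Ioo 0 b) :
    HasDerivAt (amplitude ε μ) (deriv (amplitude ε μ) x) x :=
  (((contDiffOn_amplitude hμ hε hpos).differentiableOn one_ne_zero).differentiableAt
    (Icc_mem_nhds hx.1 hx.2)).hasDerivAt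

namespace IsChart

theorem contDiffOn_vekuaF (h : IsChart ε μ b σ Ξ X) (hb : 0 < b) (hμ : 0 < μ)
    (hε : ContDiffOn ℝ 1 ε (Set.Icc 0 b)) (hpos : ∀ x ∈ Set.Icc 0 b, 0 < ε x) :
    ContDiffOn ℝ 1 (vekuaF ε μ b) (Set.Icc 0 (xi ε μ b)) := by
  refine ContDiffOn.congr ?_ (h.vekuaF_eq hb hμ hpos)
  exact ((contDiffOn_amplitude hμ hε hpos).comp h.contDiff_inv.contDiffOn
    fun y hy => h.inv_mem_Icc hb hy).div_const _

theorem vekuaF_ne_zero (h : IsChart ε μ b σ Ξ X) (hb : 0 < b) (hμ : 0 < μ)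
    (hpos : ∀ x ∈ Set.Icc 0 b, 0 < ε x) : ∀ y ∈ Set.Icc 0 (xi ε μ b), vekuaF ε μ b y ≠ 0 := by
  intro y hy
  rw [h.vekuaF_eq hb hμ hpos hy]
  exact div_ne_zero (amplitude_pos hμ (hpos _ (h.inv_mem_Icc hb hy))).ne'
    (amplitude_pos hμ (hpos _ ⟨le_rfl, hb.le⟩)).ne'

theorem vekuaF_zero (h : IsChart ε μ b σ Ξ X) (hb : 0 < b) (hμ : 0 < μ)
    (hpos : ∀ x ∈ Set.Icc 0 b, 0 < ε x) : vekuaF ε μ b 0 = 1 := by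
  rw [h.vekuaF_eq hb hμ hpos ⟨le_rfl, (h.xi_pos hb).le⟩]
  dsimp only
  rw [h.inv_zero hb]
  exact div_self (amplitude_pos hμ (hpos _ ⟨le_rfl, hb.le⟩)).ne'

theorem deriv_vekuaF_div (h : IsChart ε μ b σ Ξ X) (hb : 0 < b) (hμ : 0 < μ)
    (hε : ContDiffOn ℝ 1 ε (Set.Icc 0 b)) (hpos : ∀ x ∈ Set.Icc 0 b, 0 < ε x) {y : ℝ}
    (hy : y ∈ Set.Ioo 0 (xi ε μ b)) :
    deriv (vekuaF ε μ b) y / (2 * vekuaF ε μ b y) =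
      deriv (amplitude ε μ) (X y) / (σ (X y) * amplitude ε μ (X y)) / 2 := by
  have hX := h.inv_mem_Ioo hb hy
  have h1 : vekuaF ε μ b =ᶠ[𝓝 y] fun y => amplitude ε μ (X y) / amplitude ε μ 0 := by
    filter_upwards [isOpen_Ioo.mem_nhds hy] with z hz using
      h.vekuaF_eq hb hμ hpos (Set.Ioo_subset_Icc_self hz)
  have h2 : HasDerivAt (fun y => amplitude ε μ (X y) / amplitude ε μ 0)
      (deriv (amplitude ε μ) (X y) * (σ (X y))⁻¹ / amplitude ε μ 0) y :=
    ((hasDerivAt_amplitude hμ hε hpos hX).comp y (h.hasDerivAt_inv y)).div_const _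
  rw [h1.deriv_eq, h1.eq_of_nhds, h2.deriv]
  have k1 := (amplitude_pos hμ (hpos _ (Set.Ioo_subset_Icc_self hX))).ne'
  have k2 := (amplitude_pos hμ (hpos 0 ⟨le_rfl, hb.le⟩)).ne'
  have k3 := (h.deriv_pos (X y)).ne'
  field_simp

theorem contDiffOn_electric_magnetic (h : IsChart ε μ b σ Ξ X) (hb : 0 < b) (hμ : 0 < μ)
    (hε : ContDiffOn ℝ 1 ε (Set.Icc 0 b)) (hpos : ∀ x ∈ Set.Icc 0 b, 0 < ε x)
    {W : ℝ → ℝ → Bicomplex}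
    (hW : ContDiffOn ℝ 1 (Function.uncurry W) (Vekua.domain (xi ε μ b) α β)) :
    ContDiffOn ℝ 1 (Function.uncurry (electric ε μ W)) (domain ε μ b α β) ∧
      ContDiffOn ℝ 1 (Function.uncurry (magnetic ε μ W)) (domain ε μ b α β) := by
  have hmaps : Set.MapsTo (fun p : ℝ × ℝ => (Ξ p.1, p.2)) (domain ε μ b α β)
      (Vekua.domain (xi ε μ b) α β) := fun p hp => h.mem_vekuaDomain hb hp
  have hΞ : ContDiffOn ℝ 1 (fun p : ℝ × ℝ => (Ξ p.1, p.2)) (domain ε μ b α β) :=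
    ((h.contDiff.comp contDiff_fst).prodMk contDiff_snd).contDiffOn
  have hW' := hW.comp hΞ hmaps
  have ha : ContDiffOn ℝ 1 (fun p : ℝ × ℝ => amplitude ε μ p.1) (domain ε μ b α β) :=
    (contDiffOn_amplitude hμ hε hpos).comp contDiff_fst.contDiffOn fun p hp => ⟨hp.1, hp.2.1⟩
  have ha' := Complex.ofRealCLM.contDiff.comp_contDiffOn ha
  constructor
  · refine ((ha'.inv fun p hp => ?_).mul (reL.contDiff.comp_contDiffOn hW')).congr ?_
    · exact Complex.ofReal_ne_zero.2 (amplitude_pos hμ (hpos _ ⟨hp.1, hp.2.1⟩)).ne'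
    · exact fun p hp => electric_eq h ⟨hp.1, hp.2.1⟩ p.2
  · refine ((contDiffOn_const (c := -Complex.I)).mul (ha'.mul (imL.contDiff.comp_contDiffOn hW'))).congr ?_
    exact fun p hp => magnetic_eq h hμ (hpos _ ⟨hp.1, hp.2.1⟩) ⟨hp.1, hp.2.1⟩ p.2

/-- With E = u/a and H = -iav, the terms produced by differentiating a are cancelled by the
coefficient f'/f = a'/(σa). What remains is u_ξ = v_t, v_ξ = u_t up to factors supplied by ε = σa²
and μ = σ/a². -/
theorem isSolution_electric_magnetic (h : IsChart ε μ b σ Ξ X) (hb : 0 < b) (hμ : 0 < μ)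
    (hε : ContDiffOn ℝ 1 ε (Set.Icc 0 b)) (hpos : ∀ x ∈ Set.Icc 0 b, 0 < ε x)
    {W : ℝ → ℝ → Bicomplex}
    (hW : ContDiffOn ℝ 1 (Function.uncurry W) (Vekua.domain (xi ε μ b) α β))
    (hsol : Vekua.IsSolution (vekuaF ε μ b) (xi ε μ b) α β (vekuaData ε μ E₀ H₀) W) :
    IsSolution ε μ b α β E₀ H₀ (electric ε μ W) (magnetic ε μ W) := by
  obtain ⟨hE, hH⟩ := h.contDiffOn_electric_magnetic hb hμ hε hpos hW
  have hsub : openDomain ε μ b α β ⊆ domain ε μ b α β :=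
    fun _ h => ⟨h.1.le, h.2.1.le, h.2.2.1.le, h.2.2.2.le⟩
  have h0 : (0 : ℝ) ∈ Set.Icc 0 b := ⟨le_rfl, hb.le⟩
  have hε0 := hpos 0 h0
  have ha0 : (amplitude ε μ 0 : ℂ) ≠ 0 := Complex.ofReal_ne_zero.2 (amplitude_pos hμ hε0).ne'
  have key : ∀ x t : ℝ, (x, t) ∈ openDomain ε μ b α β →
      (ε x : ℂ) * deriv (fun s => electric ε μ W x s) t =
        Complex.I * deriv (fun s => magnetic ε μ W s t) x ∧
      Complex.I * deriv (fun s => electric ε μ W s t) x =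
        -(μ : ℂ) * deriv (fun s => magnetic ε μ W x s) t := by
    intro x t hx
    have hxI : x ∈ Set.Ioo 0 b := ⟨hx.1, hx.2.1⟩
    have hxc := Set.Ioo_subset_Icc_self hxI
    have hy := h.mem_vekuaOpenDomain hb hx
    obtain ⟨d1, d2⟩ := hsol.contDiffOn.hasDerivAt_partial (Vekua.isOpen_openDomain _ _ _) hy
    have eq := hsol.equation _ _ hy
    rw [h.deriv_vekuaF_div hb hμ hε hpos ⟨hy.1, hy.2.1⟩, Vekua.dbar, Vekua.equation_iff,
      h.left_inv] at eq
    set A := deriv (fun r => W r t) (Ξ x)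
    set B := deriv (fun r => W (Ξ x) r) t
    have ha := (hasDerivAt_amplitude hμ hε hpos hxI).ofReal_comp
    have hane : (amplitude ε μ x : ℂ) ≠ 0 :=
      Complex.ofReal_ne_zero.2 (amplitude_pos hμ (hpos x hxc)).ne'
    have hσne : (σ x : ℂ) ≠ 0 := Complex.ofReal_ne_zero.2 (h.deriv_pos x).ne'
    have d1' : HasDerivAt (fun s => W (Ξ s) t) (σ x • A) x := d1.scomp x (h.hasDerivAt x)
    have hev : ∀ᶠ s in 𝓝 x, s ∈ Set.Icc 0 b := Icc_mem_nhds hxI.1 hxI.2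
    have eEx : HasDerivAt (fun s => electric ε μ W s t) _ x :=
      ((ha.inv hane).mul (reL.hasFDerivAt.comp_hasDerivAt x d1')).congr_of_eventuallyEq
        (hev.mono fun s hs => electric_eq h hs t)
    have eHx : HasDerivAt (fun s => magnetic ε μ W s t) _ x :=
      ((ha.mul (imL.hasFDerivAt.comp_hasDerivAt x d1')).const_mul
        (-Complex.I)).congr_of_eventuallyEq
        (hev.mono fun s hs => magnetic_eq h hμ (hpos s hs) hs t)
    have eEt : HasDerivAt (fun s => electric ε μ W x s) _ t :=
      ((reL.hasFDerivAt.comp_hasDerivAt t d2).const_mul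
        (amplitude ε μ x : ℂ)⁻¹).congr_of_eventuallyEq
        (Eventually.of_forall fun s => electric_eq h hxc s)
    have eHt : HasDerivAt (fun s => magnetic ε μ W x s) _ t :=
      (((imL.hasFDerivAt.comp_hasDerivAt t d2).const_mul
        (amplitude ε μ x : ℂ)).const_mul (-Complex.I)).congr_of_eventuallyEq
        (Eventually.of_forall fun s => magnetic_eq h hμ (hpos x hxc) hxc s)
    have k1 : (ε x : ℂ) = σ x * (amplitude ε μ x : ℂ) ^ 2 := by
      rw [h.deriv_eq x hxc]
      exact_mod_cast eq_sqrt_mul_amplitude_sq hμ (hpos x hxc)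
    have k2 : (μ : ℂ) = σ x / (amplitude ε μ x : ℂ) ^ 2 := by
      rw [h.deriv_eq x hxc]
      exact_mod_cast eq_sqrt_div_amplitude_sq hμ (hpos x hxc)
    rw [eEx.deriv, eHx.deriv, eEt.deriv, eHt.deriv, k1, k2]
    obtain ⟨e1, e2⟩ := eq
    simp only [plus, minus] at e1 e2
    push_cast at e1 e2
    -- Half the sum and half the difference of the idempotent equations return the j-components: u_ξ
    -- = v_t + qu, and next v_ξ = u_t - qv.
    have hAre : A.re = B.im + deriv (amplitude ε μ) x / (σ x * amplitude ε μ x) * (W (Ξ x) t).re := by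
      linear_combination (e1 + e2) / 2
    have hAim : A.im = B.re - deriv (amplitude ε μ) x / (σ x * amplitude ε μ x) * (W (Ξ x) t).im := by
      linear_combination (e1 - e2) / 2
    have hI : ∀ z : ℂ, Complex.I * (-Complex.I * z) = z := fun z => by
      linear_combination -z * Complex.I_mul_I
    simp only [map_smul, reL_apply, imL_apply, Complex.real_smul, Function.comp, Pi.inv_apply, hI, hAre,
      hAim]
    constructor
    · field_simp
      ring
    · field_simp
      ring
  refine ⟨hE.continuousOn, hH.continuousOn, hE.mono hsub, hH.mono hsub,
    fun x t hx => (key x t hx).1, fun x t hx => (key x t hx).2, fun t ht => ?_, fun t ht => ?_⟩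
  · rw [electric_eq h h0, h.apply_zero hb, hsol.initial t ht, vekuaData_eq hμ hε0]
    simp [ha0]
  · rw [magnetic_eq h hμ hε0 h0, h.apply_zero hb, hsol.initial t ht, vekuaData_eq hμ hε0]
    field_simp
    simp

/-- This converse substitution serves uniqueness: any Maxwell solution becomes a solution of the
Vekua problem, where uniqueness is known. -/
theorem isSolution_fieldToVekua (h : IsChart ε μ b σ Ξ X) (hb : 0 < b) (hμ : 0 < μ)
    (hε : ContDiffOn ℝ 1 ε (Set.Icc 0 b)) (hpos : ∀ x ∈ Set.Icc 0 b, 0 < ε x)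
    {E H : ℝ → ℝ → ℂ} (hsol : IsSolution ε μ b α β E₀ H₀ E H) :
    Vekua.IsSolution (vekuaF ε μ b) (xi ε μ b) α β (vekuaData ε μ E₀ H₀)
      (fieldToVekua ε μ X E H) := by
  have hmaps : Set.MapsTo (fun p : ℝ × ℝ => (X p.1, p.2)) (Vekua.domain (xi ε μ b) α β)
      (domain ε μ b α β) := fun p hp => h.inv_mem_domain hb hp
  have hmaps' : Set.MapsTo (fun p : ℝ × ℝ => (X p.1, p.2)) (Vekua.openDomain (xi ε μ b) α β)
      (openDomain ε μ b α β) := fun p hp => h.inv_mem_openDomain hb hp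
  have hX : ContDiff ℝ 1 (fun p : ℝ × ℝ => (X p.1, p.2)) :=
    (h.contDiff_inv.comp contDiff_fst).prodMk contDiff_snd
  have ha : ContDiffOn ℝ 1 (fun p : ℝ × ℝ => (amplitude ε μ (X p.1) : ℂ))
      (Vekua.domain (xi ε μ b) α β) :=
    Complex.ofRealCLM.contDiff.comp_contDiffOn ((contDiffOn_amplitude hμ hε hpos).comp
      (h.contDiff_inv.comp contDiff_fst).contDiffOn fun p hp => h.inv_mem_Icc hb ⟨hp.1, hp.2.1⟩)
  have hane : ∀ p ∈ Vekua.domain (xi ε μ b) α β, (amplitude ε μ (X p.1) : ℂ) ≠ 0 := fun p hp =>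
    Complex.ofReal_ne_zero.2 (amplitude_pos hμ (hpos _ (h.inv_mem_Icc hb ⟨hp.1, hp.2.1⟩))).ne'
  have ha' := ha.inv hane
  refine ⟨?_, ?_, ?_, ?_⟩
  · exact equivProdL.symm.continuous.comp_continuousOn
      ((ha.continuousOn.mul (hsol.continuousOn_E.comp hX.continuous.continuousOn hmaps)).prodMk
        (continuousOn_const.mul (ha'.continuousOn.mul
          (hsol.continuousOn_H.comp hX.continuous.continuousOn hmaps))))
  · have hsub := Vekua.openDomain_subset_domain (L := xi ε μ b) (α := α) (β := β)
    exact contDiffOn_mk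
      ((ha.mono hsub).mul (hsol.contDiffOn_E.comp hX.contDiffOn hmaps'))
      (contDiffOn_const.mul ((ha'.mono hsub).mul (hsol.contDiffOn_H.comp hX.contDiffOn hmaps')))
  · intro y t hy
    have hyI : y ∈ Set.Ioo 0 (xi ε μ b) := ⟨hy.1, hy.2.1⟩
    have hx := h.inv_mem_openDomain hb hy
    have hxI := h.inv_mem_Ioo hb hyI
    have hxc := Set.Ioo_subset_Icc_self hxI
    obtain ⟨dE1, dE2⟩ := hsol.contDiffOn_E.hasDerivAt_partial (h.isOpen_openDomain hb) hx
    obtain ⟨dH1, dH2⟩ := hsol.contDiffOn_H.hasDerivAt_partial (h.isOpen_openDomain hb) hx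
    have eqE := hsol.equation_E _ _ hx
    have eqH := hsol.equation_H _ _ hx
    have hane' : (amplitude ε μ (X y) : ℂ) ≠ 0 := hane (y, t) (Vekua.openDomain_subset_domain hy)
    have hσne : (σ (X y) : ℂ) ≠ 0 := Complex.ofReal_ne_zero.2 (h.deriv_pos (X y)).ne'
    have da := ((hasDerivAt_amplitude hμ hε hpos hxI).comp y (h.hasDerivAt_inv y)).ofReal_comp
    have k1 : (ε (X y) : ℂ) = σ (X y) * (amplitude ε μ (X y) : ℂ) ^ 2 := by
      rw [h.deriv_eq _ hxc]
      exact_mod_cast eq_sqrt_mul_amplitude_sq hμ (hpos _ hxc)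
    have k2 : (μ : ℂ) = σ (X y) / (amplitude ε μ (X y) : ℂ) ^ 2 := by
      rw [h.deriv_eq _ hxc]
      exact_mod_cast eq_sqrt_div_amplitude_sq hμ (hpos _ hxc)
    have dξ : HasDerivAt (fun s => fieldToVekua ε μ X E H s t) _ y := hasDerivAt_mk
      (da.mul (dE1.scomp y (h.hasDerivAt_inv y)))
      (((da.inv hane').mul (dH1.scomp y (h.hasDerivAt_inv y))).const_mul Complex.I)
    have dt : HasDerivAt (fun s => fieldToVekua ε μ X E H y s) _ t := hasDerivAt_mk
      (dE2.const_mul (amplitude ε μ (X y) : ℂ))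
      ((dH2.const_mul (amplitude ε μ (X y) : ℂ)⁻¹).const_mul Complex.I)
    rw [h.deriv_vekuaF_div hb hμ hε hpos hyI, Vekua.dbar, dξ.deriv, dt.deriv, Vekua.equation_iff]
    rw [k1] at eqE
    rw [k2] at eqH
    set P := deriv (fun r => E r t) (X y)
    set P' := deriv (fun r => E (X y) r) t
    set R := deriv (fun r => H r t) (X y)
    set R' := deriv (fun r => H (X y) r) t
    -- The Maxwell equations solved for the x-derivatives, so that only t-derivatives remain to be
    -- compared.
    have hP : P = Complex.I * (σ (X y) / (amplitude ε μ (X y) : ℂ) ^ 2) * R' := by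
      linear_combination -Complex.I * eqH + P * Complex.I_mul_I
    have hR : R = -Complex.I * (σ (X y) * (amplitude ε μ (X y) : ℂ) ^ 2) * P' := by
      linear_combination Complex.I * eqE + R * Complex.I_mul_I
    simp only [plus, minus, fieldToVekua, Complex.real_smul, Function.comp, Pi.inv_apply, hP,
      hR]
    push_cast
    constructor
    · field_simp
      ring_nf
      rw [Complex.I_sq]
      ring
    · field_simp
      ring_nf
      rw [Complex.I_sq]
      ring
  · intro t ht
    rw [vekuaData_eq hμ (hpos 0 ⟨le_rfl, hb.le⟩), fieldToVekua, h.inv_zero hb,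
      hsol.initial_E t ht, hsol.initial_H t ht]

theorem eq_electric_and_eq_magnetic (h : IsChart ε μ b σ Ξ X) (hb : 0 < b) (hμ : 0 < μ)
    (hpos : ∀ x ∈ Set.Icc 0 b, 0 < ε x) {W : ℝ → ℝ → Bicomplex} {E H : ℝ → ℝ → ℂ}
    (hW : ∀ ξ t : ℝ, (ξ, t) ∈ Vekua.domain (xi ε μ b) α β → fieldToVekua ε μ X E H ξ t = W ξ t)
    {x t : ℝ} (hx : (x, t) ∈ domain ε μ b α β) :
    E x t = electric ε μ W x t ∧ H x t = magnetic ε μ W x t := by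
  have hxI : x ∈ Set.Icc 0 b := ⟨hx.1, hx.2.1⟩
  have ha : (amplitude ε μ x : ℂ) ≠ 0 :=
    Complex.ofReal_ne_zero.2 (amplitude_pos hμ (hpos x hxI)).ne'
  rw [electric_eq h hxI, magnetic_eq h hμ (hpos x hxI) hxI, ← hW _ _ (h.mem_vekuaDomain hb hx),
    fieldToVekua, h.left_inv]
  constructor
  · field_simp
  · field_simp
    linear_combination H x t * Complex.I_mul_I

end IsChart

end Maxwell

theorem theorem1 :
    -- the Cauchy problem for the hyperbolic Vekua equation
    (∀ (f : ℝ → ℝ) (L α β : ℝ) (W₀ : ℝ → Bicomplex), 0 < L → α < β →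
      ContDiffOn ℝ 1 f (Set.Icc 0 L) → (∀ ξ ∈ Set.Icc 0 L, f ξ ≠ 0) → f 0 = 1 →
      ContDiffOn ℝ 1 W₀ (Set.Icc α β) →
      ∃ W : ℝ → ℝ → Bicomplex,
        Vekua.IsSolution f L α β W₀ W ∧
        ContDiffOn ℝ 1 (Function.uncurry W) (Vekua.domain L α β) ∧
        (∀ V : ℝ → ℝ → Bicomplex, Vekua.IsSolution f L α β W₀ V →
          ∀ ξ t : ℝ, (ξ, t) ∈ Vekua.domain L α β → V ξ t = W ξ t) ∧
        Vekua.HasSeriesForm f L α β W₀ W) ∧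
    -- the Cauchy problem for the Maxwell system
    (∀ (ε : ℝ → ℝ) (μ b α β : ℝ) (E₀ H₀ : ℝ → ℂ), 0 < b → α < β → 0 < μ →
      ContDiffOn ℝ 1 ε (Set.Icc 0 b) → (∀ x ∈ Set.Icc 0 b, 0 < ε x) →
      ContDiffOn ℝ 1 E₀ (Set.Icc α β) → ContDiffOn ℝ 1 H₀ (Set.Icc α β) →
      ∃ (E H : ℝ → ℝ → ℂ) (W : ℝ → ℝ → Bicomplex),
        Maxwell.IsSolution ε μ b α β E₀ H₀ E H ∧
        ContDiffOn ℝ 1 (Function.uncurry E) (Maxwell.domain ε μ b α β) ∧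
        ContDiffOn ℝ 1 (Function.uncurry H) (Maxwell.domain ε μ b α β) ∧
        (∀ E' H' : ℝ → ℝ → ℂ, Maxwell.IsSolution ε μ b α β E₀ H₀ E' H' →
          ∀ x t : ℝ, (x, t) ∈ Maxwell.domain ε μ b α β → E' x t = E x t ∧ H' x t = H x t) ∧
        Vekua.IsSolution (Maxwell.vekuaF ε μ b) (Maxwell.xi ε μ b) α β
          (Maxwell.vekuaData ε μ E₀ H₀) W ∧
        Vekua.HasSeriesForm (Maxwell.vekuaF ε μ b) (Maxwell.xi ε μ b) α β
          (Maxwell.vekuaData ε μ E₀ H₀) W ∧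
        ∀ x t : ℝ, (x, t) ∈ Maxwell.domain ε μ b α β →
          E x t = ((1 / √(Maxwell.speed ε μ x * ε x) : ℝ) : ℂ) * (W (Maxwell.xi ε μ x) t).re ∧
          H x t = -(Complex.I / ((√(Maxwell.speed ε μ x * μ) : ℝ) : ℂ)) *
            (W (Maxwell.xi ε μ x) t).im) := by

  refine ⟨Vekua.exists_unique_solution, ?_⟩
  intro ε μ b α β E₀ H₀ hb hαβ hμ hε hpos hE₀ hH₀
  obtain ⟨σ, Ξ, X, h⟩ := Maxwell.exists_isChart hb hμ hε.continuousOn hpos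
  obtain ⟨W, hsol, hW, huniq, hser⟩ := Vekua.exists_unique_solution (Maxwell.vekuaF ε μ b)
    (Maxwell.xi ε μ b) α β (Maxwell.vekuaData ε μ E₀ H₀) (h.xi_pos hb) hαβ
    (h.contDiffOn_vekuaF hb hμ hε hpos) (h.vekuaF_ne_zero hb hμ hpos) (h.vekuaF_zero hb hμ hpos)
    (Maxwell.contDiffOn_vekuaData hμ (hpos 0 ⟨le_rfl, hb.le⟩) hE₀ hH₀)
  obtain ⟨hE, hH⟩ := h.contDiffOn_electric_magnetic hb hμ hε hpos hW
  exact ⟨Maxwell.electric ε μ W, Maxwell.magnetic ε μ W, W,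
    h.isSolution_electric_magnetic hb hμ hε hpos hW hsol, hE, hH,
    fun E' H' hEH x t hx => h.eq_electric_and_eq_magnetic hb hμ hpos
      (huniq _ (h.isSolution_fieldToVekua hb hμ hε hpos hEH)) hx,
    hsol, hser, fun x t _ => ⟨rfl, rfl⟩⟩
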